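/- **Conventions.** A weak linear order on a finite set $U$ is an ordered partition $\psi=(B_1,\dots,B_p)$ of $U$ into nonempty classes; $x<_\psi y$ means that the class of $x$ comes strictly before that of $y$; $\overline\psi=(B_p,\dots,B_1)$; $\psi[W]$ is the restriction to $W\subseteq U$. A linear order is one whose classes are singletons. $\psi_1,\psi_2$ are *compatible* if there are no $x,y$ with $x<_{\psi_1}y$ and $y<_{\psi_2}x$. The *blocks* of a graph $G$ are the classes of the relation $N[x]=N[y]$ (equal closed neighbourhoods). A *straight enumeration* of $G$ is an ordering $(B_1,\dots,B_p)$ of its blocks such that, for each $i$, $B_i$ and the blocks adjacent to it are consecutive. The *level graphs* of a nonnegative symmetric matrix $A$ are, for the distinct nonzero values $\alpha_1<\dots<\alpha_L$ of its entries, the graphs $G^{(\ell)}$ with edges $\{x,y\}$, $x\ne y$, $A_{xy}\ge\alpha_\ell$. A symmetric matrix is *Robinson* if $A_{ik}\le\min\{A_{ij},A_{jk}\}$ for all $i\le j\le k$, and *Robinsonian* if $A_\pi=(A_{\pi(i)\pi(j)})$ is Robinson for some permutation $\pi$. **Subroutines.** *CO-Lex-BFS$(G,\psi)$*, for a graph $G=(V,E)$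 and a weak linear order $\psi=(B_1,\dots,B_p)$ of $V$. Give some vertex $u\in B_1$ the label $(|V|)$ and all others the empty label. For $i=|V|,\dots,1$: let $S$ be the set of unvisited vertices with lexicographically largest label, visit an arbitrary $p\in S$ coming first in $\psi$; if the label of $p$ is empty, first *close* the current component $V_\omega$ and open a new current component; put $p$ in the current component, next in the order $\sigma$, and append $i-1$ to the labels of its unvisited neighbours. At the end close the last component. To close $V_\omega$, let $B^{\min}_\omega,B^{\max}_\omega$ be the first and last classes of $\psi$ meeting $V_\omega$: stop if some class strictly between them is not contained in $V_\omega$; otherwise, if there is a preceding component $V_{\omega-1}$: if $V_\omega\subseteq B^{\min}_{\omega-1}$, swap $V_{\omega-1}$ and $V_\omega$ (also in $\sigma$); else stop if $B^{\min}_\omega<_\psi B^{\max}_{\omega-1}$. Return the components $(V_1,\dots,V_c)$ in order, and $\sigma$. *Lex-BFS+$(G,\sigma)$* is lexicographic breadth-first search with all labels initially empty and ties broken in favour of the vertex that comes last in $\sigma$. *Straight\_enumeration$(G,\sigma)$*: let $\sigma^{+}=$ Lex-BFS+$(G,\sigma)$ and $\sigma^{++}=$ Lex-BFS+$(G,\sigma^{+})$,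 and let $\mathrm{lmn}(v),\mathrm{rmn}(v)$ be the first and last positions in $\sigma^{++}$ of vertices of $N[v]$. Go through $v$ in the order $\sigma^{++}$: stop if $\mathrm{rmn}(v)-\mathrm{lmn}(v)\ne\deg_G(v)$; otherwise put $v$ in the current class if its pair $(\mathrm{lmn},\mathrm{rmn})$ is that of the current class, and in a new class if not. Return the sequence of classes. *Refine$(\psi,\phi)$*, with $\phi=(C_1,\dots,C_q)$ on $V$: let $B^{\max}$ be the last class of $\psi$ meeting $C_1$; if some class of $\psi$ before $B^{\max}$ is not contained in $C_1$, return $\emptyset$. Otherwise let $W=V\setminus C_1$ and $\Phi=(\psi[C_1])$ if $W=\emptyset$, $\Phi=(\psi[C_1],\mathrm{Refine}(\psi[W],\phi[W]))$ if not; return $\Phi$ if it is a weak linear order of $V$, and $\emptyset$ otherwise. **Algorithm Robinson$(A,\psi)$.** Let $G$ be the support graph of $A$ and run CO-Lex-BFS$(G,\psi)$. For $\omega=1,\dots,c$: let $\phi_\omega=$ Straight\_enumeration$(G[V_\omega],\sigma[V_\omega])$; let $\Phi_\omega=$ Refine$(\psi[V_\omega],\phi_\omega)$, or, if this is $\emptyset$,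 $\Phi_\omega=$ Refine$(\psi[V_\omega],\overline\phi_\omega)$; stop if this is $\emptyset$ too. Let $A'[V_\omega]$ be $A[V_\omega]$ with all entries equal to its smallest nonzero entry (if it has one) set to $0$. If $A'[V_\omega]$ is diagonal, append $\Phi_\omega$ to $\Phi$ (initially empty); otherwise append the result of Robinson$(A'[V_\omega],\Phi_\omega)$. Return $\Phi$. The algorithm stops as soon as a subroutine or a recursive call stops. **Algorithm Robinsonian$(A)$.** Run Robinson$(A,(V))$. If it stops, answer "not Robinsonian"; if it returns $\Phi$, return an arbitrary linear order $\pi$ of $V$ compatible with $\Phi$. **Theorem.** Let $A$ be a nonnegative symmetric $n\times n$ matrix, $V=[n]$. 1. Let $\psi$ be a weak linear order of $V$. Robinson$(A,\psi)$ always ends, by returning some $\Phi$ or by stopping, and for every choice that it may make: (i) if it returns $\Phi$, then $\Phi$ is a weak linear order of $V$ that is compatible with $\psi$, and there are straight enumerations $\phi^{(1)},\dots,\phi^{(L)}$ of the level graphs $G^{(1)},\dots,G^{(L)}$ of $A$ such that $\Phi$ is compatible with each of them; (ii) if it stops, then there do not exist straight enumerations of the level graphs of $A$ that are pairwise compatible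 and compatible with $\psi$. 2. Suppose moreover that $A_{ij}\le A_{ii}$ for all $i,j$. Then Robinsonian$(A)$ correctly decides whether $A$ is Robinsonian: it always ends; if it returns $\pi$, then $A_\pi$ is Robinson; if it answers "not Robinsonian", then $A$ is not Robinsonian. -/

import Mathlib

/-! ## Weak linear orders

A weak linear order on a finite set `U` is given as the list `(B₁, …, B_p)` of its classes. -/

section WeakOrders

variable {V : Type*} [DecidableEq V]

/-- The union of the classes of a list of sets. -/
def ground (ψ : List (Finset V)) : Finset V :=
  ψ.foldr (fun B U => B ∪ U) ∅

/-- `ψ = (B₁, …, B_p)` is an ordered partition of `U`, i.e. a weak linear order on `U`. -/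
def IsWeakOrder (ψ : List (Finset V)) (U : Finset V) : Prop :=
  (∀ B ∈ ψ, B.Nonempty) ∧ ψ.Pairwise (fun B C => Disjoint B C) ∧ ground ψ = U

instance (ψ : List (Finset V)) (U : Finset V) : Decidable (IsWeakOrder ψ U) := by
  unfold IsWeakOrder; infer_instance

/-- `x <_ψ y`: the class of `x` comes strictly before the class of `y`. -/
def WeakLT (ψ : List (Finset V)) (x y : V) : Prop :=
  ∃ i j : Fin ψ.length, i < j ∧ x ∈ ψ.get i ∧ y ∈ ψ.get j

/-- Two weak linear orders are compatible if no pair is ordered strictly in opposite ways. -/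
def Compatible (ψ₁ ψ₂ : List (Finset V)) : Prop :=
  ¬ ∃ x y : V, WeakLT ψ₁ x y ∧ WeakLT ψ₂ y x

/-- The restriction `ψ[W]`. -/
def restrict (ψ : List (Finset V)) (W : Finset V) : List (Finset V) :=
  (ψ.map (fun B => B ∩ W)).filter (fun B => B.Nonempty)

/-- The weak linear order `(U)` with only one class (no class at all if `U` is empty). -/
def oneClass (U : Finset V) : List (Finset V) :=
  if U.Nonempty then [U] else []

/-- The position in `ψ` (counted from `0`) of the class of `x`. -/
def classIdx (ψ : List (Finset V)) (x : V) : ℕ :=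
  ψ.findIdx (fun B => x ∈ B)

/-- The position of the first class of `ψ` that meets `W`. -/
def firstIdx (ψ : List (Finset V)) (W : Finset V) : ℕ :=
  ψ.findIdx (fun B => (B ∩ W).Nonempty)

/-- The position of the last class of `ψ` that meets `W`. -/
def lastIdx (ψ : List (Finset V)) (W : Finset V) : ℕ :=
  W.sup (classIdx ψ)

end WeakOrders

/-! ## Straight enumerations -/

section Straight

variable {V : Type*} [DecidableEq V]

/-- The closed neighbourhood `N[x]`. -/
def closedNbhd (G : SimpleGraph V) (x : V) : Set V :=
  insert x (G.neighborSet x)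

/-- Two sets of vertices are adjacent if some edge joins them. -/
def SetsAdj (G : SimpleGraph V) (B C : Finset V) : Prop :=
  ∃ x ∈ B, ∃ y ∈ C, G.Adj x y

/-- `φ` is a straight enumeration of `G`: an ordering of the blocks of `G` (the classes of the
relation `N[x] = N[y]`) in which every block and the blocks adjacent to it are consecutive. -/
def IsStraightEnumeration [Fintype V] (G : SimpleGraph V) (φ : List (Finset V)) : Prop :=
  IsWeakOrder φ Finset.univ ∧
  (∀ B ∈ φ, ∀ x ∈ B, ∀ y, y ∈ B ↔ closedNbhd G x = closedNbhd G y) ∧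
  ∀ i : Fin φ.length,
    Set.OrdConnected {j : Fin φ.length | j = i ∨ SetsAdj G (φ.get i) (φ.get j)}

end Straight

/-! ## Matrices and their level graphs -/

section Matrices

variable {V R : Type*} [DecidableEq V] [LinearOrder R] [Zero R]

/-- The support graph of a symmetric matrix. -/
def supportGraph (A : Matrix V V R) : SimpleGraph V :=
  SimpleGraph.fromRel (fun x y => A x y ≠ 0)

instance (A : Matrix V V R) : DecidableRel (supportGraph A).Adj := fun x y =>
  inferInstanceAs (Decidable (x ≠ y ∧ (A x y ≠ 0 ∨ A y x ≠ 0)))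

/-- The level graph of a symmetric matrix at the value `α`: the edges are the pairs `{x, y}` with
`A x y ≥ α`. -/
def levelGraph (A : Matrix V V R) (α : R) : SimpleGraph V :=
  SimpleGraph.fromRel (fun x y => α ≤ A x y)

/-- The distinct nonzero values taken by the entries of `A[W]`. -/
def nonzeroValues (A : Matrix V V R) (W : Finset V) : Finset R :=
  ((W ×ˢ W).image (fun p => A p.1 p.2)).filter (fun a => a ≠ 0)

/-- The matrix `A'[W]`, obtained from `A[W]` by setting to zero the entries that are equal to the
smallest nonzero entry of `A[W]`. It is kept as a matrix on all of `V`, with zeros outside `W`. -/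
def lower (A : Matrix V V R) (W : Finset V) : Matrix V V R := fun x y =>
  if x ∈ W ∧ y ∈ W ∧ (A x y : WithTop R) ≠ (nonzeroValues A W).min then A x y else 0

/-- `A[W]` is a diagonal matrix. -/
def IsDiagOn (A : Matrix V V R) (W : Finset V) : Prop :=
  ∀ x ∈ W, ∀ y ∈ W, x ≠ y → A x y = 0

instance (A : Matrix V V R) (W : Finset V) : Decidable (IsDiagOn A W) :=
  have (x y : V) : Decidable (A x y = 0) := inferInstanceAs (Decidable ((A x y : R) = 0))
  have (x y : V) : Decidable (x ≠ y → A x y = 0) := inferInstance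
  have (x : V) : Decidable (∀ y ∈ W, x ≠ y → A x y = 0) := inferInstance
  inferInstanceAs (Decidable (∀ x ∈ W, ∀ y ∈ W, x ≠ y → A x y = 0))

end Matrices

/-- A matrix is Robinson if `A i k ≤ min (A i j) (A j k)` whenever `i ≤ j ≤ k`. -/
def IsRobinson {n : ℕ} (A : Matrix (Fin n) (Fin n) ℝ) : Prop :=
  ∀ i j k : Fin n, i ≤ j → j ≤ k → A i k ≤ min (A i j) (A j k)

/-- A matrix is Robinsonian if some permutation of its rows and columns makes it Robinson. -/
def IsRobinsonian {n : ℕ} (A : Matrix (Fin n) (Fin n) ℝ) : Prop :=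
  ∃ π : Equiv.Perm (Fin n), IsRobinson (A.submatrix π π)

/-- The linear order `π(1) < ⋯ < π(n)`, as a weak linear order all of whose classes are
singletons. -/
def permOrder {n : ℕ} (π : Equiv.Perm (Fin n)) : List (Finset (Fin n)) :=
  (List.finRange n).map (fun i => {π i})

/-! ## The algorithms

An algorithm that may stop returns an `Option`, and `none` means that it stops. An algorithm that
makes arbitrary choices is given as the set of its possible outcomes, over all choices. Graphs are
kept on the whole vertex type together with the current vertex set `U`. -/

section LexBFS

variable {V : Type*} [DecidableEq V] (G : SimpleGraph V) [DecidableRel G.Adj]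

/-- The vertices of `T` with lexicographically largest label (the current slice). -/
def slice (label : V → List ℕ) (T : Finset V) : Finset V :=
  T.filter (fun v => ∀ w ∈ T, label w ≤ label v)

/-- Append `k` to the label of every vertex of `T` that is adjacent to `p`. -/
def relabel (label : V → List ℕ) (T : Finset V) (p : V) (k : ℕ) : V → List ℕ := fun w =>
  if w ∈ T ∧ G.Adj p w then label w ++ [k] else label w

/-- What CO-Lex-BFS does when the component `cur` is completed. The list `done` holds the completed
components, the most recent one first; each component is the sequence of its vertices in the order
`σ`, so that swapping two components also modifies `σ`. -/
def closeComponent (ψ : List (Finset V)) (done : List (List V)) (cur : List V) :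
    Option (List (List V)) :=
  if ∃ k ∈ Finset.Ioo (firstIdx ψ cur.toFinset) (lastIdx ψ cur.toFinset),
      ¬ ψ.getD k ∅ ⊆ cur.toFinset then none
  else match done with
    | [] => some [cur]
    | prev :: rest =>
      if cur.toFinset ⊆ ψ.getD (firstIdx ψ prev.toFinset) ∅ then some (prev :: cur :: rest)
      else if firstIdx ψ cur.toFinset < lastIdx ψ prev.toFinset then none
      else some (cur :: prev :: rest)

/-- The main loop of CO-Lex-BFS on the graph `G[U]`, from the step `i` on, where `i` counts down to
`0` and is the number of unvisited vertices. The outcome is the list of the components, in their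
final order, each as the sequence of its vertices in the order `σ`. -/
def coLexBFSLoop (U : Finset V) (ψ : List (Finset V)) :
    (i : ℕ) → (label : V → List ℕ) → (done : List (List V)) → (cur : List V) →
      Finset (Option (List (List V)))
  | 0, _, done, cur =>
      match closeComponent ψ done cur with
      | none => {none}
      | some done' => {some done'.reverse}
  | k + 1, label, done, cur =>
      let T := U \ (done.flatten ++ cur).toFinset
      let S := slice label T
      (S.filter (fun p => ∀ q ∈ S, classIdx ψ p ≤ classIdx ψ q)).biUnion fun p =>
        let label' := relabel G label (T.erase p) p k
        if label p = [] then
          match closeComponent ψ done cur with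
          | none => {none}
          | some done' => coLexBFSLoop U ψ k label' done' [p]
        else coLexBFSLoop U ψ k label' done (cur ++ [p])

/-- CO-Lex-BFS on `G[U]` and the weak linear order `ψ` of `U`: the components `(V₁, …, V_c)` and the
vertex order `σ`. The first vertex `u` is any vertex of the first class of `ψ`. -/
def coLexBFS (U : Finset V) (ψ : List (Finset V)) :
    Finset (Option (List (Finset V) × List V)) :=
  match ψ with
  | [] => {some ([], [])}
  | B :: _ =>
    (B.biUnion fun u =>
      coLexBFSLoop G U ψ U.card (fun v => if v = u then [U.card] else []) [] []).image
    (Option.map fun comps => (comps.map List.toFinset, comps.flatten))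

/-- The loop of Lex-BFS+: `i` counts the steps down, and `out` holds the visited vertices. Ties are
broken in favour of the vertex that comes last in `σ`. -/
def lexBFSPlusLoop (σ : List V) : (i : ℕ) → (label : V → List ℕ) → (out : List V) → List V
  | 0, _, out => out
  | k + 1, label, out =>
      let T := σ.toFinset \ out.toFinset
      match (σ.filter (fun v => v ∈ slice label T)).getLast? with
      | none => out
      | some p => lexBFSPlusLoop σ k (relabel G label (T.erase p) p k) (out ++ [p])

/-- Lex-BFS+ on the graph induced on the vertices of the list `σ`. -/
def lexBFSPlus (σ : List V) : List V :=
  lexBFSPlusLoop G σ σ.length (fun _ => []) []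

/-- The position (counted from `1`) in `τ` of the leftmost vertex of `N[v]`. -/
def lmn (τ : List V) (v : V) : ℕ :=
  τ.findIdx (fun u => u = v ∨ G.Adj v u) + 1

/-- The position (counted from `1`) in `τ` of the rightmost vertex of `N[v]`. -/
def rmn (τ : List V) (v : V) : ℕ :=
  (τ.toFinset.filter (fun u => u = v ∨ G.Adj v u)).sup (fun u => τ.idxOf u + 1)

/-- The degree of `v` in the graph induced on the vertices of `τ`. -/
def degIn (τ : List V) (v : V) : ℕ :=
  (τ.toFinset.filter (fun u => G.Adj v u)).card

/-- The loop of Straight_enumeration over the vertices of `τ`. The pair `(l, r)` describes the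
current block, and `blocks` holds the blocks found so far, the current one first. -/
def straightLoop (τ : List V) :
    (l r : ℕ) → (blocks : List (Finset V)) → List V → Option (List (Finset V))
  | _, _, blocks, [] => some blocks.reverse
  | l, r, blocks, v :: vs =>
      if rmn G τ v - lmn G τ v ≠ degIn G τ v then none
      else match blocks with
        | [] => straightLoop τ (lmn G τ v) (rmn G τ v) [{v}] vs
        | C :: Cs =>
          if lmn G τ v = l ∧ rmn G τ v = r then straightLoop τ l r (insert v C :: Cs) vs
          else straightLoop τ (lmn G τ v) (rmn G τ v) ({v} :: C :: Cs) vs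

/-- Straight_enumeration on the graph induced on the vertices of the list `σ`. -/
def straightEnumeration (σ : List V) : Option (List (Finset V)) :=
  let τ := lexBFSPlus G (lexBFSPlus G σ)
  straightLoop G τ 0 0 [] τ

end LexBFS

section Robinson

variable {V R : Type*} [DecidableEq V]

/-- Refine: the common refinement of `ψ` and `φ`, or `∅ = []`. -/
def refineOrder (ψ : List (Finset V)) : List (Finset V) → List (Finset V)
  | [] => []
  | C :: φ =>
      let U := ground (C :: φ)
      let W := U \ C
      if ∃ k ∈ Finset.range (lastIdx ψ C), ¬ ψ.getD k ∅ ⊆ C then []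
      else
        let Φ := if W = ∅ then restrict ψ C else restrict ψ C ++ refineOrder (restrict ψ W) φ
        if IsWeakOrder Φ U then Φ else []

/-- A `for` loop that concatenates the outcomes of `body` after `Φ`, and stops when `body` does. -/
def concatLoop (body : Finset V → Finset (Option (List (Finset V)))) :
    List (Finset V) → List (Finset V) → Finset (Option (List (Finset V)))
  | [], Φ => {some Φ}
  | W :: Ws, Φ =>
      (body W).biUnion fun
        | none => {none}
        | some Φ' => concatLoop body Ws (Φ ++ Φ')

theorem card_nonzeroValues_lower_lt [Fintype V] [LinearOrder R] [Zero R] (A : Matrix V V R) (W : Finset V)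
    (h : ¬ IsDiagOn (lower A W) W) :
    (nonzeroValues (lower A W) Finset.univ).card < (nonzeroValues A Finset.univ).card := by
  simp only [IsDiagOn, not_forall] at h
  obtain ⟨x, hx, y, hy, -, hxy⟩ := h
  have hA : A x y ≠ 0 := by
    intro h0
    apply hxy
    simp [lower, h0]
  have hmem : A x y ∈ nonzeroValues A W := by
    simp only [nonzeroValues, Finset.mem_filter, Finset.mem_image, Finset.mem_product]
    exact ⟨⟨(x, y), ⟨hx, hy⟩, rfl⟩, hA⟩
  obtain ⟨a, ha⟩ := Finset.min_of_mem hmem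
  have haW : a ∈ nonzeroValues A W := Finset.mem_of_min ha
  apply Finset.card_lt_card
  refine (Finset.ssubset_iff_of_subset ?_).2 ⟨a, ?_, ?_⟩
  · intro b hb
    simp only [nonzeroValues, Finset.mem_filter, Finset.mem_image] at hb ⊢
    obtain ⟨⟨p, -, hp⟩, hb0⟩ := hb
    refine ⟨⟨p, by simp, ?_⟩, hb0⟩
    unfold lower at hp
    split_ifs at hp with hc
    · exact hp
    · exact absurd hp.symm hb0
  · simp only [nonzeroValues, Finset.mem_filter, Finset.mem_image] at haW ⊢
    obtain ⟨⟨p, -, hp⟩, h0⟩ := haW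
    exact ⟨⟨p, by simp, hp⟩, h0⟩
  · intro hb
    simp only [nonzeroValues, Finset.mem_filter, Finset.mem_image] at hb
    obtain ⟨⟨p, -, hp⟩, hb0⟩ := hb
    unfold lower at hp
    split_ifs at hp with hc
    · exact hc.2.2 (by rw [hp, ha])
    · exact hb0 hp.symm

/-- The possible outcomes of Robinson on the matrix `A[U]` and the weak linear order `ψ` of `U`. -/
def robinson [Fintype V] [LinearOrder R] [Zero R] (A : Matrix V V R) (U : Finset V) (ψ : List (Finset V)) :
    Finset (Option (List (Finset V))) :=
  (coLexBFS (supportGraph A) U ψ).biUnion fun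
    | none => {none}
    | some (comps, σ) =>
      concatLoop (fun W =>
        match straightEnumeration (supportGraph A) (σ.filter (fun v => v ∈ W)) with
        | none => {none}
        | some φ =>
          let Φ₁ := refineOrder (restrict ψ W) φ
          let Φ₂ := if Φ₁ = [] then refineOrder (restrict ψ W) φ.reverse else Φ₁
          if Φ₂ = [] then {none}
          else if _h : IsDiagOn (lower A W) W then {some Φ₂}
          else robinson (lower A W) W Φ₂) comps []
termination_by (nonzeroValues A Finset.univ).card
decreasing_by exact card_nonzeroValues_lower_lt A W _h

end Robinson

/-- The possible outcomes of Robinsonian on `A`: the answer `none` ("not Robinsonian") if Robinson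
stops on `A` and `(V)`, and any linear order compatible with `Φ` if Robinson returns `Φ`. -/
def robinsonian {n : ℕ} (A : Matrix (Fin n) (Fin n) ℝ) : Set (Option (Equiv.Perm (Fin n))) :=
  {o | ∃ r ∈ robinson A Finset.univ (oneClass Finset.univ),
    match r, o with
    | none, none => True
    | some Φ, some π => Compatible (permOrder π) Φ
    | _, _ => False}

/-! A linear order is a Robinson ordering of `A`, up to the diagonal, exactly when in every level
graph an edge forces both of its ends to be adjacent to everything between them (`Umbrella`).
Straight enumerations are such orders with twins merged (`BlockRank`). Adding up the class positions
of pairwise compatible weak orders produces a common linear extension (`sum_classIdx_lt`), so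
compatible straight enumerations that are also compatible with `ψ` yield a Robinson ranking that
extends `ψ` (`exists_isRobinsonRank`). It therefore suffices to show that a returned `Φ` refines `ψ`
and has only Robinson orderings as linear extensions, and that stopping rules out every Robinson
ranking compatible with `ψ`. This is `CorrectOutcomes`, proved in `robinson_correct` by induction on
the number of distinct nonzero entries.

For one level, a Robinson ranking is an umbrella order of the support graph, in which components
cannot interleave; so CO-Lex-BFS stops only if `ψ` admits no such order (`closeComponent_none`).
Within a component the order of the blocks is unique up to reversal, and three sweeps find it
(`three_sweeps`): the first sweep ends at an extreme vertex, the second runs from there to the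
opposite end, and the third comes back sorted, its ties being settled by the second. The tool is
`LexOrder.lt_of_closedAdj`: to the right of the starting point, a vertex that reaches further left
is visited earlier. Refine then returns the common refinement of the two orders, and fails only if
they are incompatible.

The algorithm never returns to the second orientation of an enumeration once the first has been
accepted. Nothing is lost: if `ψ` is compatible with both orientations, then `ψ` or the enumeration
is trivial (`IsWeakOrder.trivial_or_trivial`), and in the first case a Robinson ranking may be
reversed. Removing the smallest nonzero value keeps rankings Robinson (`lower_mono`); conversely,
the umbrella property of the support graph restores the lost inequalities (`le_of_lower_le`).
Components are independent of each other, since entries between them vanish. -/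

set_option linter.unusedSectionVars false

/-! ### Calculus of weak linear orders. -/

section WeakOrderLemmas

variable {V : Type*} [DecidableEq V]

@[simp] theorem ground_nil : ground ([] : List (Finset V)) = ∅ := rfl

@[simp] theorem ground_cons (B : Finset V) (ψ : List (Finset V)) :
    ground (B :: ψ) = B ∪ ground ψ := rfl

theorem mem_ground {ψ : List (Finset V)} {x : V} : x ∈ ground ψ ↔ ∃ B ∈ ψ, x ∈ B := by
  induction ψ with
  | nil => simp
  | cons B ψ ih => simp [ih]

@[simp] theorem ground_append (ψ φ : List (Finset V)) :
    ground (ψ ++ φ) = ground ψ ∪ ground φ := by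
  ext x; simp only [mem_ground, Finset.mem_union, List.mem_append, or_and_right, exists_or]

@[simp] theorem weakLT_nil (x y : V) : ¬ WeakLT [] x y := by
  rintro ⟨i, -⟩; exact i.elim0

theorem weakLT_iff_getElem {ψ : List (Finset V)} {x y : V} :
    WeakLT ψ x y ↔ ∃ (i j : ℕ) (hi : i < ψ.length) (hj : j < ψ.length),
      i < j ∧ x ∈ ψ[i] ∧ y ∈ ψ[j] := by
  constructor
  · rintro ⟨i, j, h, hx, hy⟩
    exact ⟨i, j, i.2, j.2, h, hx, hy⟩
  · rintro ⟨i, j, hi, hj, h, hx, hy⟩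
    exact ⟨⟨i, hi⟩, ⟨j, hj⟩, h, hx, hy⟩

@[simp] theorem weakLT_cons {B : Finset V} {ψ : List (Finset V)} {x y : V} :
    WeakLT (B :: ψ) x y ↔ (x ∈ B ∧ y ∈ ground ψ) ∨ WeakLT ψ x y := by
  simp only [weakLT_iff_getElem, mem_ground]
  constructor
  · rintro ⟨i, j, hi, hj, h, hx, hy⟩
    obtain ⟨j, rfl⟩ : ∃ j', j = j' + 1 := ⟨j - 1, by omega⟩
    rcases i with _ | i
    · exact Or.inl ⟨hx, ψ[j]'(by simpa using hj), List.getElem_mem _, hy⟩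
    · exact Or.inr ⟨i, j, by simpa using hi, by simpa using hj, by omega, hx, hy⟩
  · rintro (⟨hx, C, hC, hy⟩ | ⟨i, j, hi, hj, h, hx, hy⟩)
    · obtain ⟨j, hj, rfl⟩ := List.getElem_of_mem hC
      exact ⟨0, j + 1, by simp, by simpa using hj, by omega, hx, hy⟩
    · exact ⟨i + 1, j + 1, by simpa using hi, by simpa using hj, by omega, hx, hy⟩

theorem weakLT_append {ψ φ : List (Finset V)} {x y : V} :
    WeakLT (ψ ++ φ) x y ↔
      WeakLT ψ x y ∨ (x ∈ ground ψ ∧ y ∈ ground φ) ∨ WeakLT φ x y := by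
  induction ψ with
  | nil => simp
  | cons B ψ ih => simp [ih]; tauto

theorem WeakLT.mem_left {ψ : List (Finset V)} {x y : V} (h : WeakLT ψ x y) : x ∈ ground ψ := by
  obtain ⟨i, j, -, hx, -⟩ := h
  exact mem_ground.2 ⟨_, List.get_mem _ _, hx⟩

theorem WeakLT.mem_right {ψ : List (Finset V)} {x y : V} (h : WeakLT ψ x y) : y ∈ ground ψ := by
  obtain ⟨i, j, -, -, hy⟩ := h
  exact mem_ground.2 ⟨_, List.get_mem _ _, hy⟩

theorem ground_reverse (ψ : List (Finset V)) : ground ψ.reverse = ground ψ := by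
  ext x; simp [mem_ground]

theorem weakLT_reverse {ψ : List (Finset V)} {x y : V} :
    WeakLT ψ.reverse x y ↔ WeakLT ψ y x := by
  induction ψ with
  | nil => simp
  | cons B ψ ih => simp [weakLT_append, ih, ground_reverse]; tauto

@[simp] theorem isWeakOrder_nil {U : Finset V} : IsWeakOrder [] U ↔ U = ∅ := by
  simp [IsWeakOrder, eq_comm]

theorem disjoint_ground {B : Finset V} {ψ : List (Finset V)} :
    Disjoint B (ground ψ) ↔ ∀ C ∈ ψ, Disjoint B C := by
  induction ψ with
  | nil => simp
  | cons C ψ ih => simp [ih, Finset.disjoint_union_right]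

theorem isWeakOrder_append {ψ φ : List (Finset V)} {U W : Finset V} (hψ : IsWeakOrder ψ U)
    (hφ : IsWeakOrder φ W) (h : Disjoint U W) : IsWeakOrder (ψ ++ φ) (U ∪ W) := by
  refine ⟨?_, ?_, by rw [ground_append, hψ.2.2, hφ.2.2]⟩
  · intro B hB
    rcases List.mem_append.1 hB with hB | hB
    exacts [hψ.1 B hB, hφ.1 B hB]
  · refine List.pairwise_append.2 ⟨hψ.2.1, hφ.2.1, fun B hB C hC => ?_⟩
    rw [Finset.disjoint_left] at h ⊢
    intro x hxB hxC
    exact h (hψ.2.2 ▸ mem_ground.2 ⟨B, hB, hxB⟩) (hφ.2.2 ▸ mem_ground.2 ⟨C, hC, hxC⟩)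

theorem isWeakOrder_singleton {B : Finset V} (h : B.Nonempty) : IsWeakOrder [B] B := by
  simp [IsWeakOrder, h]

theorem IsWeakOrder.of_cons {B : Finset V} {ψ : List (Finset V)} {U : Finset V}
    (h : IsWeakOrder (B :: ψ) U) :
    B.Nonempty ∧ B ⊆ U ∧ Disjoint B (ground ψ) ∧ ground ψ = U \ B ∧ IsWeakOrder ψ (U \ B) := by
  obtain ⟨h1, h2, rfl⟩ := h
  rw [List.pairwise_cons] at h2
  have hd : Disjoint B (ground ψ) := disjoint_ground.2 h2.1
  have he : ground ψ = ground (B :: ψ) \ B := by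
    rw [ground_cons, Finset.union_sdiff_left, Finset.sdiff_eq_self_of_disjoint hd.symm]
  exact ⟨h1 B (by simp), by simp, hd, he,
    fun C hC => h1 C (List.mem_cons_of_mem _ hC), h2.2, he⟩

theorem IsWeakOrder.reverse {ψ : List (Finset V)} {U : Finset V} (h : IsWeakOrder ψ U) :
    IsWeakOrder ψ.reverse U := by
  refine ⟨fun B hB => h.1 B (List.mem_reverse.1 hB), ?_, by rw [ground_reverse, h.2.2]⟩
  rw [List.pairwise_reverse]
  exact h.2.1.imp fun h => h.symm

theorem IsWeakOrder.weakLT_iff {ψ : List (Finset V)} {U : Finset V} (h : IsWeakOrder ψ U)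
    {x y : V} : WeakLT ψ x y ↔ x ∈ U ∧ y ∈ U ∧ classIdx ψ x < classIdx ψ y := by
  induction ψ generalizing U with
  | nil => simp [isWeakOrder_nil.1 h]
  | cons B ψ ih =>
    obtain ⟨-, hBU, hd, hg, hψ⟩ := h.of_cons
    rw [weakLT_cons, ih hψ, hg]
    simp only [classIdx, List.findIdx_cons, Finset.mem_sdiff]
    by_cases hx : x ∈ B <;> by_cases hy : y ∈ B <;> simp [hx, hy]
    intro _
    exact hBU hx

theorem classIdx_lt_iff {ψ : List (Finset V)} {x : V} :
    classIdx ψ x < ψ.length ↔ x ∈ ground ψ := by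
  simp [classIdx, List.findIdx_lt_length, mem_ground]

theorem mem_classIdx {ψ : List (Finset V)} {x : V} (h : x ∈ ground ψ) :
    x ∈ ψ[classIdx ψ x]'(classIdx_lt_iff.2 h) := by
  have := List.findIdx_getElem (xs := ψ) (p := fun B => decide (x ∈ B)) (w := classIdx_lt_iff.2 h)
  exact of_decide_eq_true this

theorem IsWeakOrder.mem_getElem_iff {ψ : List (Finset V)} {U : Finset V} (h : IsWeakOrder ψ U)
    {x : V} (hx : x ∈ U) {i : ℕ} (hi : i < ψ.length) : x ∈ ψ[i] ↔ classIdx ψ x = i := by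
  have hg : x ∈ ground ψ := h.2.2 ▸ hx
  constructor
  · intro hxi
    by_contra hne
    have hd := List.pairwise_iff_getElem.1 h.2.1
    rcases lt_or_gt_of_ne hne with hlt | hlt
    · exact Finset.disjoint_left.1 (hd _ _ _ hi hlt) (mem_classIdx hg) hxi
    · exact Finset.disjoint_left.1 (hd _ _ hi _ hlt) hxi (mem_classIdx hg)
  · rintro rfl
    exact mem_classIdx hg

theorem ground_restrict (ψ : List (Finset V)) (W : Finset V) :
    ground (restrict ψ W) = ground ψ ∩ W := by
  ext x
  simp only [mem_ground, restrict, List.mem_filter, List.mem_map, Finset.mem_inter]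
  constructor
  · rintro ⟨B, ⟨⟨C, hC, rfl⟩, -⟩, hx⟩
    rw [Finset.mem_inter] at hx
    exact ⟨⟨C, hC, hx.1⟩, hx.2⟩
  · rintro ⟨⟨C, hC, hx⟩, hW⟩
    exact ⟨C ∩ W, ⟨⟨C, hC, rfl⟩, by simpa using ⟨x, by simp [hx, hW]⟩⟩, by simp [hx, hW]⟩

theorem weakLT_restrict {ψ : List (Finset V)} {W : Finset V} {x y : V} :
    WeakLT (restrict ψ W) x y ↔ WeakLT ψ x y ∧ x ∈ W ∧ y ∈ W := by
  induction ψ with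
  | nil => simp [restrict]
  | cons B ψ ih =>
    have hr : restrict (B :: ψ) W =
        if (B ∩ W).Nonempty then (B ∩ W) :: restrict ψ W else restrict ψ W := by
      simp [restrict, List.filter_cons]
    rw [hr]
    split_ifs with hB
    · simp [ih, ground_restrict]; tauto
    · rw [ih, weakLT_cons]
      have : x ∈ B → x ∉ W := fun h h' => hB ⟨x, by simp [h, h']⟩
      tauto

theorem IsWeakOrder.restrict {ψ : List (Finset V)} {U W : Finset V} (h : IsWeakOrder ψ U)
    (hW : W ⊆ U) : IsWeakOrder (restrict ψ W) W := by
  refine ⟨?_, ?_, by rw [ground_restrict, h.2.2, Finset.inter_eq_right.2 hW]⟩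
  · intro B hB
    simpa using (List.mem_filter.1 hB).2
  · refine List.Pairwise.filter _ (List.pairwise_map.2 (h.2.1.imp fun hd => ?_))
    exact hd.mono Finset.inter_subset_left Finset.inter_subset_left

theorem isWeakOrder_oneClass (U : Finset V) : IsWeakOrder (oneClass U) U := by
  unfold oneClass
  split_ifs with h
  · exact isWeakOrder_singleton h
  · simpa using Finset.not_nonempty_iff_eq_empty.1 h

theorem not_weakLT_oneClass {U : Finset V} {x y : V} : ¬ WeakLT (oneClass U) x y := by
  unfold oneClass
  split_ifs <;> simp

theorem IsWeakOrder.ne_nil {ψ : List (Finset V)} {U : Finset V} (h : IsWeakOrder ψ U)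
    (hU : U.Nonempty) : ψ ≠ [] := by
  rintro rfl
  exact hU.ne_empty (isWeakOrder_nil.1 h)

/-- The weak linear order with the level sets of `f` as its classes. -/
def ofRank (f : V → ℕ) (U : Finset V) : List (Finset V) :=
  restrict ((List.range (U.sup f + 1)).map fun i => U.filter fun x => f x = i) U

theorem weakLT_map_range {f : V → ℕ} {U : Finset V} {n : ℕ} {x y : V} :
    WeakLT ((List.range n).map fun i => U.filter fun x => f x = i) x y ↔
      x ∈ U ∧ y ∈ U ∧ f x < f y ∧ f y < n := by
  simp only [weakLT_iff_getElem, List.getElem_map, List.getElem_range, Finset.mem_filter,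
    List.length_map, List.length_range]
  constructor
  · rintro ⟨i, j, hi, hj, h, ⟨hx, rfl⟩, hy, rfl⟩
    exact ⟨hx, hy, h, hj⟩
  · rintro ⟨hx, hy, h, hn⟩
    exact ⟨_, _, h.trans hn, hn, h, ⟨hx, rfl⟩, hy, rfl⟩

theorem weakLT_ofRank {f : V → ℕ} {U : Finset V} {x y : V} :
    WeakLT (ofRank f U) x y ↔ x ∈ U ∧ y ∈ U ∧ f x < f y := by
  rw [ofRank, weakLT_restrict, weakLT_map_range]
  have : y ∈ U → f y < U.sup f + 1 := fun h => Nat.lt_succ_of_le (Finset.le_sup h)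
  tauto

theorem isWeakOrder_ofRank (f : V → ℕ) (U : Finset V) : IsWeakOrder (ofRank f U) U := by
  refine ⟨?_, ?_, ?_⟩
  · intro B hB
    simpa using (List.mem_filter.1 hB).2
  · refine List.Pairwise.filter _ (List.pairwise_map.2 (List.pairwise_map.2 ?_))
    refine List.nodup_range.imp fun hne => ?_
    rw [Finset.disjoint_left]
    intro x
    simp only [Finset.mem_inter, Finset.mem_filter]
    rintro ⟨⟨-, h⟩, -⟩ ⟨⟨-, h'⟩, -⟩
    exact hne (h.symm.trans h')
  · rw [ofRank, ground_restrict, Finset.inter_eq_right]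
    intro x hx
    rw [mem_ground]
    exact ⟨U.filter fun y => f y = f x, List.mem_map.2 ⟨f x, by
      simpa using Nat.lt_succ_of_le (Finset.le_sup hx), rfl⟩, by simp [hx]⟩

end WeakOrderLemmas

/-! ### Three lexicographic searches of a connected proper interval graph. -/

section ThreeSweeps

variable {V : Type*}

/-- `y` lies in the closed neighbourhood of `x`. -/
def ClosedAdj (G : SimpleGraph V) (x y : V) : Prop := x = y ∨ G.Adj x y

theorem ClosedAdj.refl (G : SimpleGraph V) (x : V) : ClosedAdj G x x := Or.inl rfl

theorem ClosedAdj.symm {G : SimpleGraph V} {x y : V} (h : ClosedAdj G x y) : ClosedAdj G y x :=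
  h.imp Eq.symm SimpleGraph.Adj.symm

theorem ClosedAdj.adj {G : SimpleGraph V} {x y : V} (h : ClosedAdj G x y) (hne : x ≠ y) :
    G.Adj x y := h.resolve_left hne

/-- The vertices of `U` are ranked by `r` so that every edge spans a clique. -/
def Umbrella (G : SimpleGraph V) (U : Finset V) (r : V → ℤ) : Prop :=
  ∀ x ∈ U, ∀ y ∈ U, ∀ z ∈ U, r x ≤ r y → r y ≤ r z → ClosedAdj G x z →
    ClosedAdj G x y ∧ ClosedAdj G y z

/-- Two vertices have the same closed neighbourhood in `G[U]`. -/
def Twins (G : SimpleGraph V) (U : Finset V) (x y : V) : Prop :=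
  ∀ w ∈ U, ClosedAdj G x w ↔ ClosedAdj G y w

/-- The rank of the block of a vertex in a straight enumeration of `G[U]`. -/
def BlockRank (G : SimpleGraph V) (U : Finset V) (r : V → ℤ) : Prop :=
  Umbrella G U r ∧ ∀ x ∈ U, ∀ y ∈ U, Twins G U x y → r x = r y

/-- `p` gives the positions of the vertices in a lexicographic breadth-first search of `G[U]`. -/
def LexOrder (G : SimpleGraph V) (U : Finset V) (p : V → ℕ) : Prop :=
  Set.InjOn p U ∧ ∀ a ∈ U, ∀ b ∈ U, ∀ c ∈ U, p a < p b → p b < p c → G.Adj a c → ¬ G.Adj a b →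
    ∃ d ∈ U, p d < p a ∧ G.Adj d b ∧ ¬ G.Adj d c

/-- Ties in the search with positions `p` are broken in favour of the last vertex in `q`. -/
def TiesBrokenBy (G : SimpleGraph V) (U : Finset V) (q p : V → ℕ) : Prop :=
  ∀ x ∈ U, ∀ y ∈ U, p y < p x → (∀ a ∈ U, p a < p y → (G.Adj a y ↔ G.Adj a x)) → q x < q y

/-- `G[U]` is connected: no proper nonempty part of `U` is closed under adjacency. -/
def ConnectedOn (G : SimpleGraph V) (U : Finset V) : Prop :=
  ∀ S ⊆ U, S.Nonempty → (∀ a ∈ S, ∀ b ∈ U, G.Adj a b → b ∈ S) → S = U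

variable {G : SimpleGraph V} {U : Finset V} {r : V → ℤ} {p q : V → ℕ}

theorem Umbrella.neg (h : Umbrella G U r) : Umbrella G U (fun x => -r x) := by
  intro x hx y hy z hz hxy hyz hxz
  obtain ⟨h1, h2⟩ := h z hz y hy x hx (by simpa using hyz) (by simpa using hxy) hxz.symm
  exact ⟨h2.symm, h1.symm⟩

theorem BlockRank.neg (h : BlockRank G U r) : BlockRank G U (fun x => -r x) :=
  ⟨h.1.neg, fun x hx y hy ht => by simpa using h.2 x hx y hy ht⟩

theorem Umbrella.twins_of_eq (h : Umbrella G U r) {x y : V} (hx : x ∈ U) (hy : y ∈ U)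
    (hxy : r x = r y) : Twins G U x y := by
  have key : ∀ x ∈ U, ∀ y ∈ U, r x = r y → ∀ w ∈ U, ClosedAdj G x w → ClosedAdj G y w := by
    intro x hx y hy hxy w hw hxw
    rcases le_total (r x) (r w) with hle | hle
    · exact (h x hx y hy w hw hxy.le (hxy ▸ hle) hxw).2
    · exact (h w hw y hy x hx (hxy ▸ hle) hxy.ge hxw.symm).1.symm
  exact fun w hw => ⟨key x hx y hy hxy w hw, key y hy x hx hxy.symm w hw⟩

/-- Vertices ranked between twins are twins of them. -/
theorem Umbrella.twins_between (h : Umbrella G U r) {x y z : V} (hx : x ∈ U) (hy : y ∈ U)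
    (hz : z ∈ U) (hxy : r x ≤ r y) (hyz : r y ≤ r z) (ht : Twins G U x z) : Twins G U x y := by
  have hxz : ClosedAdj G x z := (ht z hz).2 (ClosedAdj.refl G z)
  intro w hw
  constructor
  · intro hxw
    rcases le_total (r w) (r y) with hle | hle
    · exact (h w hw y hy z hz hle hyz ((ht w hw).1 hxw).symm).1.symm
    · exact (h x hx y hy w hw hxy hle hxw).2
  · intro hyw
    rcases le_total (r w) (r x) with h1 | h1
    · exact (h w hw x hx y hy h1 hxy hyw.symm).1.symm
    rcases le_total (r w) (r z) with h2 | h2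
    · exact (h x hx w hw z hz h1 h2 hxz).1
    · exact (ht w hw).2 (h y hy z hz w hw hyz h2 hyw).2

/-- An earlier vertex is not chosen if its set of visited neighbours is properly dominated. -/
theorem LexOrder.adj_of_adj (h : LexOrder G U p) {x y : V} (hx : x ∈ U) (hy : y ∈ U)
    (hyx : p y < p x) (hsub : ∀ a ∈ U, p a < p y → G.Adj a y → G.Adj a x) {a : V} (ha : a ∈ U)
    (hay : p a < p y) (hax : G.Adj a x) : G.Adj a y := by
  by_contra hn
  obtain ⟨d, hd, hda, hdy, hdx⟩ := h.2 a ha y hy x hx hay hyx hax hn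
  exact hdx (hsub d hd (hda.trans hay) hdy)

/-- If `y` had no earlier neighbour, the vertices before `y` would be closed under adjacency: an
edge from one of them to a vertex after `y` would, by the search condition, require an earlier
neighbour of `y`. This contradicts connectedness. -/
theorem LexOrder.exists_earlier (h : LexOrder G U p) (hc : ConnectedOn G U) {s y : V} (hs : s ∈ U)
    (hy : y ∈ U) (hsy : p s < p y) : ∃ t ∈ U, p t < p y ∧ G.Adj t y := by
  by_contra! hn
  have hS := hc (U.filter fun a => p a < p y) (Finset.filter_subset _ _)
    ⟨s, by simp [hs, hsy]⟩ (by
      intro a ha b hb hab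
      rw [Finset.mem_filter] at ha ⊢
      refine ⟨hb, ?_⟩
      by_contra hby
      rcases (not_lt.1 hby).lt_or_eq with hlt | heq
      · obtain ⟨d, hd, hda, hdy, -⟩ := h.2 a ha.1 y hy b hb ha.2 hlt hab (hn a ha.1 ha.2)
        exact hn d hd (hda.trans ha.2) hdy
      · obtain rfl := h.1 hy hb heq
        exact hn a ha.1 ha.2 hab)
  have : y ∈ U.filter fun a => p a < p y := by rw [hS]; exact hy
  simp at this

/-- In a search from `s`, to the right of `s` the vertices with more neighbours on the left come
first. -/
theorem LexOrder.lt_of_closedAdj (hp : LexOrder G U p) (hc : ConnectedOn G U) (hr : Umbrella G U r)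
    {s : V} (hs : s ∈ U) (hfirst : ∀ x ∈ U, p s ≤ p x) {x y v : V} (hx : x ∈ U) (hy : y ∈ U)
    (hv : v ∈ U) (hsv : r s ≤ r v) (hvx : r v ≤ r x) (hxy : r x < r y) (hadj : ClosedAdj G v x)
    (hnadj : ¬ ClosedAdj G v y) : p x < p y := by
  induction hk : p y using Nat.strong_induction_on generalizing x y v with
  | _ k ih =>
  subst hk
  by_contra hlt
  have hyx : p y < p x :=
    (not_lt.1 hlt).lt_of_ne fun h => hxy.ne (congrArg r (hp.1 hy hx h).symm)
  -- A neighbour `u` to the left of `x` sees `x` under the umbrella. One to the right that missed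
  -- `x` would, by induction with `u` for `y` and `x` for `v`, come after `x`.
  have hsub : ∀ u ∈ U, p u < p y → G.Adj u y → G.Adj u x := by
    intro u hu huy hadjuy
    have hux : u ≠ x := fun h => (huy.trans hyx).ne (congrArg p h)
    rcases le_or_gt (r u) (r x) with hle | hgt
    · exact (hr u hu x hx y hy hle hxy.le (Or.inr hadjuy)).1.adj hux
    · by_contra hnux
      exact (huy.trans hyx).not_gt (ih (p u) huy hx hu hx (hsv.trans hvx) le_rfl hgt
        (ClosedAdj.refl G x) (fun h => hnux (h.symm.adj hux)) rfl)
  have heq : ∀ a ∈ U, p a < p y → G.Adj a x → G.Adj a y := fun a ha hay hax =>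
    hp.adj_of_adj hx hy hyx hsub ha hay hax
  -- a non-neighbour of `y` that comes after `y`
  obtain ⟨x, hx, hsx, hxy, hyx, hnxy, hsub, heq⟩ : ∃ x ∈ U, r s ≤ r x ∧ r x < r y ∧ p y < p x ∧
      ¬ ClosedAdj G x y ∧ (∀ u ∈ U, p u < p y → G.Adj u y → G.Adj u x) ∧
      ∀ a ∈ U, p a < p y → G.Adj a x → G.Adj a y := by
    -- If `x` is adjacent to `y`, then `v` takes its place. It comes after `y`, because otherwise
    -- `heq` would turn its edge to `x` into an edge to `y`.
    by_cases hnxy : ClosedAdj G x y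
    · have hvx' : v ≠ x := fun h => hnadj (h ▸ hnxy)
      have hvy : v ≠ y := fun h => hnadj (h ▸ ClosedAdj.refl G v)
      have hpv : p y < p v := by
        rcases lt_trichotomy (p v) (p y) with h | h | h
        · exact absurd (Or.inr (heq v hv h (hadj.adj hvx'))) hnadj
        · exact absurd (hp.1 hv hy h) hvy
        · exact h
      have hvylt : r v < r y := hvx.trans_lt hxy
      have hsubv : ∀ u ∈ U, p u < p y → G.Adj u y → G.Adj u v := by
        intro u hu huy hadjuy
        have huv : u ≠ v := fun h => (huy.trans hpv).ne (congrArg p h)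
        rcases le_or_gt (r u) (r v) with hle | hgt
        · exact (hr u hu v hv y hy hle hvylt.le (Or.inr hadjuy)).1.adj huv
        · by_contra hnuv
          exact (huy.trans hpv).not_gt (ih (p u) huy hv hu hv hsv le_rfl hgt
            (ClosedAdj.refl G v) (fun h => hnuv (h.symm.adj huv)) rfl)
      exact ⟨v, hv, hsv, hvylt, hpv, hnadj, hsubv, fun a ha hay hax =>
        hp.adj_of_adj hv hy hpv hsubv ha hay hax⟩
    · exact ⟨x, hx, hsv.trans hvx, hxy, hyx, hnxy, hsub, heq⟩
  -- The first visited vertex `u` to the right of `x` was reached from some `t` not to the right of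
  -- `x`. The edge `tu` passes over `x`, so `t` is adjacent to `x`, hence to `y`; but then the edge
  -- `ty` passes over `x` too and makes `x` adjacent to `y`.
  obtain ⟨u, hu, hmin⟩ := Finset.exists_min_image (U.filter fun u => r x < r u) p
    ⟨y, by simp [hy, hxy]⟩
  rw [Finset.mem_filter] at hu
  have huy : p u ≤ p y := hmin y (by simp [hy, hxy])
  have hsu : p s < p u := (hfirst u hu.1).lt_of_ne fun h => by
    have := hp.1 hs hu.1 h
    subst this
    exact hsx.not_gt hu.2
  obtain ⟨t, ht, htu, htadj⟩ := hp.exists_earlier hc hs hu.1 hsu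
  have hrt : r t ≤ r x := by
    by_contra hgt
    exact (hmin t (by simp [ht, not_le.1 hgt])).not_gt htu
  obtain ⟨htx, -⟩ := hr t ht x hx u hu.1 hrt hu.2.le (Or.inr htadj)
  have hty : p t < p y := htu.trans_le huy
  have : G.Adj t y := heq t ht hty (htx.adj fun h => (hty.trans hyx).ne (congrArg p h))
  exact hnxy (hr t ht x hx y hy hrt hxy.le (Or.inr this)).2

/-- The last vertex of a search from a vertex `s` not to the right of it has extreme rank. -/
theorem LexOrder.last_extreme_of_le (hp : LexOrder G U p) (hc : ConnectedOn G U)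
    (hr : BlockRank G U r) {s z : V} (hs : s ∈ U) (hfirst : ∀ x ∈ U, p s ≤ p x) (hz : z ∈ U)
    (hlast : ∀ x ∈ U, p x ≤ p z) (hsz : r s ≤ r z) :
    (∀ x ∈ U, r z ≤ r x) ∨ ∀ x ∈ U, r x ≤ r z := by
  classical
  by_contra! hcon
  obtain ⟨-, w, hw, hzw⟩ := hcon
  have hU := hr.1
  have hlt : ∀ x ∈ U, x ≠ z → p x < p z := fun x hx hne =>
    (hlast x hx).lt_of_ne fun h => hne (hp.1 hx hz h)
  have hwz : ∀ w ∈ U, r z < r w → p w < p z := fun w hw h =>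
    hlt w hw fun he => h.ne (congrArg r he.symm)
  -- Otherwise `z` would be visited before `w`, although it is the last vertex.
  have hB : ∀ w ∈ U, r z < r w → ∀ v ∈ U, r s ≤ r v → r v ≤ r z → ClosedAdj G v z →
      ClosedAdj G v w := by
    intro w hw hzw v hv hsv hvz hadj
    by_contra hn
    exact (hwz w hw hzw).not_gt (hp.lt_of_closedAdj hc hU hs hfirst hz hw hv hsv hvz hzw hadj hn)
  have hzall : ∀ w ∈ U, r z < r w → ClosedAdj G z w := fun w hw h =>
    hB w hw h z hz hsz le_rfl (ClosedAdj.refl G z)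
  -- Their ranks differ, so `z` and `w` are not twins; every neighbour of `w` is one of `z`, so it
  -- is a neighbour of `z` that tells them apart.
  obtain ⟨u, hu, huz, huw⟩ : ∃ u ∈ U, ClosedAdj G u z ∧ ¬ ClosedAdj G u w := by
    by_contra! hn
    refine hzw.ne (hr.2 z hz w hw fun v hv => ⟨fun h => (hn v hv h.symm).symm, fun h => ?_⟩)
    rcases le_or_gt (r v) (r z) with hle | hgt
    · exact (hU v hv z hz w hw hle hzw.le h.symm).1.symm
    · exact hzall v hv hgt
  have hus : r u < r s := by
    by_contra hge
    rcases le_or_gt (r u) (r z) with hle | hgt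
    · exact huw (hB w hw hzw u hu (not_lt.1 hge) hle huz)
    · rcases le_total (r u) (r w) with h | h
      · exact huw (hU z hz u hu w hw hgt.le h (hzall w hw hzw)).2
      · exact huw (hU z hz w hw u hu hzw.le h (hzall u hu hgt)).2.symm
  obtain ⟨-, hsadj⟩ := hU u hu s hs z hz hus.le hsz huz
  have hsz' : s ≠ z := by
    rintro rfl
    have : p w = p s := le_antisymm (hlast w hw) (hfirst w hw)
    exact hzw.ne (congrArg r (hp.1 hw hs this).symm)
  -- A non-neighbour of `s` would be visited between `s` and its neighbour `z`, and the search
  -- condition would ask for a vertex before `s`. Consequently each side of `s` is a clique.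
  have huniv : ∀ x ∈ U, ClosedAdj G s x := by
    intro x hx
    by_contra hn
    have hxs : p s < p x := (hfirst x hx).lt_of_ne fun h => hn (Or.inl (hp.1 hs hx h))
    have hxz : p x < p z := hlt x hx fun h => hn (h ▸ hsadj)
    obtain ⟨d, hd, hds, -⟩ := hp.2 s hs x hx z hz hxs hxz (hsadj.adj hsz')
      (fun h => hn (Or.inr h))
    exact hds.not_ge (hfirst d hd)
  have hright : ∀ a ∈ U, ∀ b ∈ U, r s ≤ r a → r s ≤ r b → ClosedAdj G a b := by
    intro a ha b hb hsa hsb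
    rcases le_total (r a) (r b) with h | h
    · exact (hU s hs a ha b hb hsa h (huniv b hb)).2
    · exact (hU s hs b hb a ha hsb h (huniv a ha)).2.symm
  have hleft : ∀ a ∈ U, ∀ b ∈ U, r a ≤ r s → r b ≤ r s → ClosedAdj G a b := by
    intro a ha b hb hsa hsb
    rcases le_total (r a) (r b) with h | h
    · exact (hU a ha b hb s hs h hsb (huniv a ha).symm).1
    · exact (hU b hb a ha s hs h hsa (huniv b hb).symm).1.symm
  have hsw : r s ≤ r w := hsz.trans hzw.le
  have huz' : u ≠ z := fun h => hus.not_ge (h ▸ hsz)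
  have huzp : p u < p z := hlt u hu huz'
  -- `w` is visited before `u`
  have hwu : p w < p u := by
    rcases lt_trichotomy (p w) (p u) with h | h | h
    · exact h
    · exact absurd (hp.1 hw hu h) fun h => hus.not_ge (h ▸ hsw)
    · refine absurd (Or.inr (hp.adj_of_adj hz hw (hwz w hw hzw) ?_ hu h (huz.adj huz'))) huw
      intro a ha haw hadj
      have haz : a ≠ z := fun he => (haw.trans (hwz w hw hzw)).ne (congrArg p he)
      rcases le_total (r a) (r z) with hle | hle
      · exact (hU a ha z hz w hw hle hzw.le (Or.inr hadj)).1.adj haz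
      · exact (hright a ha z hz (hsz.trans hle) hsz).adj haz
  -- The search condition is used twice. For `b, u, z` it gives an earlier `d` adjacent to `u` but
  -- not to `z`, which must lie to the left of `u` and miss `b`. For `d, b, u` it gives a still
  -- earlier `e` adjacent to `b` but not to `u`; this `e` cannot lie in the left clique, so it
  -- contradicts the choice of `b`.
  obtain ⟨b, hb, hmin⟩ := Finset.exists_min_image
    (U.filter fun b => r s ≤ r b ∧ ¬ G.Adj b u ∧ p b < p u) p
    ⟨w, by simpa [hw, hsw, hwu] using fun h : G.Adj w u => huw (Or.inr h.symm)⟩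
  obtain ⟨hbU, hsb, hbu, hpb⟩ := Finset.mem_filter.1 hb
  have hbz : b ≠ z := fun h => (hpb.trans huzp).ne (congrArg p h)
  have hbu' : ¬ ClosedAdj G b u := by
    rintro (h | h)
    exacts [hpb.ne (congrArg p h), hbu h]
  obtain ⟨d, hd, hdb, hdu, hdz⟩ := hp.2 b hbU u hu z hz hpb huzp
    ((hright b hbU z hz hsb hsz).adj hbz) hbu
  have hdz' : ¬ ClosedAdj G d z := by
    rintro (h | h)
    · exact (hdb.trans (hpb.trans huzp)).ne (congrArg p h)
    · exact hdz h
  have hds : r d < r s := by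
    by_contra hge
    exact hdz' (hright d hd z hz (not_lt.1 hge) hsz)
  have hdu' : r d < r u := by
    by_contra hge
    exact hdz' (hU u hu d hd z hz (not_lt.1 hge) (hds.le.trans hsz) huz).2
  have hndb : ¬ G.Adj d b := fun h => hbu'
    (hU d hd u hu b hbU hdu'.le (hus.le.trans hsb) (Or.inr h)).2.symm
  obtain ⟨e, he, hed, heb, heu⟩ := hp.2 d hd b hbU u hu hdb hpb hdu hndb
  have hpe : p e < p b := hed.trans hdb
  have hse : r s ≤ r e := by
    by_contra hlt'
    exact heu ((hleft e he u hu (not_le.1 hlt').le hus.le).adj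
      fun h => (hpe.trans hpb).ne (congrArg p h))
  exact hpe.not_ge (hmin e (by simp [he, hse, heu, hpe.trans hpb]))

/-- Negating the rank reduces to a starting vertex not to the right of `z`. -/
theorem LexOrder.last_extreme (hp : LexOrder G U p) (hc : ConnectedOn G U) (hr : BlockRank G U r)
    {z : V} (hz : z ∈ U) (hlast : ∀ x ∈ U, p x ≤ p z) :
    (∀ x ∈ U, r z ≤ r x) ∨ ∀ x ∈ U, r x ≤ r z := by
  obtain ⟨s, hs, hfirst⟩ := Finset.exists_min_image U p ⟨z, hz⟩
  rcases le_total (r s) (r z) with h | h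
  · exact hp.last_extreme_of_le hc hr hs hfirst hz hlast h
  · have := hp.last_extreme_of_le hc hr.neg hs hfirst hz hlast (by simpa using h)
    simpa [or_comm] using this

/-- The last vertex of a search from a vertex of lowest rank has highest rank. -/
theorem LexOrder.last_highest (hp : LexOrder G U p) (hc : ConnectedOn G U) (hr : BlockRank G U r)
    {s z : V} (hs : s ∈ U) (hfirst : ∀ x ∈ U, p s ≤ p x) (hlow : ∀ x ∈ U, r s ≤ r x) (hz : z ∈ U)
    (hlast : ∀ x ∈ U, p x ≤ p z) : ∀ x ∈ U, r x ≤ r z := by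
  have hU := hr.1
  by_contra! hcon
  obtain ⟨y, hy, hzy⟩ := hcon
  have hB : ∀ y ∈ U, r z < r y → ∀ v ∈ U, r v ≤ r z → ClosedAdj G v z → ClosedAdj G v y := by
    intro y hy hzy v hv hvz hadj
    by_contra hn
    exact (hp.lt_of_closedAdj hc hU hs hfirst hz hy hv (hlow v hv) hvz hzy hadj hn).not_ge
      (hlast y hy)
  have hzall : ∀ w ∈ U, r z < r w → ClosedAdj G z w := fun w hw h =>
    hB w hw h z hz le_rfl (ClosedAdj.refl G z)
  -- With the start at the left end, `hB` covers all vertices up to `z`, so that `z` and `y` become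
  -- twins of different rank.
  refine hzy.ne (hr.2 z hz y hy fun v hv => ⟨fun h => ?_, fun h => ?_⟩)
  · rcases le_or_gt (r v) (r z) with hle | hgt
    · exact (hB y hy hzy v hv hle h.symm).symm
    · rcases le_total (r v) (r y) with h' | h'
      · exact (hU z hz v hv y hy hgt.le h' (hzall y hy hzy)).2.symm
      · exact (hU z hz y hy v hv hzy.le h' (hzall v hv hgt)).2
  · rcases le_or_gt (r v) (r z) with hle | hgt
    · exact (hU v hv z hz y hy hle hzy.le h.symm).1.symm
    · exact hzall v hv hgt

/-- At the first step no vertex has been visited, so all vertices are tied. -/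
theorem TiesBrokenBy.first_eq_last (h : TiesBrokenBy G U q p) {s z : V} (hp : Set.InjOn p U)
    (hs : s ∈ U)
    (hfirst : ∀ x ∈ U, p s ≤ p x) (hz : z ∈ U) (hlast : ∀ x ∈ U, q x ≤ q z) : s = z := by
  by_contra hne
  have hlt : p s < p z := (hfirst z hz).lt_of_ne fun he => hne (hp hs hz he)
  exact (h z hz s hs hlt fun a ha hlt => absurd (hfirst a ha) hlt.not_ge).not_ge (hlast s hs)

/-- Three searches of a connected proper interval graph, the last two of which break ties in favour
of the last vertex of the preceding one, sort the vertices by every block rank, up to reversal. -/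
theorem three_sweeps {p₀ p₁ p₂ : V → ℕ} (hc : ConnectedOn G U) (hr : BlockRank G U r)
    (h₀ : LexOrder G U p₀) (h₁ : LexOrder G U p₁) (h₂ : LexOrder G U p₂)
    (t₁ : TiesBrokenBy G U p₀ p₁) (t₂ : TiesBrokenBy G U p₁ p₂) :
    (∀ x ∈ U, ∀ y ∈ U, r x < r y → p₂ x < p₂ y) ∨
      ∀ x ∈ U, ∀ y ∈ U, r x < r y → p₂ y < p₂ x := by
  rcases U.eq_empty_or_nonempty with rfl | hne
  · simp
  -- the case in which the second search starts at the left end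
  have key : ∀ r : V → ℤ, BlockRank G U r → ∀ s ∈ U, (∀ x ∈ U, p₁ s ≤ p₁ x) →
      (∀ x ∈ U, r s ≤ r x) → ∀ x ∈ U, ∀ y ∈ U, r x < r y → p₂ y < p₂ x := by
    clear hr
    intro r hr s hs hfirst hlow
    have hU := hr.1
    obtain ⟨e, he, helast⟩ := Finset.exists_max_image U p₁ hne
    have hehigh := h₁.last_highest hc hr hs hfirst hlow he helast
    obtain ⟨e', he', hefirst⟩ := Finset.exists_min_image U p₂ hne
    obtain rfl := t₂.first_eq_last h₂.1 he' hefirst he helast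
    by_contra! hcon
    obtain ⟨x₀, hx₀, y₀, hy₀, hxy₀, hp₀⟩ := hcon
    -- The earliest vertex of the third sweep that precedes some vertex `y` to its right.
    obtain ⟨x, hx, hmin⟩ := Finset.exists_min_image
      (U.filter fun x => ∃ y ∈ U, r x < r y ∧ p₂ x ≤ p₂ y) p₂
      ⟨x₀, by simpa [hx₀] using ⟨y₀, hy₀, hxy₀, hp₀⟩⟩
    obtain ⟨hx, y, hy, hxy, hp⟩ := Finset.mem_filter.1 hx
    have hlt : p₂ x < p₂ y := hp.lt_of_ne fun h => hxy.ne (congrArg r (h₂.1 hx hy h))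
    have hB : ∀ v ∈ U, r y ≤ r v → ClosedAdj G v y → ClosedAdj G v x := by
      intro v hv hyv hadj
      by_contra hn
      exact hlt.not_gt (h₂.lt_of_closedAdj hc hU.neg he hefirst hy hx hv
        (by simpa using hehigh v hv) (by simpa using hyv) (by simpa using hxy) hadj hn)
    have hyx : ClosedAdj G y x := hB y hy le_rfl (ClosedAdj.refl G y)
    -- By minimality everything visited before `x` has rank at least that of `y`. On such vertices
    -- the umbrella gives one implication and the third sweep, read from the right end, gives the
    -- other.
    have htie : ∀ a ∈ U, p₂ a < p₂ x → (G.Adj a x ↔ G.Adj a y) := by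
      intro a ha hax
      have hya : r y ≤ r a := by
        by_contra hcon
        refine hax.not_ge (hmin a ?_)
        rw [Finset.mem_filter]
        exact ⟨ha, y, hy, not_le.1 hcon, (hax.trans hlt).le⟩
      have hne : a ≠ x := fun h => hax.ne (congrArg p₂ h)
      have hne' : a ≠ y := fun h => (hax.trans hlt).ne (congrArg p₂ h)
      exact ⟨fun h => (hU x hx y hy a ha hxy.le hya (Or.inr h.symm)).2.symm.adj hne',
        fun h => (hB a ha hya (Or.inr h)).adj hne⟩
    -- The tie was thus decided by the second sweep. Since that sweep started at the left end, `x`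
    -- and `y` also agree to the left, and turn out to be twins.
    have hρ : p₁ y < p₁ x := t₂ y hy x hx hlt htie
    have hB' : ∀ v ∈ U, r v ≤ r x → ClosedAdj G v x → ClosedAdj G v y := by
      intro v hv hvx hadj
      by_contra hn
      exact hρ.not_gt (h₁.lt_of_closedAdj hc hU hs hfirst hx hy hv (hlow v hv) hvx hxy hadj hn)
    refine hxy.ne (hr.2 x hx y hy fun v hv => ?_)
    rcases le_or_gt (r v) (r x) with h | h
    · exact ⟨fun h' => (hB' v hv h h'.symm).symm,
        fun h' => (hU v hv x hx y hy h hxy.le h'.symm).1.symm⟩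
    rcases le_or_gt (r y) (r v) with h' | h'
    · exact ⟨fun h'' => (hU x hx y hy v hv hxy.le h' h'').2, fun h'' => (hB v hv h' h''.symm).symm⟩
    · have := hU x hx v hv y hy h.le h'.le hyx.symm
      exact ⟨fun _ => this.2.symm, fun _ => this.1⟩
  obtain ⟨z, hz, hzlast⟩ := Finset.exists_max_image U p₀ hne
  obtain ⟨s, hs, hfirst⟩ := Finset.exists_min_image U p₁ hne
  obtain rfl := t₁.first_eq_last h₁.1 hs hfirst hz hzlast
  rcases h₀.last_extreme hc hr hz hzlast with hlow | hhigh
  · exact Or.inr (key r hr s hs hfirst hlow)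
  · left
    intro x hx y hy hxy
    exact key _ hr.neg s hs hfirst (by simpa using hhigh) y hy x hx (by simpa using hxy)

end ThreeSweeps

/-! ### Label-based Lex-BFS and its order-theoretic description. -/

section LexBFSLemmas

variable {V : Type*} [DecidableEq V] {G : SimpleGraph V}

/-- Labels only receive numbers smaller than all those present, so a strict comparison of two labels
is never overturned; the delicate case is a proper prefix `l₁` of `l₂`. -/
theorem List.append_lt_append_of_lt {l₁ l₂ e₁ e₂ : List ℕ} (h : l₁ < l₂)
    (he : ∀ m ∈ e₁, ∀ m' ∈ l₂, m < m') : l₁ ++ e₁ < l₂ ++ e₂ := by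
  induction l₂ generalizing l₁ with
  | nil => exact absurd h (List.not_lt_nil _)
  | cons b l₂ ih =>
    cases l₁ with
    | nil =>
      cases e₁ with
      | nil => exact List.nil_lt_cons _ _
      | cons m e₁ => exact List.cons_lt_cons_iff.2 (Or.inl (he m (by simp) b (by simp)))
    | cons a l₁ =>
      rcases List.cons_lt_cons_iff.1 h with h' | ⟨rfl, h'⟩
      · exact List.cons_lt_cons_iff.2 (Or.inl h')
      · exact List.cons_lt_cons_iff.2 (Or.inr ⟨rfl, ih h' fun m hm m' hm' =>
          he m hm m' (List.mem_cons_of_mem _ hm')⟩)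

/-- An absent element has the length of the list as its index, so unvisited vertices count as tied
after all visited ones. Appending `p` only separates `p` from those that remain absent. -/
theorem List.idxOf_append_singleton_lt {l : List V} {p x y : V} (hp : p ∉ l)
    (h : (l ++ [p]).idxOf x < (l ++ [p]).idxOf y) :
    l.idxOf x < l.idxOf y ∨ (x = p ∧ y ∉ l ∧ y ≠ p) := by
  by_cases hx : x ∈ l <;> by_cases hy : y ∈ l
  · simp_all [List.idxOf_append]
  · exact Or.inl ((List.idxOf_lt_length_iff.2 hx).trans_eq (List.idxOf_of_notMem hy).symm)
  · exfalso
    simp [List.idxOf_append, hx, hy] at h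
    have := List.idxOf_lt_length_iff.2 hy
    omega
  · by_cases hxp : x = p
    · subst hxp
      by_cases hyx : y = x
      · subst hyx; omega
      · exact Or.inr ⟨rfl, hy, hyx⟩
    · exfalso
      have hx' : (l ++ [p]).idxOf x = (l ++ [p]).length :=
        List.idxOf_of_notMem (by simp [hx, hxp])
      have := List.idxOf_le_length (l := l ++ [p]) (a := y)
      omega

theorem List.mem_of_idxOf_lt {l : List V} {x y : V} (h : l.idxOf x < l.idxOf y) : x ∈ l :=
  List.idxOf_lt_length_iff.1 (h.trans_le List.idxOf_le_length)

theorem List.injOn_idxOf (l : List V) : Set.InjOn l.idxOf {x | x ∈ l} := by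
  intro x hx y hy h
  exact (List.idxOf_inj hx).1 h

/-- The state of a lexicographic breadth-first search that has visited the vertices of `out` and has
still to visit those of `T`. -/
structure LexState (G : SimpleGraph V) (label : V → List ℕ) (T : Finset V) (out : List V) (k : ℕ) :
    Prop where
  nodup : out.Nodup
  disj : ∀ x ∈ out, x ∉ T
  large : ∀ x ∈ T, ∀ m ∈ label x, k ≤ m
  le : ∀ x ∈ T, ∀ y ∈ T, label x ≤ label y → ∀ a ∈ out, G.Adj a x → ¬ G.Adj a y →
    ∃ d ∈ out, out.idxOf d < out.idxOf a ∧ G.Adj d y ∧ ¬ G.Adj d x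
  eq : ∀ x ∈ T, ∀ y ∈ T, (∀ a ∈ out, G.Adj a x ↔ G.Adj a y) → label x = label y
  nil : ∀ x ∈ T, label x = [] ↔ ∀ a ∈ out, ¬ G.Adj a x
  lex : ∀ a b c, (c ∈ out ∨ c ∈ T) → out.idxOf a < out.idxOf b → out.idxOf b < out.idxOf c →
    G.Adj a c → ¬ G.Adj a b → ∃ d ∈ out, out.idxOf d < out.idxOf a ∧ G.Adj d b ∧ ¬ G.Adj d c

theorem LexState.init (T : Finset V) (k : ℕ) : LexState G (fun _ => []) T [] k where
  nodup := List.nodup_nil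
  disj := by simp
  large := by simp
  le := by simp
  eq := by simp
  nil := by simp
  lex := by simp

theorem mem_slice {label : V → List ℕ} {T : Finset V} {v : V} :
    v ∈ slice label T ↔ v ∈ T ∧ ∀ w ∈ T, label w ≤ label v := by simp [slice]

theorem slice_nonempty {label : V → List ℕ} {T : Finset V} (h : T.Nonempty) :
    (slice label T).Nonempty := by
  obtain ⟨v, hv, hmax⟩ := Finset.exists_max_image T label h
  exact ⟨v, mem_slice.2 ⟨hv, hmax⟩⟩

theorem relabel_apply [DecidableRel G.Adj] {label : V → List ℕ} {T : Finset V} {p x : V} {k : ℕ}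
    (hx : x ∈ T) :
    relabel G label T p k x = label x ++ if G.Adj p x then [k] else [] := by
  by_cases h : G.Adj p x <;> simp [relabel, hx, h]

/-- The new entry `k` is below all entries of labels in `T`, so old strict comparisons persist and
`p` only decides between equal labels. The maximality of the label of `p` yields the search
condition for triples whose middle vertex is `p`. -/
theorem LexState.step [DecidableRel G.Adj] {label : V → List ℕ} {T : Finset V} {out : List V} {k : ℕ}
    (h : LexState G label T out (k + 1)) {p : V} (hp : p ∈ slice label T) :
    LexState G (relabel G label (T.erase p) p k) (T.erase p) (out ++ [p]) k := by
  obtain ⟨hpT, hmax⟩ := mem_slice.1 hp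
  have hpout : p ∉ out := fun hp => h.disj p hp hpT
  have hidx : ∀ x ∈ out, (out ++ [p]).idxOf x = out.idxOf x := fun x hx =>
    List.idxOf_append_of_mem hx
  have hidxp : (out ++ [p]).idxOf p = out.length := by simp [List.idxOf_append, hpout]
  constructor
  · exact List.nodup_append.2 ⟨h.nodup, List.nodup_singleton p, by
      rintro a ha b hb rfl
      exact hpout (List.mem_singleton.1 hb ▸ ha)⟩
  · intro x hx
    rcases List.mem_append.1 hx with hx | hx
    · exact fun hxT => h.disj x hx (Finset.mem_of_mem_erase hxT)
    · simp [List.mem_singleton.1 hx]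
  · intro x hx m hm
    rw [relabel_apply hx, List.mem_append] at hm
    rcases hm with hm | hm
    · exact (Nat.le_succ k).trans (h.large x (Finset.mem_of_mem_erase hx) m hm)
    · split_ifs at hm <;> simp_all
  · intro x hx y hy hle a ha hax hay
    have hxT := Finset.mem_of_mem_erase hx
    have hyT := Finset.mem_of_mem_erase hy
    rw [relabel_apply hx, relabel_apply hy] at hle
    have hsmall : ∀ m ∈ (if G.Adj p y then [k] else []), ∀ m' ∈ label x, m < m' := by
      intro m hm m' hm'
      have := h.large x hxT m' hm'
      split_ifs at hm <;> simp_all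
    have hle' : label x ≤ label y := by
      by_contra hlt
      exact (List.append_lt_append_of_lt (not_le.1 hlt) hsmall).not_ge hle
    rcases List.mem_append.1 ha with ha | ha
    · obtain ⟨d, hd, hda, hdy⟩ := h.le x hxT y hyT hle' a ha hax hay
      exact ⟨d, List.mem_append_left _ hd, by rwa [hidx d hd, hidx a ha], hdy⟩
    · obtain rfl := List.mem_singleton.1 ha
      -- The new vertex is adjacent to `x` only; with equal old labels `x` would now be strictly
      -- ahead. So the old labels differ, and an earlier vertex accounts for that in favour of `y`.
      have hne : label x ≠ label y := by
        intro he
        rw [he, if_pos hax, if_neg hay, List.append_nil] at hle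
        refine hle.not_gt ?_
        nth_rewrite 1 [← List.append_nil (label y)]
        exact List.append_left_lt (List.nil_lt_cons _ _)
      obtain ⟨d, hd, hdy, hdx⟩ : ∃ d ∈ out, G.Adj d y ∧ ¬ G.Adj d x := by
        by_contra! hcon
        apply hne
        apply h.eq x hxT y hyT
        refine fun d hd => ⟨fun hdx => ?_, hcon d hd⟩
        by_contra hdy
        obtain ⟨e, he, -, hey, hex⟩ := h.le x hxT y hyT hle' d hd hdx hdy
        exact hex (hcon e he hey)
      refine ⟨d, List.mem_append_left _ hd, ?_, hdy, hdx⟩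
      rw [hidx d hd, hidxp]
      exact List.idxOf_lt_length_iff.2 hd
  · intro x hx y hy hadj
    rw [relabel_apply hx, relabel_apply hy, h.eq x (Finset.mem_of_mem_erase hx) y
      (Finset.mem_of_mem_erase hy) fun a ha => hadj a (List.mem_append_left _ ha)]
    simp [hadj p (by simp)]
  · intro x hx
    rw [relabel_apply hx, List.append_eq_nil_iff, h.nil x (Finset.mem_of_mem_erase hx)]
    simp only [List.mem_append, List.mem_singleton, ite_eq_right_iff, List.cons_ne_nil, imp_false]
    constructor
    · rintro ⟨h1, h2⟩ a (ha | rfl)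
      exacts [h1 a ha, h2]
    · exact fun h' => ⟨fun a ha => h' a (Or.inl ha), h' p (Or.inr rfl)⟩
  · intro a b c hc hab hbc hac hnab
    have hc' : c ∈ out ∨ c ∈ T := by
      rcases hc with hc | hc
      · rcases List.mem_append.1 hc with hc | hc
        · exact Or.inl hc
        · exact Or.inr (List.mem_singleton.1 hc ▸ hpT)
      · exact Or.inr (Finset.mem_of_mem_erase hc)
    rcases List.idxOf_append_singleton_lt hpout hab with hab' | ⟨rfl, hb, hbp⟩
    · have ha := List.mem_of_idxOf_lt hab'
      rcases List.idxOf_append_singleton_lt hpout hbc with hbc' | ⟨rfl, hcout, hcp⟩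
      · obtain ⟨d, hd, hda, hdb⟩ := h.lex a b c hc' hab' hbc' hac hnab
        exact ⟨d, List.mem_append_left _ hd, by rwa [hidx d hd, hidx a ha], hdb⟩
      -- Here `b` is the vertex just chosen, and `c` is still unvisited, with a label that is no
      -- larger.
      · obtain ⟨d, hd, hda, hdb⟩ := h.le c (hc'.resolve_left hcout) b hpT
          (hmax c (hc'.resolve_left hcout)) a ha hac hnab
        exact ⟨d, List.mem_append_left _ hd, by rwa [hidx d hd, hidx a ha], hdb⟩
    · exfalso
      have := List.mem_of_idxOf_lt hbc
      simp [hb, hbp] at this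

theorem LexState.lexOrder {label : V → List ℕ} {out : List V} {k : ℕ}
    (h : LexState G label ∅ out k) : LexOrder G out.toFinset out.idxOf := by
  refine ⟨fun x hx y hy => out.injOn_idxOf (by simpa using hx) (by simpa using hy), ?_⟩
  intro a _ b _ c hc hab hbc hac hnab
  obtain ⟨d, hd, h'⟩ := h.lex a b c (Or.inl (by simpa using hc)) hab hbc hac hnab
  exact ⟨d, by simpa using hd, h'⟩

theorem List.idxOf_le_of_getLast?_filter {σ : List V} (hσ : σ.Nodup) {P : V → Bool} {p x : V}
    (h : (σ.filter P).getLast? = some p) (hx : x ∈ σ) (hP : P x) : σ.idxOf x ≤ σ.idxOf p := by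
  obtain ⟨ys, hys⟩ := List.getLast?_eq_some_iff.1 h
  obtain ⟨l₁, l₂, rfl, -, h₂⟩ := List.filter_eq_append_iff.1 hys
  obtain ⟨l₃, l₄, rfl, -, -, h₄⟩ := List.filter_eq_cons_iff.1 h₂
  rw [← List.append_assoc] at hx hσ ⊢
  have hp : p ∉ l₁ ++ l₃ := fun hp => by
    have := (List.nodup_append.1 hσ).2.2 p hp p (by simp)
    exact this rfl
  have hidx : (l₁ ++ l₃ ++ p :: l₄).idxOf p = (l₁ ++ l₃).length := by
    rw [List.idxOf_append_of_notMem hp]; simp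
  rw [hidx]
  rcases List.mem_append.1 hx with hx | hx
  · rw [List.idxOf_append_of_mem hx]
    exact List.idxOf_le_length
  · rcases List.mem_cons.1 hx with rfl | hx
    · exact hidx.le
    · have := List.filter_eq_nil_iff.1 h₄ x hx
      simp [hP] at this

/-- The vertices of `out` come in an order in which ties are broken in favour of the last vertex
of `σ`. -/
def TiesState (G : SimpleGraph V) (σ out : List V) : Prop :=
  ∀ x ∈ σ, ∀ y, out.idxOf y < out.idxOf x →
    (∀ a ∈ out, out.idxOf a < out.idxOf y → (G.Adj a y ↔ G.Adj a x)) → σ.idxOf x < σ.idxOf y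

theorem TiesState.step {σ out : List V} (h : TiesState G σ out) {p : V} (hp : p ∉ out)
    (hlast : ∀ x ∈ σ, x ∉ out → x ≠ p → (∀ a ∈ out, G.Adj a p ↔ G.Adj a x) →
      σ.idxOf x < σ.idxOf p) : TiesState G σ (out ++ [p]) := by
  intro x hx y hyx htie
  have hidx : ∀ x ∈ out, (out ++ [p]).idxOf x = out.idxOf x := fun x hx =>
    List.idxOf_append_of_mem hx
  rcases List.idxOf_append_singleton_lt hp hyx with h' | ⟨rfl, hxo, hxp⟩
  · have hy := List.mem_of_idxOf_lt h'
    refine h x hx y h' fun a ha hay => htie a (List.mem_append_left _ ha) ?_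
    rwa [hidx a ha, hidx y hy]
  · refine hlast x hx hxo hxp fun a ha => htie a (List.mem_append_left _ ha) ?_
    rw [hidx a ha]
    refine (List.idxOf_lt_length_iff.2 ha).trans_eq ?_
    simp [List.idxOf_append, hp]

theorem lexBFSPlusLoop_spec [DecidableRel G.Adj] {σ : List V} (hσ : σ.Nodup) {k : ℕ}
    {label : V → List ℕ} {out : List V}
    (hk : (σ.toFinset \ out.toFinset).card = k) (hsub : ∀ x ∈ out, x ∈ σ)
    (hs : LexState G label (σ.toFinset \ out.toFinset) out k) (ht : TiesState G σ out) :
    let τ := lexBFSPlusLoop G σ k label out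
    τ.Nodup ∧ τ.toFinset = σ.toFinset ∧ LexOrder G σ.toFinset τ.idxOf ∧ TiesState G σ τ := by
  induction k generalizing label out with
  | zero =>
    have hempty := Finset.card_eq_zero.1 hk
    have he : out.toFinset = σ.toFinset := by
      refine Finset.Subset.antisymm (fun x hx => ?_) (Finset.sdiff_eq_empty_iff_subset.1 hempty)
      simpa using hsub x (by simpa using hx)
    rw [hempty] at hs
    exact ⟨hs.nodup, he, he ▸ hs.lexOrder, ht⟩
  | succ k ih =>
    set T := σ.toFinset \ out.toFinset with hT
    have hTne : T.Nonempty := Finset.card_pos.1 (by omega)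
    obtain ⟨v, hv⟩ := slice_nonempty (label := label) hTne
    have hvσ : v ∈ σ := by
      have := (mem_slice.1 hv).1
      simp [hT] at this
      exact this.1
    obtain ⟨p, hp⟩ : ∃ p, (σ.filter (fun v => v ∈ slice label T)).getLast? = some p := by
      have : σ.filter (fun v => v ∈ slice label T) ≠ [] :=
        List.ne_nil_of_mem (List.mem_filter.2 ⟨hvσ, by simpa using hv⟩)
      exact ⟨_, List.getLast?_eq_some_getLast this⟩
    have hpm := List.mem_filter.1 (List.mem_of_getLast? hp)
    have hpσ := hpm.1
    have hps : p ∈ slice label T := by simpa using hpm.2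
    have hpT := (mem_slice.1 hps).1
    have hpo : p ∉ out := fun h => hs.disj p h hpT
    have hT' : σ.toFinset \ (out ++ [p]).toFinset = T.erase p := by
      ext x
      simp [hT]
      tauto
    rw [lexBFSPlusLoop]
    simp only [← hT, hp]
    apply ih
    · rw [hT', Finset.card_erase_of_mem hpT, hk]; rfl
    · intro x hx
      rcases List.mem_append.1 hx with hx | hx
      exacts [hsub x hx, List.mem_singleton.1 hx ▸ hpσ]
    · rw [hT']
      exact hs.step hps
    -- A vertex tied with `p` carries the same label, so it belongs to the slice, of which `p` is
    -- the last member in `σ`.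
    · refine ht.step hpo fun x hx hxo hxp hadj => ?_
      have hxT : x ∈ T := by simp [hT, hx, hxo]
      have hxs : x ∈ slice label T := by
        rw [mem_slice] at hps ⊢
        rw [hs.eq x hxT p hpT fun a ha => (hadj a ha).symm]
        exact ⟨hxT, hps.2⟩
      refine (List.idxOf_le_of_getLast?_filter hσ hp hx (by simpa using hxs)).lt_of_ne ?_
      exact fun he => hxp (σ.injOn_idxOf hx hpσ he)

theorem lexBFSPlus_spec [DecidableRel G.Adj] {σ : List V} (hσ : σ.Nodup) :
    (lexBFSPlus G σ).Nodup ∧ (lexBFSPlus G σ).toFinset = σ.toFinset ∧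
      LexOrder G σ.toFinset (lexBFSPlus G σ).idxOf ∧
      TiesBrokenBy G σ.toFinset σ.idxOf (lexBFSPlus G σ).idxOf := by
  obtain ⟨h1, h2, h3, h4⟩ := lexBFSPlusLoop_spec (G := G) (label := fun _ => []) (out := []) hσ
    (by simpa using List.toFinset_card_of_nodup hσ) (by simp) (LexState.init _ _)
    (by simp [TiesState])
  refine ⟨h1, h2, h3, fun x hx y hy hyx htie => h4 x (by simpa using hx) y hyx fun a ha => ?_⟩
  exact htie a (by simpa [← h2] using ha)

/-- The order found by three sweeps is sorted by every block rank, up to reversal. -/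
theorem lexBFSPlus_lexBFSPlus_sorted [DecidableRel G.Adj] {σ : List V} (hσ : σ.Nodup)
    (hc : ConnectedOn G σ.toFinset)
    (h₀ : LexOrder G σ.toFinset σ.idxOf) {r : V → ℤ} (hr : BlockRank G σ.toFinset r) :
    let τ := lexBFSPlus G (lexBFSPlus G σ)
    (∀ x ∈ σ, ∀ y ∈ σ, r x < r y → τ.idxOf x < τ.idxOf y) ∨
      ∀ x ∈ σ, ∀ y ∈ σ, r x < r y → τ.idxOf y < τ.idxOf x := by
  obtain ⟨hn₁, hs₁, hl₁, ht₁⟩ := lexBFSPlus_spec (G := G) hσ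
  obtain ⟨-, hs₂, hl₂, ht₂⟩ := lexBFSPlus_spec (G := G) hn₁
  rw [hs₁] at hl₂ ht₂
  simpa using three_sweeps hc hr h₀ hl₁ hl₂ ht₁ ht₂

end LexBFSLemmas

/-! ### Components and CO-Lex-BFS. -/

section CoLexBFSLemmas

variable {V : Type*} [DecidableEq V] {G : SimpleGraph V}

theorem IsWeakOrder.mem_getD_iff {ψ : List (Finset V)} {U : Finset V} (h : IsWeakOrder ψ U) {x : V}
    (hx : x ∈ U) {k : ℕ} : x ∈ ψ.getD k ∅ ↔ classIdx ψ x = k := by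
  by_cases hk : k < ψ.length
  · rw [List.getD_eq_getElem _ _ hk, h.mem_getElem_iff hx]
  · have h1 : classIdx ψ x < ψ.length := classIdx_lt_iff.2 (h.2.2 ▸ hx)
    rw [List.getD_eq_default _ _ (not_lt.1 hk)]
    simp
    omega

theorem IsWeakOrder.getD_subset {ψ : List (Finset V)} {U : Finset V} (h : IsWeakOrder ψ U) (k : ℕ) :
    ψ.getD k ∅ ⊆ U := by
  intro x hx
  by_cases hk : k < ψ.length
  · rw [List.getD_eq_getElem _ _ hk] at hx
    exact h.2.2 ▸ mem_ground.2 ⟨_, List.getElem_mem hk, hx⟩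
  · rw [List.getD_eq_default _ _ (not_lt.1 hk)] at hx
    simp at hx

theorem IsWeakOrder.firstIdx_eq {ψ : List (Finset V)} {U W : Finset V} (h : IsWeakOrder ψ U)
    (hW : W ⊆ U) {m : V} (hm : m ∈ W) (hmin : ∀ x ∈ W, classIdx ψ m ≤ classIdx ψ x) :
    firstIdx ψ W = classIdx ψ m := by
  have hlt : classIdx ψ m < ψ.length := classIdx_lt_iff.2 (h.2.2 ▸ hW hm)
  refine (List.findIdx_eq hlt).2 ⟨?_, fun j hj => ?_⟩
  · simpa using ⟨m, Finset.mem_inter.2 ⟨mem_classIdx (h.2.2 ▸ hW hm), hm⟩⟩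
  · simp only [decide_eq_false_iff_not]
    rintro ⟨x, hx⟩
    obtain ⟨hxj, hxW⟩ := Finset.mem_inter.1 hx
    have := hmin x hxW
    rw [h.mem_getElem_iff (hW hxW)] at hxj
    omega

theorem IsWeakOrder.exists_firstIdx {ψ : List (Finset V)} {U W : Finset V} (h : IsWeakOrder ψ U)
    (hW : W ⊆ U) (hne : W.Nonempty) :
    ∃ m ∈ W, firstIdx ψ W = classIdx ψ m ∧ ∀ x ∈ W, classIdx ψ m ≤ classIdx ψ x := by
  obtain ⟨m, hm, hmin⟩ := Finset.exists_min_image W (classIdx ψ) hne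
  exact ⟨m, hm, h.firstIdx_eq hW hm hmin, hmin⟩

theorem exists_lastIdx {ψ : List (Finset V)} {W : Finset V} (hne : W.Nonempty) :
    ∃ m ∈ W, lastIdx ψ W = classIdx ψ m := by
  obtain ⟨m, hm, h⟩ := Finset.exists_mem_eq_sup W hne (classIdx ψ)
  exact ⟨m, hm, h⟩

theorem classIdx_le_lastIdx {ψ : List (Finset V)} {W : Finset V} {x : V} (hx : x ∈ W) :
    classIdx ψ x ≤ lastIdx ψ W := Finset.le_sup hx

/-- An edge of `X` passing over `y` would make its ends adjacent to `y`. Hence the part of `X` to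
the left of `y` is closed under adjacency within `X`, and is all of `X` if it is nonempty. -/
theorem ConnectedOn.lt_of_lt {U X : Finset V} {r : V → ℤ} (hX : ConnectedOn G X) (hr : Umbrella G U r)
    (hXU : X ⊆ U) {x x' y : V} (hy : y ∈ U) (hn : ∀ a ∈ X, ¬ ClosedAdj G a y) (hx : x ∈ X)
    (hx' : x' ∈ X) (hxy : r x < r y) : r x' < r y := by
  have hS := hX (X.filter fun a => r a < r y) (Finset.filter_subset _ _)
    ⟨x, by simp [hx, hxy]⟩ (by
      intro a ha b hb hab
      rw [Finset.mem_filter] at ha ⊢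
      refine ⟨hb, ?_⟩
      by_contra hby
      exact hn a ha.1 (hr a (hXU ha.1) y hy b (hXU hb) ha.2.le (not_lt.1 hby) (Or.inr hab)).1)
  rw [← hS] at hx'
  exact (Finset.mem_filter.1 hx').2

/-- In an umbrella order, two components are not interleaved. -/
theorem ConnectedOn.lt_of_lt₂ {U X Y : Finset V} {r : V → ℤ} (hX : ConnectedOn G X)
    (hY : ConnectedOn G Y) (hr : Umbrella G U r) (hXU : X ⊆ U) (hYU : Y ⊆ U)
    (hn : ∀ a ∈ X, ∀ b ∈ Y, ¬ ClosedAdj G a b) {x x' y y' : V} (hx : x ∈ X) (hx' : x' ∈ X)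
    (hy : y ∈ Y) (hy' : y' ∈ Y) (hxy : r x < r y) : r x' < r y' := by
  have h1 := hX.lt_of_lt hr hXU (hYU hy) (fun a ha => hn a ha y hy) hx hx' hxy
  have h2 := hY.lt_of_lt hr.neg hYU (hXU hx') (fun a ha h => hn x' hx' a ha h.symm) hy hy'
    (by simpa using h1)
  simpa using h2

/-- `c` lists the vertices of a component of `G[U]` in the order of a lexicographic breadth-first
search. -/
structure IsSearchedComponent (G : SimpleGraph V) (U : Finset V) (c : List V) : Prop where
  ne_nil : c ≠ []
  nodup : c.Nodup
  subset : c.toFinset ⊆ U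
  conn : ConnectedOn G c.toFinset
  lex : LexOrder G c.toFinset c.idxOf
  closed : ∀ x ∈ c, ∀ y ∈ U, G.Adj x y → y ∈ c

theorem IsSearchedComponent.nonempty {U : Finset V} {c : List V} (h : IsSearchedComponent G U c) :
    c.toFinset.Nonempty := by
  simpa [List.toFinset_nonempty_iff] using h.ne_nil

/-- The completed components, the last one first, are in an order consistent with `ψ`. -/
structure ComponentStack (G : SimpleGraph V) (U : Finset V) (ψ done : List _) : Prop where
  comp : ∀ c ∈ done, IsSearchedComponent G U c
  disj : done.Pairwise fun c c' => ∀ x ∈ c, x ∉ c'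
  mono : done.Pairwise fun c c' => ∀ x ∈ c, ∀ y ∈ c', classIdx ψ y ≤ classIdx ψ x

/-- No vertex of `T` comes in `ψ` before the last completed component. -/
def AboveTop (ψ : List (Finset V)) (done : List (List V)) (T : Finset V) : Prop :=
  ∀ c ∈ done.head?, ∀ x ∈ T, firstIdx ψ c.toFinset ≤ classIdx ψ x

/-- One swap is enough to keep the stack sorted: no vertex of the new component precedes the first
class of the old top, which already comes weakly after every deeper component. So the new component
can only have to go just below the top. -/
theorem closeComponent_some {U T : Finset V} {ψ : List (Finset V)} (hψ : IsWeakOrder ψ U)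
    {done done' : List (List V)} {cur : List V} (hd : ComponentStack G U ψ done)
    (hcur : IsSearchedComponent G U cur) (hdisj : ∀ c ∈ done, ∀ x ∈ cur, x ∉ c)
    (htop : AboveTop ψ done (cur.toFinset ∪ T))
    (hT : ∀ x ∈ T, firstIdx ψ cur.toFinset ≤ classIdx ψ x)
    (h : closeComponent ψ done cur = some done') :
    ComponentStack G U ψ done' ∧ AboveTop ψ done' T ∧
      ∀ x, x ∈ done'.flatten ↔ x ∈ done.flatten ∨ x ∈ cur := by
  unfold closeComponent at h
  split_ifs at h with hmid
  rcases done with _ | ⟨prev, rest⟩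
  · obtain rfl := Option.some_injective _ h
    exact ⟨⟨by simpa using hcur, by simp, by simp⟩, by simpa [AboveTop] using hT, by simp⟩
  · have hprev := hd.comp prev (by simp)
    obtain ⟨m, hm, hfm, hmin⟩ := hψ.exists_firstIdx hprev.subset hprev.nonempty
    obtain ⟨hd2, hd2'⟩ := List.pairwise_cons.1 hd.disj
    obtain ⟨hd3, hd3'⟩ := List.pairwise_cons.1 hd.mono
    have hrest : ∀ c ∈ rest, ∀ x ∈ cur, ∀ y ∈ c, classIdx ψ y ≤ classIdx ψ x := by
      intro c hc x hx y hy
      have := htop prev (by simp) x (by simp [hx])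
      exact (hd3 c hc m (by simpa using hm) y hy).trans (hfm ▸ this)
    dsimp only at h
    split_ifs at h with hsub hlt
    · obtain rfl := Option.some_injective _ h
      refine ⟨⟨?_, ?_, ?_⟩, ?_, ?_⟩
      · intro c hc
        simp only [List.mem_cons] at hc
        rcases hc with rfl | rfl | hc
        exacts [hprev, hcur, hd.comp c (by simp [hc])]
      · refine List.pairwise_cons.2 ⟨?_, List.pairwise_cons.2
          ⟨fun c hc => hdisj c (by simp [hc]), hd2'⟩⟩
        intro c hc
        rcases List.mem_cons.1 hc with rfl | hc
        · exact fun x hx hx' => hdisj prev (by simp) x hx' hx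
        · exact hd2 c hc
      · refine List.pairwise_cons.2 ⟨?_, List.pairwise_cons.2 ⟨hrest, hd3'⟩⟩
        intro c hc
        rcases List.mem_cons.1 hc with rfl | hc
        · intro x hx y hy
          have hy' : y ∈ c.toFinset := by simpa using hy
          have := (hψ.mem_getD_iff (hcur.subset hy')).1 (hsub hy')
          rw [this, hfm]
          exact hmin x (by simpa using hx)
        · exact hd3 c hc
      · intro c hc x hx
        exact htop c (by simpa using hc) x (by simp [hx])
      · intro x
        simp only [List.flatten_cons, List.mem_append]
        tauto
    · obtain rfl := Option.some_injective _ h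
      obtain ⟨m', hm', hfm', hmin'⟩ := hψ.exists_firstIdx hcur.subset hcur.nonempty
      refine ⟨⟨?_, ?_, ?_⟩, ?_, ?_⟩
      · intro c hc
        rcases List.mem_cons.1 hc with rfl | hc
        exacts [hcur, hd.comp c hc]
      · exact List.pairwise_cons.2 ⟨hdisj, hd.disj⟩
      · refine List.pairwise_cons.2 ⟨?_, hd.mono⟩
        intro c hc
        rcases List.mem_cons.1 hc with rfl | hc
        · intro x hx y hy
          have h1 := classIdx_le_lastIdx (ψ := ψ) (W := c.toFinset) (x := y) (by simpa using hy)
          have h2 := hmin' x (by simpa using hx)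
          omega
        · exact hrest c hc
      · intro c hc x hx
        simp only [List.head?_cons, Option.mem_def, Option.some.injEq] at hc
        exact hc ▸ hT x hx
      · intro x
        simp only [List.flatten_cons, List.mem_append]
        tauto

/-- Either way of stopping exhibits a configuration that `ψ` forces and an umbrella order forbids: a
foreign vertex strictly inside a component, or two interleaved components. -/
theorem closeComponent_none {U T : Finset V} {ψ : List (Finset V)} (hψ : IsWeakOrder ψ U)
    {done : List (List V)} {cur : List V} (hd : ComponentStack G U ψ done)
    (hcur : IsSearchedComponent G U cur) (hdisj : ∀ c ∈ done, ∀ x ∈ cur, x ∉ c)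
    (htop : AboveTop ψ done (cur.toFinset ∪ T))
    (h : closeComponent ψ done cur = none) {r : V → ℤ} (hr : Umbrella G U r) :
    ¬ ∀ x y, WeakLT ψ x y → r x < r y := by
  intro hrψ
  have hlt : ∀ x ∈ U, ∀ y ∈ U, classIdx ψ x < classIdx ψ y → r x < r y := fun x hx y hy h =>
    hrψ x y (hψ.weakLT_iff.2 ⟨hx, hy, h⟩)
  obtain ⟨m, hm, hfm, hmin⟩ := hψ.exists_firstIdx hcur.subset hcur.nonempty
  unfold closeComponent at h
  split_ifs at h with hmid
  · obtain ⟨k, hk, hsub⟩ := hmid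
    obtain ⟨y, hyk, hyc⟩ := Finset.not_subset.1 hsub
    have hyU := hψ.getD_subset k hyk
    have hky := (hψ.mem_getD_iff hyU).1 hyk
    obtain ⟨z, hz, hlz⟩ := exists_lastIdx (ψ := ψ) hcur.nonempty
    rw [Finset.mem_Ioo, hfm, hlz, ← hky] at hk
    have hn : ∀ a ∈ cur.toFinset, ¬ ClosedAdj G a y := by
      rintro a ha (rfl | hadj)
      · exact hyc ha
      · exact hyc (by simpa using hcur.closed a (by simpa using ha) y hyU hadj)
    have h1 := hlt m (hcur.subset hm) y hyU hk.1
    have h2 := hlt y hyU z (hcur.subset hz) hk.2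
    exact h2.not_gt (hcur.conn.lt_of_lt hr hcur.subset hyU hn hm hz h1)
  · rcases done with _ | ⟨prev, rest⟩
    · simp at h
    have hprev := hd.comp prev (by simp)
    obtain ⟨m', hm', hfm', hmin'⟩ := hψ.exists_firstIdx hprev.subset hprev.nonempty
    dsimp only at h
    split_ifs at h with hsub hl
    obtain ⟨z, hz, hlz⟩ := exists_lastIdx (ψ := ψ) hprev.nonempty
    rw [hfm, hlz] at hl
    -- The failed second test puts `m` of `cur` before `z` of `prev`. The failed first test, with
    -- `AboveTop`, puts some `y` of `cur` after `m'` of `prev`.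
    have h1 := hlt m (hcur.subset hm) z (hprev.subset hz) hl
    obtain ⟨y, hy, hyn⟩ := Finset.not_subset.1 hsub
    have h2 := htop prev (by simp) y (by simp [List.mem_toFinset.1 hy])
    have h3 : classIdx ψ m' < classIdx ψ y := by
      refine (hfm' ▸ h2).lt_of_ne fun he => hyn ?_
      rw [hψ.mem_getD_iff (hcur.subset hy), ← he, hfm']
    have h4 := hlt m' (hprev.subset hm') y (hcur.subset hy) h3
    have hn : ∀ a ∈ cur.toFinset, ∀ b ∈ prev.toFinset, ¬ ClosedAdj G a b := by
      rintro a ha b hb (rfl | hadj)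
      · exact hdisj prev (by simp) a (by simpa using ha) (by simpa using hb)
      · exact hdisj prev (by simp) b
          (hcur.closed a (by simpa using ha) b (hprev.subset hb) hadj) (by simpa using hb)
    exact h4.not_gt (hcur.conn.lt_of_lt₂ hprev.conn hr hcur.subset hprev.subset hn hm hy hz hm' h1)

/-- The components found by CO-Lex-BFS, each in the order of the search. -/
structure ComponentsSpec (G : SimpleGraph V) (U : Finset V) (ψ comps : List _) : Prop where
  comp : ∀ c ∈ comps, IsSearchedComponent G U c
  weak : IsWeakOrder (comps.map List.toFinset) U
  sep : ∀ x y, WeakLT (comps.map List.toFinset) x y → ¬ G.Adj x y ∧ ¬ WeakLT ψ y x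

theorem ComponentStack.spec {U : Finset V} {ψ : List (Finset V)} (hψ : IsWeakOrder ψ U)
    {done : List (List V)} (h : ComponentStack G U ψ done) (hU : ∀ x ∈ U, x ∈ done.flatten) :
    ComponentsSpec G U ψ done.reverse := by
  have hw : IsWeakOrder (done.map List.toFinset) U := by
    refine ⟨?_, ?_, ?_⟩
    · intro B hB
      obtain ⟨c, hc, rfl⟩ := List.mem_map.1 hB
      exact (h.comp c hc).nonempty
    · refine List.pairwise_map.2 (h.disj.imp fun hd => ?_)
      rw [Finset.disjoint_left]
      simpa using hd
    · ext x
      rw [mem_ground]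
      constructor
      · rintro ⟨B, hB, hx⟩
        obtain ⟨c, hc, rfl⟩ := List.mem_map.1 hB
        exact (h.comp c hc).subset hx
      · intro hx
        obtain ⟨c, hc, hxc⟩ := List.mem_flatten.1 (hU x hx)
        exact ⟨c.toFinset, List.mem_map_of_mem hc, by simpa using hxc⟩
  refine ⟨fun c hc => h.comp c (List.mem_reverse.1 hc), by rw [List.map_reverse]; exact hw.reverse,
    ?_⟩
  intro x y hxy
  rw [List.map_reverse, weakLT_reverse, weakLT_iff_getElem] at hxy
  obtain ⟨i, j, hi, hj, hij, hy, hx⟩ := hxy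
  rw [List.length_map] at hi hj
  rw [List.getElem_map, List.mem_toFinset] at hx hy
  have hci := h.comp _ (List.getElem_mem hi)
  have hcj := h.comp _ (List.getElem_mem hj)
  constructor
  · intro hadj
    exact List.pairwise_iff_getElem.1 h.disj i j hi hj hij y hy
      (hcj.closed x hx y (hci.subset (by simpa using hy)) hadj)
  · intro hlt
    have := List.pairwise_iff_getElem.1 h.mono i j hi hj hij y hy x hx
    exact (hψ.weakLT_iff.1 hlt).2.2.not_ge this

theorem LexState.congr {label label' : V → List ℕ} {T : Finset V} {out : List V} {k : ℕ}
    (h : LexState G label T out k) (he : ∀ x ∈ T, label' x = label x) :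
    LexState G label' T out k where
  nodup := h.nodup
  disj := h.disj
  large x hx := by rw [he x hx]; exact h.large x hx
  le x hx y hy := by rw [he x hx, he y hy]; exact h.le x hx y hy
  eq x hx y hy := by rw [he x hx, he y hy]; exact h.eq x hx y hy
  nil x hx := by rw [he x hx]; exact h.nil x hx
  lex := h.lex

theorem LexState.restrict {label : V → List ℕ} {T T' : Finset V} {out : List V} {k : ℕ}
    (h : LexState G label T out k) (hT : T' ⊆ T) : LexState G label T' out k where
  nodup := h.nodup
  disj x hx hxT := h.disj x hx (hT hxT)
  large x hx := h.large x (hT hx)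
  le x hx y hy := h.le x (hT hx) y (hT hy)
  eq x hx y hy := h.eq x (hT hx) y (hT hy)
  nil x hx := h.nil x (hT hx)
  lex a b c hc := h.lex a b c (hc.imp_right fun h => hT h)

/-- Every vertex of `c` but the first one has a neighbour that comes earlier. -/
def Reached (G : SimpleGraph V) (c : List V) : Prop :=
  ∀ y ∈ c, 0 < c.idxOf y → ∃ t ∈ c, c.idxOf t < c.idxOf y ∧ G.Adj t y

theorem Reached.step {c : List V} (h : Reached G c) {p : V} (hp : p ∉ c)
    (ht : ∃ t ∈ c, G.Adj t p) : Reached G (c ++ [p]) := by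
  have hidx : ∀ x ∈ c, (c ++ [p]).idxOf x = c.idxOf x := fun x hx => List.idxOf_append_of_mem hx
  intro y hy hy0
  rcases List.mem_append.1 hy with hy | hy
  · rw [hidx y hy] at hy0 ⊢
    obtain ⟨t, ht, hlt, hadj⟩ := h y hy hy0
    exact ⟨t, List.mem_append_left _ ht, by rwa [hidx t ht], hadj⟩
  · obtain rfl := List.mem_singleton.1 hy
    obtain ⟨t, ht, hadj⟩ := ht
    refine ⟨t, List.mem_append_left _ ht, ?_, hadj⟩
    rw [hidx t ht]
    refine (List.idxOf_lt_length_iff.2 ht).trans_eq ?_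
    simp [List.idxOf_append, hp]

/-- Going back along earlier neighbours leads to the first vertex, so a part closed under adjacency
contains a vertex if and only if it contains the first one. -/
theorem Reached.connectedOn {c : List V} (h : Reached G c) : ConnectedOn G c.toFinset := by
  intro S hS hne hcl
  have hc : c ≠ [] := by
    rintro rfl
    obtain ⟨x, hx⟩ := hne
    simpa using hS hx
  obtain ⟨s, l, rfl⟩ := List.exists_cons_of_ne_nil hc
  have key : ∀ y ∈ s :: l, (y ∈ S ↔ s ∈ S) := by
    intro y hy
    induction hk : (s :: l).idxOf y using Nat.strong_induction_on generalizing y with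
    | _ k ih =>
      subst hk
      by_cases h0 : 0 < (s :: l).idxOf y
      · obtain ⟨t, ht, hlt, hadj⟩ := h y hy h0
        rw [← ih _ hlt t ht rfl]
        exact ⟨fun hy' => hcl y hy' t (by simpa using ht) hadj.symm,
          fun ht' => hcl t ht' y (by simpa using hy) hadj⟩
      · have : (s :: l).idxOf y = (s :: l).idxOf s := by simp at h0 ⊢; omega
        rw [(List.idxOf_inj hy).1 this]
  obtain ⟨x, hx⟩ := hne
  have hs := (key x (by simpa using hS hx)).1 hx
  exact Finset.Subset.antisymm hS fun y hy => (key y (by simpa using hy)).2 hs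

/-- The state of CO-Lex-BFS with unvisited vertices `T`. -/
structure SearchState (G : SimpleGraph V) (U : Finset V) (ψ : List (Finset V)) (T : Finset V)
    (label : V → List ℕ) (done : List (List V)) (cur : List V) (k : ℕ) : Prop where
  unvisited : U \ (done.flatten ++ cur).toFinset = T
  card : T.card = k
  stack : ComponentStack G U ψ done
  ne_nil : cur ≠ []
  subset : ∀ x ∈ cur, x ∈ U
  disj : ∀ c ∈ done, ∀ x ∈ cur, x ∉ c
  lex : LexState G label T cur k
  reached : Reached G cur
  top : AboveTop ψ done (cur.toFinset ∪ T)
  first : ∀ x ∈ T, firstIdx ψ cur.toFinset ≤ classIdx ψ x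

theorem SearchState.isSearchedComponent {U T : Finset V} {ψ : List (Finset V)}
    {label : V → List ℕ} {done : List (List V)} {cur : List V} {k : ℕ}
    (h : SearchState G U ψ T label done cur k) (hnil : ∀ x ∈ T, label x = []) :
    IsSearchedComponent G U cur where
  ne_nil := h.ne_nil
  nodup := h.lex.nodup
  subset x hx := h.subset x (by simpa using hx)
  conn := h.reached.connectedOn
  lex := (h.lex.restrict (Finset.empty_subset T)).lexOrder
  closed x hx y hy hadj := by
    by_contra hyc
    by_cases hyd : y ∈ done.flatten
    · obtain ⟨c, hc, hyc'⟩ := List.mem_flatten.1 hyd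
      exact h.disj c hc x hx ((h.stack.comp c hc).closed y hyc' x (h.subset x hx) hadj.symm)
    · have hyT : y ∈ T := by
        rw [← h.unvisited]
        simp only [Finset.mem_sdiff, List.mem_toFinset, List.mem_append]
        tauto
      exact (h.lex.nil y hyT).1 (hnil y hyT) x hx hadj

/-- `SearchState` is preserved whichever admissible vertex is visited, so each clause holds for
every choice. A stop is always caused by `closeComponent`, to which `closeComponent_none` applies.
-/
theorem coLexBFSLoop_spec [DecidableRel G.Adj] {U : Finset V} {ψ : List (Finset V)}
    (hψ : IsWeakOrder ψ U)
    {T : Finset V} {label : V → List ℕ} {done : List (List V)} {cur : List V} {k : ℕ}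
    (h : SearchState G U ψ T label done cur k) :
    (coLexBFSLoop G U ψ k label done cur).Nonempty ∧
      (∀ comps, some comps ∈ coLexBFSLoop G U ψ k label done cur → ComponentsSpec G U ψ comps) ∧
      (none ∈ coLexBFSLoop G U ψ k label done cur →
        ∀ r, Umbrella G U r → ¬ ∀ x y, WeakLT ψ x y → r x < r y) := by
  induction k generalizing T label done cur with
  | zero =>
    have hT : T = ∅ := Finset.card_eq_zero.1 h.card
    have hcur := h.isSearchedComponent (by simp [hT])
    rw [coLexBFSLoop]
    cases hclose : closeComponent ψ done cur with
    | none =>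
      refine ⟨by simp, by simp, fun _ r hr => ?_⟩
      exact closeComponent_none hψ h.stack hcur h.disj h.top hclose hr
    | some done' =>
      obtain ⟨h1, -, h3⟩ := closeComponent_some hψ h.stack hcur h.disj h.top h.first hclose
      refine ⟨by simp, ?_, by simp⟩
      intro comps hcomps
      simp only [Finset.mem_singleton, Option.some.injEq] at hcomps
      subst hcomps
      refine h1.spec hψ fun x hx => ?_
      rw [h3]
      by_contra hn
      have : x ∈ T := by
        rw [← h.unvisited]
        simp only [Finset.mem_sdiff, List.mem_toFinset, List.mem_append]
        exact ⟨hx, hn⟩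
      simp [hT] at this
  | succ k ih =>
    have hTne : T.Nonempty := Finset.card_pos.1 (by rw [h.card]; omega)
    rw [coLexBFSLoop]
    simp only [h.unvisited]
    set C := (slice label T).filter
      (fun p => ∀ q ∈ slice label T, classIdx ψ p ≤ classIdx ψ q) with hC
    have hCne : C.Nonempty := by
      obtain ⟨p, hp, hmin⟩ := Finset.exists_min_image (slice label T) (classIdx ψ)
        (slice_nonempty hTne)
      exact ⟨p, Finset.mem_filter.2 ⟨hp, hmin⟩⟩
    set F : V → Finset (Option (List (List V))) := fun p =>
      if label p = [] then
        match closeComponent ψ done cur with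
        | none => {none}
        | some done' => coLexBFSLoop G U ψ k (relabel G label (T.erase p) p k) done' [p]
      else coLexBFSLoop G U ψ k (relabel G label (T.erase p) p k) done (cur ++ [p]) with hF
    suffices hmain : ∀ p ∈ C, (F p).Nonempty ∧
        (∀ comps, some comps ∈ F p → ComponentsSpec G U ψ comps) ∧
        (none ∈ F p → ∀ r, Umbrella G U r → ¬ ∀ x y, WeakLT ψ x y → r x < r y) by
      refine ⟨?_, ?_, ?_⟩
      · obtain ⟨p, hp⟩ := hCne
        obtain ⟨o, ho⟩ := (hmain p hp).1
        exact ⟨o, Finset.mem_biUnion.2 ⟨p, hp, ho⟩⟩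
      · intro comps hcomps
        obtain ⟨p, hp, ho⟩ := Finset.mem_biUnion.1 hcomps
        exact (hmain p hp).2.1 comps ho
      · intro hnone
        obtain ⟨p, hp, ho⟩ := Finset.mem_biUnion.1 hnone
        exact (hmain p hp).2.2 ho
    intro p hp
    obtain ⟨hps, hpmin⟩ := Finset.mem_filter.1 hp
    obtain ⟨hpT, hpmax⟩ := mem_slice.1 hps
    have hpU : p ∈ U ∧ p ∉ done.flatten ∧ p ∉ cur := by
      have := hpT
      rw [← h.unvisited] at this
      simp only [Finset.mem_sdiff, List.mem_toFinset, List.mem_append, not_or] at this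
      exact this
    have hcard : (T.erase p).card = k := by
      rw [Finset.card_erase_of_mem hpT, h.card]; rfl
    simp only [hF]
    split_ifs with hpl
    -- The label of `p` is the largest one, so if it is empty they all are: the component is
    -- complete, and `p` comes first in `ψ` among all unvisited vertices.
    · have hnil : ∀ x ∈ T, label x = [] := fun x hx => by
        have := hpmax x hx
        rw [hpl] at this
        by_contra hne
        obtain ⟨a, l, hl⟩ := List.exists_cons_of_ne_nil hne
        rw [hl] at this
        exact this.not_gt (List.nil_lt_cons _ _)
      have hcur := h.isSearchedComponent hnil
      cases hclose : closeComponent ψ done cur with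
      | none =>
        refine ⟨by simp, by simp, fun _ r hr => ?_⟩
        exact closeComponent_none hψ h.stack hcur h.disj h.top hclose hr
      | some done' =>
        obtain ⟨h1, h2, h3⟩ := closeComponent_some hψ h.stack hcur h.disj h.top h.first hclose
        have hslice : ∀ x ∈ T, x ∈ slice label T := fun x hx =>
          mem_slice.2 ⟨hx, fun w hw => by rw [hnil w hw, hnil x hx]⟩
        have hpmin' : ∀ x ∈ T, classIdx ψ p ≤ classIdx ψ x := fun x hx => hpmin x (hslice x hx)
        refine ih (T := T.erase p) ⟨?_, hcard, h1, by simp, by simpa using hpU.1, ?_, ?_, ?_, ?_, ?_⟩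
        · ext x
          rw [← h.unvisited]
          simp only [Finset.mem_sdiff, List.mem_toFinset, List.mem_append, Finset.mem_erase, h3,
            List.mem_singleton]
          tauto
        · intro c hc x hx hxc
          obtain rfl := List.mem_singleton.1 hx
          have := (h3 x).1 (List.mem_flatten.2 ⟨c, hc, hxc⟩)
          tauto
        -- With all labels empty, the search of the next component begins like a fresh one.
        · have := ((LexState.init (G := G) T (k + 1)).congr (label' := label) hnil).step hps
          simpa using this
        · intro y hy hy0
          obtain rfl := List.mem_singleton.1 hy
          simp at hy0
        · intro c hc x hx
          refine h2 c hc x ?_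
          rcases Finset.mem_union.1 hx with hx | hx
          · have : x = p := by simpa using hx
            exact this ▸ hpT
          · exact Finset.mem_of_mem_erase hx
        · intro x hx
          rw [hψ.firstIdx_eq (m := p) (by simpa using hpU.1) (by simp) (by simp)]
          exact hpmin' x (Finset.mem_of_mem_erase hx)
    · obtain ⟨t, ht, htp⟩ : ∃ t ∈ cur, G.Adj t p := by
        by_contra! hcon
        exact hpl ((h.lex.nil p hpT).2 hcon)
      have hsub : cur.toFinset ⊆ U := fun x hx => h.subset x (by simpa using hx)
      obtain ⟨m, hm, hfm, hmin⟩ := hψ.exists_firstIdx hsub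
        (by simpa [List.toFinset_nonempty_iff] using h.ne_nil)
      have hpm : classIdx ψ m ≤ classIdx ψ p := hfm ▸ h.first p hpT
      refine ih (T := T.erase p) ⟨?_, hcard, h.stack, by simp, ?_, ?_, h.lex.step hps,
        h.reached.step hpU.2.2 ⟨t, ht, htp⟩, ?_, ?_⟩
      · ext x
        rw [← h.unvisited]
        simp only [Finset.mem_sdiff, List.mem_toFinset, List.mem_append, Finset.mem_erase,
          List.mem_singleton]
        tauto
      · intro x hx
        rcases List.mem_append.1 hx with hx | hx
        exacts [h.subset x hx, List.mem_singleton.1 hx ▸ hpU.1]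
      · intro c hc x hx hxc
        rcases List.mem_append.1 hx with hx | hx
        · exact h.disj c hc x hx hxc
        · obtain rfl := List.mem_singleton.1 hx
          exact hpU.2.1 (List.mem_flatten.2 ⟨c, hc, hxc⟩)
      · intro c hc x hx
        refine h.top c hc x ?_
        simp only [List.toFinset_append, Finset.mem_union, List.mem_toFinset, List.mem_singleton,
          Finset.mem_erase] at hx ⊢
        rcases hx with (hx | rfl) | hx
        exacts [Or.inl hx, Or.inr hpT, Or.inr hx.2]
      · intro x hx
        rw [hψ.firstIdx_eq (m := m) ?_ (by simp [List.mem_toFinset.1 hm]) ?_, ← hfm]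
        · exact h.first x (Finset.mem_of_mem_erase hx)
        · intro y hy
          simp only [List.mem_toFinset, List.mem_append, List.mem_singleton] at hy
          rcases hy with hy | rfl
          exacts [h.subset y hy, hpU.1]
        · intro y hy
          simp only [List.mem_toFinset, List.mem_append, List.mem_singleton] at hy
          rcases hy with hy | rfl
          exacts [hmin y (by simpa using hy), hpm]

theorem coLexBFS_spec [DecidableRel G.Adj] {U : Finset V} {ψ : List (Finset V)}
    (hψ : IsWeakOrder ψ U) :
    (coLexBFS G U ψ).Nonempty ∧
      (∀ comps σ, some (comps, σ) ∈ coLexBFS G U ψ →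
        ∃ cs, ComponentsSpec G U ψ cs ∧ comps = cs.map List.toFinset ∧ σ = cs.flatten) ∧
      (none ∈ coLexBFS G U ψ →
        ∀ r, Umbrella G U r → ¬ ∀ x y, WeakLT ψ x y → r x < r y) := by
  rcases ψ with _ | ⟨B, ψ⟩
  · obtain rfl := isWeakOrder_nil.1 hψ
    refine ⟨by simp [coLexBFS], ?_, by simp [coLexBFS]⟩
    intro comps σ h
    simp only [coLexBFS, Finset.mem_singleton, Option.some.injEq, Prod.mk.injEq] at h
    exact ⟨[], ⟨by simp, by simp, by simp⟩, by simp [h.1], by simp [h.2]⟩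
  · obtain ⟨⟨u₀, hu₀⟩, hBU, -⟩ := hψ.of_cons
    have hB0 : ∀ u ∈ B, classIdx (B :: ψ) u = 0 := fun u hu => by
      simp [classIdx, List.findIdx_cons, hu]
    suffices hmain : ∀ u ∈ B, ∀ S, S = coLexBFSLoop G U (B :: ψ) U.card
        (fun v => if v = u then [U.card] else []) [] [] →
        S.Nonempty ∧ (∀ comps, some comps ∈ S → ComponentsSpec G U (B :: ψ) comps) ∧
        (none ∈ S → ∀ r, Umbrella G U r → ¬ ∀ x y, WeakLT (B :: ψ) x y → r x < r y) by
      refine ⟨?_, ?_, ?_⟩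
      · obtain ⟨o, ho⟩ := (hmain u₀ hu₀ _ rfl).1
        exact ⟨_, Finset.mem_image_of_mem _ (Finset.mem_biUnion.2 ⟨u₀, hu₀, ho⟩)⟩
      · intro comps σ h
        obtain ⟨o, ho, he⟩ := Finset.mem_image.1 h
        obtain ⟨u, hu, ho⟩ := Finset.mem_biUnion.1 ho
        obtain ⟨cs, rfl, heq⟩ := Option.map_eq_some_iff.1 he
        have he := Prod.mk.inj heq
        exact ⟨cs, (hmain u hu _ rfl).2.1 cs ho, he.1.symm, he.2.symm⟩
      · intro h
        obtain ⟨o, ho, he⟩ := Finset.mem_image.1 h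
        obtain ⟨u, hu, ho⟩ := Finset.mem_biUnion.1 ho
        rw [Option.map_eq_none_iff] at he
        exact (hmain u hu _ rfl).2.2 (he ▸ ho)
    rintro u hu _ rfl
    have huU := hBU hu
    obtain ⟨k, hk⟩ : ∃ k, U.card = k + 1 :=
      ⟨U.card - 1, by have := Finset.card_pos.2 ⟨u, huU⟩; omega⟩
    set label : V → List ℕ := fun v => if v = u then [U.card] else [] with hlabel
    -- The initial label only serves to single out `u`. Being nonempty, it also prevents the closing
    -- of an empty component at the first step.
    have hslice : slice label U = {u} := by
      ext p
      rw [mem_slice, Finset.mem_singleton]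
      constructor
      · rintro ⟨-, hmax⟩
        by_contra hne
        have := hmax u huU
        simp only [hlabel, if_pos, if_neg hne] at this
        exact this.not_gt (List.nil_lt_cons _ _)
      · rintro rfl
        refine ⟨huU, fun w _ => ?_⟩
        by_cases hw : w = p
        · rw [hw]
        · simpa [hlabel, hw] using (List.nil_lt_cons _ _).le
    rw [hk, coLexBFSLoop]
    have hfilter : (({u} : Finset V).filter
        (fun p => ∀ q ∈ ({u} : Finset V), classIdx (B :: ψ) p ≤ classIdx (B :: ψ) q)) = {u} := by
      rw [Finset.filter_singleton, if_pos (by simp)]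
    have hlu : label u ≠ [] := by simp [hlabel]
    simp only [List.flatten_nil, List.nil_append, List.toFinset_nil, Finset.sdiff_empty, hslice,
      hfilter, Finset.singleton_biUnion, hlu, if_false]
    refine coLexBFSLoop_spec hψ (T := U.erase u) ⟨?_, ?_, ⟨by simp, by simp, by simp⟩, by simp,
      by simpa using huU, by simp, ?_, ?_, by simp [AboveTop], ?_⟩
    · simp [Finset.sdiff_singleton_eq_erase]
    · rw [Finset.card_erase_of_mem huU, hk]; rfl
    · have := (LexState.init (G := G) U (k + 1)).step (p := u)
        (mem_slice.2 ⟨huU, fun _ _ => le_rfl⟩)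
      refine this.congr fun x hx => ?_
      rw [relabel_apply hx, relabel_apply hx]
      simp [hlabel, Finset.ne_of_mem_erase hx]
    · intro y hy hy0
      obtain rfl := List.mem_singleton.1 hy
      simp at hy0
    · intro x _
      rw [hψ.firstIdx_eq (m := u) (by simpa using huU) (by simp) (by simp), hB0 u hu]
      exact Nat.zero_le _

/-- The vertex order restricted to one of its parts. -/
theorem filter_flatten_eq {cs : List (List V)}
    (h : (cs.map List.toFinset).Pairwise fun B C => Disjoint B C)
    {c : List V} (hc : c ∈ cs) : cs.flatten.filter (fun v => v ∈ c.toFinset) = c := by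
  induction cs with
  | nil => simp at hc
  | cons d cs ih =>
    rw [List.map_cons, List.pairwise_cons] at h
    rw [List.flatten_cons, List.filter_append]
    rcases List.mem_cons.1 hc with rfl | hc'
    · have h1 : c.filter (fun v => v ∈ c.toFinset) = c := by simp
      have h2 : cs.flatten.filter (fun v => v ∈ c.toFinset) = [] := by
        simp only [List.filter_eq_nil_iff, List.mem_flatten, decide_eq_true_eq]
        rintro x ⟨e, he, hx⟩ hxc
        exact Finset.disjoint_left.1 (h.1 _ (List.mem_map_of_mem he)) hxc (by simpa using hx)
      rw [h1, h2, List.append_nil]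
    · have h1 : d.filter (fun v => v ∈ c.toFinset) = [] := by
        simp only [List.filter_eq_nil_iff, decide_eq_true_eq]
        intro x hx hxc
        exact Finset.disjoint_left.1 (h.1 _ (List.mem_map_of_mem hc')) (by simpa using hx) hxc
      rw [h1, ih h.2 hc', List.nil_append]

end CoLexBFSLemmas

/-! ### Straight_enumeration on a component. -/

section StraightLemmas

variable {V : Type*} {G : SimpleGraph V}

theorem Twins.symm {U : Finset V} {x y : V} (h : Twins G U x y) : Twins G U y x :=
  fun w hw => (h w hw).symm

theorem Twins.trans {U : Finset V} {x y z : V} (h : Twins G U x y) (h' : Twins G U y z) :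
    Twins G U x z := fun w hw => (h w hw).trans (h' w hw)

theorem Twins.closedAdj_congr {U : Finset V} {x x' y y' : V} (hx : x' ∈ U) (hy : y ∈ U)
    (hxx : Twins G U x x') (hyy : Twins G U y y') (h : ClosedAdj G x y) : ClosedAdj G x' y' :=
  ((hyy x' hx).1 ((hxx y hy).1 h).symm).symm

/-- Twin classes are intervals of an umbrella order, so each vertex can be given the least rank of
its twins without reversing any pair. -/
theorem Umbrella.exists_blockRank {U : Finset V} {r : V → ℤ} (h : Umbrella G U r) :
    ∃ f : V → ℤ, BlockRank G U f ∧ (∀ x ∈ U, ∃ x' ∈ U, f x = r x') ∧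
      ∀ x ∈ U, ∀ y ∈ U, f x < f y → r x < r y := by
  classical
  have hex : ∀ x, ∃ m, x ∈ U → m ∈ U ∧ Twins G U x m ∧ ∀ y ∈ U, Twins G U x y → r m ≤ r y := by
    intro x
    by_cases hx : x ∈ U
    · obtain ⟨m, hm, hmin⟩ := Finset.exists_min_image (U.filter (Twins G U x)) r
        ⟨x, Finset.mem_filter.2 ⟨hx, fun _ _ => Iff.rfl⟩⟩
      rw [Finset.mem_filter] at hm
      exact ⟨m, fun _ => ⟨hm.1, hm.2, fun y hy ht => hmin y (Finset.mem_filter.2 ⟨hy, ht⟩)⟩⟩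
    · exact ⟨x, fun h => absurd h hx⟩
  choose m hm using hex
  refine ⟨fun x => r (m x), ⟨?_, ?_⟩, fun x hx => ⟨m x, (hm x hx).1, rfl⟩, ?_⟩
  · intro x hx y hy z hz hxy hyz hxz
    obtain ⟨hx1, hx2, -⟩ := hm x hx
    obtain ⟨hy1, hy2, -⟩ := hm y hy
    obtain ⟨hz1, hz2, -⟩ := hm z hz
    obtain ⟨h1, h2⟩ := h _ hx1 _ hy1 _ hz1 hxy hyz (hx2.closedAdj_congr hx1 hz hz2 hxz)
    exact ⟨hx2.symm.closedAdj_congr hx hy1 hy2.symm h1, hy2.symm.closedAdj_congr hy hz1 hz2.symm h2⟩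
  · intro x hx y hy ht
    obtain ⟨hx1, hx2, hx3⟩ := hm x hx
    obtain ⟨hy1, hy2, hy3⟩ := hm y hy
    exact le_antisymm (hx3 _ hy1 (ht.trans hy2)) (hy3 _ hx1 (ht.symm.trans hx2))
  · intro x hx y hy hlt
    by_contra hle
    obtain ⟨hx1, hx2, hx3⟩ := hm x hx
    obtain ⟨hy1, hy2, hy3⟩ := hm y hy
    have ht := h.twins_between hx1 hy hx (hlt.le.trans (hy3 y hy fun _ _ => Iff.rfl)) (not_lt.1 hle)
      hx2.symm
    exact hlt.not_ge (hy3 _ hx1 ht.symm)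

variable [DecidableEq V] [DecidableRel G.Adj] {τ : List V}

theorem lmn_le {u v : V} (hu : u ∈ τ) (h : ClosedAdj G v u) :
    lmn G τ v ≤ τ.idxOf u + 1 := by
  have hi := List.idxOf_lt_length_iff.2 hu
  by_contra hlt
  have := List.not_of_lt_findIdx (xs := τ) (p := fun u => decide (u = v ∨ G.Adj v u))
    (i := τ.idxOf u) (by unfold lmn at hlt; omega)
  rw [List.getElem_idxOf hi] at this
  have h' : u = v ∨ G.Adj v u := h.imp_left Eq.symm
  simp [h'] at this

theorem exists_lmn {v : V} (hτ : τ.Nodup) (hv : v ∈ τ) :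
    ∃ u ∈ τ, ClosedAdj G v u ∧ lmn G τ v = τ.idxOf u + 1 := by
  have hlt : τ.findIdx (fun u => decide (u = v ∨ G.Adj v u)) < τ.length :=
    List.findIdx_lt_length_of_exists ⟨v, hv, by simp⟩
  have h := List.findIdx_getElem (w := hlt)
  refine ⟨_, List.getElem_mem hlt, ?_, ?_⟩
  · exact (of_decide_eq_true h).imp_left Eq.symm
  · rw [lmn, hτ.idxOf_getElem _ hlt]

theorem le_rmn {u v : V} (hu : u ∈ τ) (h : ClosedAdj G v u) : τ.idxOf u + 1 ≤ rmn G τ v :=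
  Finset.le_sup (f := fun u => τ.idxOf u + 1) (by simpa [hu] using h.imp_left Eq.symm)

theorem exists_rmn {v : V} (hv : v ∈ τ) :
    ∃ u ∈ τ, ClosedAdj G v u ∧ rmn G τ v = τ.idxOf u + 1 := by
  obtain ⟨u, hu, h⟩ := Finset.exists_mem_eq_sup (τ.toFinset.filter (fun u => u = v ∨ G.Adj v u))
    ⟨v, by simp [hv]⟩ (fun u => τ.idxOf u + 1)
  rw [Finset.mem_filter, List.mem_toFinset] at hu
  exact ⟨u, hu.1, hu.2.imp_left Eq.symm, h⟩

/-- The test of Straight_enumeration succeeds if the closed neighbourhood is an interval. -/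
theorem rmn_sub_lmn_eq_degIn_iff {v : V} (hτ : τ.Nodup) (hv : v ∈ τ) :
    rmn G τ v - lmn G τ v = degIn G τ v ↔
      ∀ u ∈ τ, lmn G τ v ≤ τ.idxOf u + 1 → τ.idxOf u + 1 ≤ rmn G τ v → ClosedAdj G v u := by
  set N := τ.toFinset.filter (fun u => u = v ∨ G.Adj v u) with hN
  set M := τ.toFinset.filter
    (fun u => lmn G τ v ≤ τ.idxOf u + 1 ∧ τ.idxOf u + 1 ≤ rmn G τ v) with hM
  have hmemN : ∀ u, u ∈ N ↔ u ∈ τ ∧ ClosedAdj G v u := fun u => by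
    simp [hN, ClosedAdj, eq_comm]
  have hNM : N ⊆ M := by
    intro u hu
    obtain ⟨hu, hadj⟩ := (hmemN u).1 hu
    exact Finset.mem_filter.2 ⟨by simpa using hu, lmn_le hu hadj, le_rmn hu hadj⟩
  have hNcard : N.card = degIn G τ v + 1 := by
    have : N = insert v (τ.toFinset.filter (fun u => G.Adj v u)) := by
      ext u
      rw [hmemN, Finset.mem_insert, Finset.mem_filter, List.mem_toFinset]
      constructor
      · rintro ⟨hu, rfl | h⟩
        exacts [Or.inl rfl, Or.inr ⟨hu, h⟩]
      · rintro (rfl | ⟨hu, h⟩)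
        exacts [⟨hv, Or.inl rfl⟩, ⟨hu, Or.inr h⟩]
    rw [this, Finset.card_insert_of_notMem (by simp)]
    rfl
  obtain ⟨a, ha, -, hla⟩ := exists_lmn (G := G) hτ hv
  obtain ⟨b, hb, -, hrb⟩ := exists_rmn (G := G) hv
  have h1 := lmn_le hv (ClosedAdj.refl G v)
  have h2 := le_rmn (τ := τ) hv (ClosedAdj.refl G v)
  have hbl := List.idxOf_lt_length_iff.2 hb
  have hMcard : M.card = rmn G τ v - lmn G τ v + 1 := by
    have himg : M.image (fun u => τ.idxOf u + 1) = Finset.Icc (lmn G τ v) (rmn G τ v) := by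
      ext i
      simp only [hM, Finset.mem_image, Finset.mem_filter, List.mem_toFinset, Finset.mem_Icc]
      constructor
      · rintro ⟨u, ⟨-, h⟩, rfl⟩
        exact h
      · rintro ⟨hi1, hi2⟩
        have hi : i - 1 < τ.length := by omega
        have he : τ.idxOf τ[i - 1] + 1 = i := by rw [hτ.idxOf_getElem _ hi]; omega
        exact ⟨τ[i - 1], ⟨List.getElem_mem hi, by rw [he]; exact ⟨hi1, hi2⟩⟩, he⟩
    rw [← Finset.card_image_of_injOn (s := M) (f := fun u => τ.idxOf u + 1), himg, Nat.card_Icc]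
    · omega
    · intro x hx y hy hxy
      rw [Finset.mem_coe, Finset.mem_filter, List.mem_toFinset] at hx hy
      exact τ.injOn_idxOf hx.1 hy.1 (Nat.succ_injective hxy)
  have hcards : rmn G τ v - lmn G τ v = degIn G τ v ↔ M ⊆ N := by
    constructor
    · intro h
      exact (Finset.eq_of_subset_of_card_le hNM (by omega)).ge
    · intro h
      have := Finset.card_le_card h
      have := Finset.card_le_card hNM
      omega
  rw [hcards]
  constructor
  · intro h u hu hl hr
    exact ((hmemN u).1 (h (Finset.mem_filter.2 ⟨by simpa using hu, hl, hr⟩))).2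
  · intro h u hu
    simp only [hM, Finset.mem_filter, List.mem_toFinset] at hu
    exact (hmemN u).2 ⟨hu.1, h u hu.1 hu.2.1 hu.2.2⟩

theorem umbrella_idxOf_iff (hτ : τ.Nodup) :
    Umbrella G τ.toFinset (fun x => (τ.idxOf x : ℤ)) ↔
      ∀ v ∈ τ, rmn G τ v - lmn G τ v = degIn G τ v := by
  constructor
  · intro h v hv
    rw [rmn_sub_lmn_eq_degIn_iff hτ hv]
    intro u hu hl hr
    have hvW : v ∈ τ.toFinset := by simpa using hv
    have huW : u ∈ τ.toFinset := by simpa using hu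
    rcases le_total (τ.idxOf u) (τ.idxOf v) with hle | hle
    · obtain ⟨a, ha, hva, hla⟩ := exists_lmn (G := G) hτ hv
      exact (h a (by simpa using ha) u huW v hvW (by simp; omega) (by simpa using hle)
        hva.symm).2.symm
    · obtain ⟨b, hb, hvb, hrb⟩ := exists_rmn (G := G) hv
      exact (h v hvW u huW b (by simpa using hb) (by simpa using hle) (by simp; omega) hvb).1
  · intro h x hx y hy z hz hxy hyz hxz
    simp only [Nat.cast_le, List.mem_toFinset] at hx hy hz hxy hyz
    constructor
    · refine (rmn_sub_lmn_eq_degIn_iff hτ hx).1 (h x hx) y hy ?_ ?_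
      · exact (lmn_le hx (ClosedAdj.refl G x)).trans (by omega)
      · exact (Nat.succ_le_succ hyz).trans (le_rmn hz hxz)
    · refine ((rmn_sub_lmn_eq_degIn_iff hτ hz).1 (h z hz) y hy ?_ ?_).symm
      · exact (lmn_le hx hxz.symm).trans (by omega)
      · exact (Nat.succ_le_succ hyz).trans (le_rmn hz (ClosedAdj.refl G z))

/-- Two vertices have the same leftmost and the same rightmost neighbours. -/
def SameSpan (G : SimpleGraph V) [DecidableRel G.Adj] (τ : List V) (x y : V) : Prop :=
  lmn G τ x = lmn G τ y ∧ rmn G τ x = rmn G τ y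

/-- Once the tests succeed, a closed neighbourhood is an interval, determined by its two ends. -/
theorem sameSpan_iff_twins (hτ : τ.Nodup)
    (h : ∀ v ∈ τ, rmn G τ v - lmn G τ v = degIn G τ v) {x y : V} (hx : x ∈ τ) (hy : y ∈ τ) :
    SameSpan G τ x y ↔ Twins G τ.toFinset x y := by
  have key : ∀ v ∈ τ, ∀ u ∈ τ, ClosedAdj G v u ↔
      lmn G τ v ≤ τ.idxOf u + 1 ∧ τ.idxOf u + 1 ≤ rmn G τ v := fun v hv u hu =>
    ⟨fun h' => ⟨lmn_le hu h', le_rmn hu h'⟩,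
      fun h' => (rmn_sub_lmn_eq_degIn_iff hτ hv).1 (h v hv) u hu h'.1 h'.2⟩
  constructor
  · rintro ⟨h1, h2⟩ w hw
    rw [List.mem_toFinset] at hw
    rw [key x hx w hw, key y hy w hw, h1, h2]
  · intro ht
    constructor
    · obtain ⟨a, ha, hxa, hla⟩ := exists_lmn (G := G) hτ hx
      obtain ⟨b, hb, hyb, hlb⟩ := exists_lmn (G := G) hτ hy
      exact le_antisymm (hlb ▸ lmn_le hb ((ht b (by simpa using hb)).2 hyb))
        (hla ▸ lmn_le ha ((ht a (by simpa using ha)).1 hxa))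
    · obtain ⟨a, ha, hxa, hra⟩ := exists_rmn (G := G) hx
      obtain ⟨b, hb, hyb, hrb⟩ := exists_rmn (G := G) hy
      exact le_antisymm (hra ▸ le_rmn ha ((ht a (by simpa using ha)).1 hxa))
        (hrb ▸ le_rmn hb ((ht b (by simpa using hb)).2 hyb))

theorem straightLoop_some {l r : ℕ} {blocks φ : List (Finset V)} {vs : List V}
    (h : straightLoop G τ l r blocks vs = some φ) :
    ∀ v ∈ vs, rmn G τ v - lmn G τ v = degIn G τ v := by
  induction vs generalizing l r blocks with
  | nil => simp
  | cons v vs ih =>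
    rw [List.forall_mem_cons]
    cases blocks with
    | nil =>
      rw [straightLoop] at h
      split_ifs at h with hv
      exact ⟨not_not.1 hv, ih h⟩
    | cons C Cs =>
      rw [straightLoop] at h
      split_ifs at h with hv hs
      exacts [⟨not_not.1 hv, ih h⟩, ⟨not_not.1 hv, ih h⟩]

/-- The blocks are accumulated in reverse, so the invariant `hlt` orders them backwards. The loop
compares `v` with the current block only; this is sufficient because vertices with equal spans are
consecutive (`hcontig`). For an empty list of blocks `l` and `r` are irrelevant. -/
theorem straightLoop_spec (hτ : τ.Nodup)
    (hcontig : ∀ x ∈ τ, ∀ y ∈ τ, ∀ z ∈ τ, τ.idxOf x ≤ τ.idxOf y → τ.idxOf y ≤ τ.idxOf z →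
      SameSpan G τ x z → SameSpan G τ y z)
    {l r : ℕ} {blocks : List (Finset V)} {pre vs : List V} (hsplit : τ = pre ++ vs)
    (hvs : ∀ v ∈ vs, rmn G τ v - lmn G τ v = degIn G τ v)
    (hw : IsWeakOrder blocks pre.toFinset)
    (hlt : ∀ x ∈ pre, ∀ y ∈ pre,
      (WeakLT blocks y x ↔ τ.idxOf x < τ.idxOf y ∧ ¬ SameSpan G τ x y))
    (hhead : ∀ C ∈ blocks.head?, (∃ y ∈ C, ∀ x ∈ pre, τ.idxOf x ≤ τ.idxOf y) ∧
      ∀ x ∈ C, lmn G τ x = l ∧ rmn G τ x = r) :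
    ∃ φ, straightLoop G τ l r blocks vs = some φ ∧ IsWeakOrder φ τ.toFinset ∧
      ∀ x ∈ τ, ∀ y ∈ τ, (WeakLT φ x y ↔ τ.idxOf x < τ.idxOf y ∧ ¬ SameSpan G τ x y) := by
  induction vs generalizing l r blocks pre with
  | nil =>
    rw [List.append_nil] at hsplit
    refine ⟨blocks.reverse, rfl, by rw [hsplit]; exact hw.reverse, ?_⟩
    intro x hx y hy
    rw [weakLT_reverse]
    exact hlt x (by rwa [← hsplit]) y (by rwa [← hsplit])
  | cons v vs ih =>
    rw [List.forall_mem_cons] at hvs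
    have hsplit' : τ = (pre ++ [v]) ++ vs := by rw [hsplit]; simp
    have hvpre : v ∉ pre := fun hv => by
      rw [hsplit] at hτ
      exact (List.nodup_append.1 hτ).2.2 v hv v (by simp) rfl
    have hvτ : v ∈ τ := by rw [hsplit]; simp
    have hpreτ : ∀ x ∈ pre, x ∈ τ := fun x hx => by rw [hsplit]; simp [hx]
    have hvidx : τ.idxOf v = pre.length := by
      rw [hsplit, List.idxOf_append_of_notMem hvpre]; simp
    have hpreidx : ∀ x ∈ pre, τ.idxOf x < τ.idxOf v := fun x hx => by
      rw [hvidx, hsplit, List.idxOf_append_of_mem hx]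
      exact List.idxOf_lt_length_iff.2 hx
    have hground : ground blocks = pre.toFinset := hw.2.2
    have hmax : ∀ x ∈ pre ++ [v], τ.idxOf x ≤ τ.idxOf v := by
      intro x hx
      rcases List.mem_append.1 hx with hx | hx
      · exact (hpreidx x hx).le
      · rw [List.mem_singleton.1 hx]
    have hset : (pre ++ [v]).toFinset = insert v pre.toFinset := by
      ext x; simp
    -- the case in which `v` forms a new block
    have hnew : (∀ x ∈ pre, ¬ SameSpan G τ x v) →
        ∃ φ, straightLoop G τ (lmn G τ v) (rmn G τ v) ({v} :: blocks) vs = some φ ∧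
          IsWeakOrder φ τ.toFinset ∧
          ∀ x ∈ τ, ∀ y ∈ τ, (WeakLT φ x y ↔ τ.idxOf x < τ.idxOf y ∧ ¬ SameSpan G τ x y) := by
      intro hne
      refine ih hsplit' hvs.2 ?_ ?_ ?_
      · have := isWeakOrder_append (isWeakOrder_singleton (Finset.singleton_nonempty v)) hw
          (by simpa using hvpre)
        rwa [List.singleton_append, Finset.singleton_union, ← hset] at this
      · intro x hx y hy
        rw [weakLT_cons, hground, Finset.mem_singleton, List.mem_toFinset]
        rcases List.mem_append.1 hy with hy | hy
        · have hyv : y ≠ v := fun h => hvpre (h ▸ hy)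
          rcases List.mem_append.1 hx with hx | hx
          · rw [hlt x hx y hy]
            simp [hyv]
          · have hyp := hy
            obtain rfl := List.mem_singleton.1 hx
            have h1 := hpreidx y hyp
            have h2 : ¬ WeakLT blocks y x := fun h => hvpre (by simpa [hground] using h.mem_right)
            simp only [hyv, h2, false_and, or_false, false_iff, not_and]
            omega
        · obtain rfl := List.mem_singleton.1 hy
          have h2 : ¬ WeakLT blocks y x := fun h => hvpre (by simpa [hground] using h.mem_left)
          rcases List.mem_append.1 hx with hx | hx
          · simp [hx, hpreidx x hx, hne x hx]
          · obtain rfl := List.mem_singleton.1 hx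
            simp [hvpre, h2]
      · intro C hC
        simp only [List.head?_cons, Option.mem_def, Option.some.injEq] at hC
        subst hC
        exact ⟨⟨v, by simp, hmax⟩, by simp⟩
    cases blocks with
    | nil =>
      rw [straightLoop, if_neg (not_not.2 hvs.1)]
      have hpre : pre = [] := by
        have := isWeakOrder_nil.1 hw
        simpa using this
      exact hnew (by simp [hpre])
    | cons C Cs =>
      obtain ⟨⟨y₀, hy₀C, hy₀max⟩, hCspan⟩ := hhead C (by simp)
      have hy₀pre : y₀ ∈ pre := by
        have : y₀ ∈ ground (C :: Cs) := by simp [hy₀C]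
        simpa [hground] using this
      have hspan₀ := hCspan y₀ hy₀C
      rw [straightLoop, if_neg (not_not.2 hvs.1)]
      split_ifs with hv
      · obtain ⟨hCne, -, hCd, hgr, hCs⟩ := hw.of_cons
        -- Since `v` has the span of the last vertex `y₀`, the older blocks are the visited vertices
        -- that `hlt` separates from `y₀`.
        have hrest : ∀ x, x ∈ ground Cs ↔ x ∈ pre ∧ ¬ SameSpan G τ x v := by
          intro x
          have hspan : SameSpan G τ x v ↔ SameSpan G τ x y₀ := by
            rw [SameSpan, SameSpan, hv.1, hv.2, hspan₀.1, hspan₀.2]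
          rw [hspan]
          constructor
          · intro hx
            have hxp : x ∈ pre := by
              have : x ∈ ground (C :: Cs) := by simp [hx]
              simpa [hground] using this
            exact ⟨hxp, ((hlt x hxp y₀ hy₀pre).1 (weakLT_cons.2 (Or.inl ⟨hy₀C, hx⟩))).2⟩
          · rintro ⟨hxp, hns⟩
            have hne : τ.idxOf x ≠ τ.idxOf y₀ := fun he => hns (by
              rw [τ.injOn_idxOf (hpreτ x hxp) (hpreτ y₀ hy₀pre) he]; exact ⟨rfl, rfl⟩)
            have := (hlt x hxp y₀ hy₀pre).2 ⟨(hy₀max x hxp).lt_of_ne hne, hns⟩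
            rcases weakLT_cons.1 this with h | h
            exacts [h.2, h.mem_right]
        have hvg : v ∉ ground Cs := fun h => hvpre ((hrest v).1 h).1
        have hvC : v ∉ C := fun h => hvpre (by
          have : v ∈ ground (C :: Cs) := by simp [h]
          simpa [hground] using this)
        refine ih hsplit' hvs.2 ?_ ?_ ?_
        · have := isWeakOrder_append (isWeakOrder_singleton (Finset.insert_nonempty v C)) hCs
            (by rw [← hgr, Finset.disjoint_insert_left]; exact ⟨hvg, hCd⟩)
          rw [List.singleton_append] at this
          convert this using 1
          rw [hset, ← hgr, ← hground, ground_cons, Finset.insert_union]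
        · intro x hx y hy
          rw [weakLT_cons, Finset.mem_insert]
          rcases List.mem_append.1 hy with hy | hy
          · have hyv : y ≠ v := fun h => hvpre (h ▸ hy)
            rcases List.mem_append.1 hx with hx | hx
            · rw [← hlt x hx y hy, weakLT_cons]
              simp [hyv]
            · have hyp := hy
              obtain rfl := List.mem_singleton.1 hx
              have h1 := hpreidx y hyp
              have h2 : ¬ WeakLT Cs y x := fun h => hvg h.mem_right
              simp only [hvg, h2, and_false, or_false, false_iff, not_and]
              omega
          · obtain rfl := List.mem_singleton.1 hy
            have h2 : ¬ WeakLT Cs y x := fun h => hvg h.mem_left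
            rw [hrest]
            rcases List.mem_append.1 hx with hx | hx
            · simp [hx, h2, hpreidx x hx]
            · obtain rfl := List.mem_singleton.1 hx
              simp [hvpre, h2]
        · intro D hD
          simp only [List.head?_cons, Option.mem_def, Option.some.injEq] at hD
          subst hD
          refine ⟨⟨v, by simp, hmax⟩, ?_⟩
          intro x hx
          rcases Finset.mem_insert.1 hx with rfl | hx
          exacts [hv, hCspan x hx]
      -- An earlier vertex with the span of `v` would force the same span on `y₀`, which lies
      -- between them.
      · refine hnew fun x hx hs => hv ?_
        have := hcontig x (hpreτ x hx) y₀ (hpreτ y₀ hy₀pre) v hvτ (hy₀max x hx)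
          (hpreidx y₀ hy₀pre).le hs
        exact ⟨this.1.symm.trans hspan₀.1, this.2.symm.trans hspan₀.2⟩

/-- If the closed neighbourhoods are intervals of `τ`, the loop of Straight_enumeration finds the
blocks in the order of `τ`. -/
theorem straightLoop_of_umbrella (hτ : τ.Nodup)
    (h : Umbrella G τ.toFinset (fun x => (τ.idxOf x : ℤ))) :
    ∃ φ, straightLoop G τ 0 0 [] τ = some φ ∧ IsWeakOrder φ τ.toFinset ∧
      ∀ x ∈ τ, ∀ y ∈ τ, (WeakLT φ x y ↔ τ.idxOf x < τ.idxOf y ∧ ¬ Twins G τ.toFinset x y) := by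
  have hall := (umbrella_idxOf_iff hτ).1 h
  obtain ⟨φ, h1, h2, h3⟩ := straightLoop_spec (G := G) hτ (l := 0) (r := 0) (blocks := [])
    (pre := []) (vs := τ) (by
      intro x hx y hy z hz hxy hyz hs
      rw [sameSpan_iff_twins hτ hall hx hz] at hs
      rw [sameSpan_iff_twins hτ hall hy hz]
      exact (h.twins_between (by simpa using hx) (by simpa using hy) (by simpa using hz)
        (by simpa using hxy) (by simpa using hyz) hs).symm.trans hs)
    (by simp) hall (by simp) (by simp) (by simp)
  refine ⟨φ, h1, h2, fun x hx y hy => ?_⟩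
  rw [h3 x hx y hy, sameSpan_iff_twins hτ hall hx hy]

/-- The degree tests alone certify the answer: connectedness and the quality of the sweeps play no
role in soundness. -/
theorem straightEnumeration_some {σ : List V} (hσ : σ.Nodup) {φ : List (Finset V)}
    (h : straightEnumeration G σ = some φ) :
    IsWeakOrder φ σ.toFinset ∧ BlockRank G σ.toFinset (fun x => (classIdx φ x : ℤ)) := by
  obtain ⟨hn₁, hs₁, -⟩ := lexBFSPlus_spec (G := G) hσ
  obtain ⟨hn₂, hs₂, -⟩ := lexBFSPlus_spec (G := G) hn₁
  rw [hs₁] at hs₂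
  rw [straightEnumeration] at h
  set τ := lexBFSPlus G (lexBFSPlus G σ)
  have hu := (umbrella_idxOf_iff hn₂).2 (straightLoop_some h)
  obtain ⟨φ', hφ', hw, hlt⟩ := straightLoop_of_umbrella hn₂ hu
  obtain rfl : φ = φ' := Option.some_injective _ (h.symm.trans hφ')
  rw [← hs₂]
  have hiff : ∀ x ∈ τ.toFinset, ∀ y ∈ τ.toFinset, (classIdx φ x < classIdx φ y ↔
      τ.idxOf x < τ.idxOf y ∧ ¬ Twins G τ.toFinset x y) := fun x hx y hy => by
    rw [← hlt x (by simpa using hx) y (by simpa using hy), hw.weakLT_iff]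
    simp [List.mem_toFinset.1 hx, List.mem_toFinset.1 hy]
  -- The class order can disagree with `τ` only between twins, for which adjacency can be
  -- transferred directly.
  have hle : ∀ x ∈ τ.toFinset, ∀ y ∈ τ.toFinset, classIdx φ x ≤ classIdx φ y →
      τ.idxOf x ≤ τ.idxOf y ∨ Twins G τ.toFinset y x := by
    intro x hx y hy hxy
    by_contra! hcon
    exact ((hiff y hy x hx).2 hcon).not_ge hxy
  refine ⟨hw, ?_, ?_⟩
  · intro x hx y hy z hz hxy hyz hxz
    simp only [Nat.cast_le] at hxy hyz
    rcases hle x hx y hy hxy with h1 | h1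
    · rcases hle y hy z hz hyz with h2 | h2
      · exact hu x hx y hy z hz (by simpa using h1) (by simpa using h2) hxz
      · exact ⟨((h2 x hx).1 hxz.symm).symm, (h2 y hy).2 (ClosedAdj.refl G y) |>.symm⟩
    · exact ⟨(h1 y hy).1 (ClosedAdj.refl G y), (h1 z hz).2 hxz⟩
  · intro x hx y hy ht
    simp only [Nat.cast_inj]
    apply le_antisymm <;> rw [← not_lt]
    · exact fun hlt => ((hiff y hy x hx).1 hlt).2 ht.symm
    · exact fun hlt => ((hiff x hx y hy).1 hlt).2 ht

/-- On a connected proper interval graph, Straight_enumeration succeeds, and finds the order of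
any block rank up to reversal. -/
theorem straightEnumeration_of_blockRank {σ : List V} (hσ : σ.Nodup)
    (hc : ConnectedOn G σ.toFinset) (h₀ : LexOrder G σ.toFinset σ.idxOf) {r : V → ℤ}
    (hr : BlockRank G σ.toFinset r) :
    ∃ φ, straightEnumeration G σ = some φ ∧
      ((∀ x ∈ σ, ∀ y ∈ σ, r x < r y → WeakLT φ x y) ∨
        ∀ x ∈ σ, ∀ y ∈ σ, r x < r y → WeakLT φ y x) := by
  obtain ⟨hn₁, hs₁, -⟩ := lexBFSPlus_spec (G := G) hσ
  obtain ⟨hn₂, hs₂, -⟩ := lexBFSPlus_spec (G := G) hn₁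
  have hsort := lexBFSPlus_lexBFSPlus_sorted hσ hc h₀ hr
  rw [hs₁] at hs₂
  rw [straightEnumeration]
  dsimp only at hsort ⊢
  set τ := lexBFSPlus G (lexBFSPlus G σ)
  have hmem : ∀ x, x ∈ τ ↔ x ∈ σ := fun x => by
    rw [← List.mem_toFinset, hs₂, List.mem_toFinset]
  have hu : Umbrella G τ.toFinset (fun x => (τ.idxOf x : ℤ)) := by
    rw [hs₂]
    intro x hx y hy z hz hxy hyz hxz
    simp only [Nat.cast_le] at hxy hyz
    rw [List.mem_toFinset] at hx hy hz
    rcases hsort with hsort | hsort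
    · have h1 : r x ≤ r y := not_lt.1 fun h => (hsort y hy x hx h).not_ge hxy
      have h2 : r y ≤ r z := not_lt.1 fun h => (hsort z hz y hy h).not_ge hyz
      exact hr.1 x (by simpa) y (by simpa) z (by simpa) h1 h2 hxz
    · have h1 : r y ≤ r x := not_lt.1 fun h => (hsort x hx y hy h).not_ge hxy
      have h2 : r z ≤ r y := not_lt.1 fun h => (hsort y hy z hz h).not_ge hyz
      have := hr.1 z (by simpa) y (by simpa) x (by simpa) h2 h1 hxz.symm
      exact ⟨this.2.symm, this.1.symm⟩
  obtain ⟨φ, h1, -, h3⟩ := straightLoop_of_umbrella hn₂ hu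
  have hnt : ∀ x ∈ σ, ∀ y ∈ σ, r x < r y → ¬ Twins G τ.toFinset x y := fun x hx y hy h ht =>
    h.ne (hr.2 x (by simpa) y (by simpa) (hs₂ ▸ ht))
  refine ⟨φ, h1, ?_⟩
  refine hsort.imp (fun hsort x hx y hy h => ?_) (fun hsort x hx y hy h => ?_)
  · exact (h3 x ((hmem x).2 hx) y ((hmem y).2 hy)).2 ⟨hsort x hx y hy h, hnt x hx y hy h⟩
  · exact (h3 y ((hmem y).2 hy) x ((hmem x).2 hx)).2
      ⟨hsort x hx y hy h, fun ht => hnt x hx y hy h ht.symm⟩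

end StraightLemmas

/-! ### Refine and common refinements. -/

section RefineLemmas

variable {V : Type*} [DecidableEq V]

theorem IsWeakOrder.eq_nil {φ : List (Finset V)} {W : Finset V} (h : IsWeakOrder φ W) (hW : W = ∅) :
    φ = [] := by
  cases φ with
  | nil => rfl
  | cons B φ =>
    obtain ⟨⟨x, hx⟩, hB, -⟩ := h.of_cons
    simpa [hW] using hB hx

theorem refineOrder_spec {ψ φ : List (Finset V)} {U : Finset V} (hψ : IsWeakOrder ψ U)
    (hφ : IsWeakOrder φ U) (h : refineOrder ψ φ ≠ []) :
    IsWeakOrder (refineOrder ψ φ) U ∧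
      ∀ x y, WeakLT (refineOrder ψ φ) x y ↔ WeakLT ψ x y ∨ WeakLT φ x y := by
  induction φ generalizing ψ U with
  | nil => simp [refineOrder] at h
  | cons C φ ih =>
    have hU := hφ.2.2
    obtain ⟨hCne, hCU, hd, hg, hφ'⟩ := hφ.of_cons
    rw [refineOrder] at h ⊢
    simp only [hU] at h ⊢
    split_ifs at h ⊢ with hk hW hw hw
    · exact absurd rfl h
    · refine ⟨hw, fun x y => ?_⟩
      have hUC : U = C := (Finset.sdiff_eq_empty_iff_subset.1 hW).antisymm hCU
      subst hUC
      have hφ0 : φ = [] := hφ'.eq_nil hW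
      subst hφ0
      rw [weakLT_restrict, hψ.weakLT_iff]
      simp
      tauto
    · exact absurd rfl h
    -- A failure of the recursive call is caught by the final test: with `[]` appended, the result
    -- does not cover the nonempty set `U \ C`.
    · have hR : refineOrder (restrict ψ (U \ C)) φ ≠ [] := by
        intro he
        rw [he, List.append_nil] at hw
        have h1 := hw.2.2
        rw [(hψ.restrict hCU).2.2] at h1
        exact hW (by rw [h1, Finset.sdiff_self])
      obtain ⟨h1, h2⟩ := ih (hψ.restrict Finset.sdiff_subset) hφ' hR
      refine ⟨hw, fun x y => ?_⟩
      rw [weakLT_append, h2, weakLT_cons, weakLT_restrict, weakLT_restrict,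
        (hψ.restrict hCU).2.2, h1.2.2, hg]
      -- The passed test says that `ψ` never puts a vertex outside `C` before one of `C`; hence
      -- placing `C` first respects `ψ`.
      have hback : WeakLT ψ x y → x ∈ U ∧ y ∈ U ∧ (x ∈ C ∨ y ∉ C) := by
        intro hxy
        obtain ⟨hx, hy, hlt⟩ := hψ.weakLT_iff.1 hxy
        refine ⟨hx, hy, ?_⟩
        by_contra! hcon
        refine hk ⟨classIdx ψ x,
          Finset.mem_range.2 (hlt.trans_le (classIdx_le_lastIdx hcon.2)), fun hsub => ?_⟩
        exact hcon.1 (hsub ((hψ.mem_getD_iff hx).2 rfl))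
      simp only [Finset.mem_sdiff]
      tauto
    · exact absurd rfl h

theorem refineOrder_ne_nil {ψ φ : List (Finset V)} {U : Finset V} (hψ : IsWeakOrder ψ U)
    (hφ : IsWeakOrder φ U) (hU : U.Nonempty) (hc : Compatible ψ φ) : refineOrder ψ φ ≠ [] := by
  induction φ generalizing ψ U with
  | nil => exact absurd rfl (hφ.ne_nil hU)
  | cons C φ ih =>
    have hUg := hφ.2.2
    obtain ⟨hCne, hCU, hd, hg, hφ'⟩ := hφ.of_cons
    rw [refineOrder]
    simp only [hUg]
    -- A failed test produces a vertex outside `C` that `ψ` puts before one of `C`, against the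
    -- order `φ`.
    have hk : ¬ ∃ k ∈ Finset.range (lastIdx ψ C), ¬ ψ.getD k ∅ ⊆ C := by
      rintro ⟨k, hk, hsub⟩
      obtain ⟨y, hyk, hyC⟩ := Finset.not_subset.1 hsub
      have hyU := hψ.getD_subset k hyk
      obtain ⟨z, hz, hl⟩ := exists_lastIdx (ψ := ψ) hCne
      refine hc ⟨y, z, hψ.weakLT_iff.2 ⟨hyU, hCU hz, ?_⟩, weakLT_cons.2 (Or.inl ⟨hz, ?_⟩)⟩
      · rw [(hψ.mem_getD_iff hyU).1 hyk, ← hl]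
        exact Finset.mem_range.1 hk
      · rw [hg]
        exact Finset.mem_sdiff.2 ⟨hyU, hyC⟩
    rw [if_neg hk]
    split_ifs with hW hw hw
    · exact hw.ne_nil hU
    · have hUC : U = C := (Finset.sdiff_eq_empty_iff_subset.1 hW).antisymm hCU
      subst hUC
      exact absurd (hψ.restrict hCU) hw
    · exact hw.ne_nil hU
    · have hR := ih (hψ.restrict Finset.sdiff_subset) hφ' (Finset.nonempty_iff_ne_empty.2 hW) (by
        rintro ⟨x, y, h1, h2⟩
        exact hc ⟨x, y, (weakLT_restrict.1 h1).1, weakLT_cons.2 (Or.inr h2)⟩)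
      have h1 := (refineOrder_spec (hψ.restrict Finset.sdiff_subset) hφ' hR).1
      have h2 := isWeakOrder_append (hψ.restrict hCU) h1 Finset.disjoint_sdiff
      rw [Finset.union_sdiff_of_subset hCU] at h2
      exact absurd h2 hw

end RefineLemmas

/-! ### Concatenating the results for the components. -/

section ConcatLemmas

variable {V : Type*} [DecidableEq V]

theorem concatLoop_spec {body : Finset V → Finset (Option (List (Finset V)))}
    {P : Finset V → List (Finset V) → Prop} {Ws : List (Finset V)}
    (hne : ∀ W ∈ Ws, (body W).Nonempty) (hP : ∀ W ∈ Ws, ∀ Φ, some Φ ∈ body W → P W Φ)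
    (Φ : List (Finset V)) :
    (concatLoop body Ws Φ).Nonempty ∧
      (∀ Ψ, some Ψ ∈ concatLoop body Ws Φ → ∃ L, List.Forall₂ P Ws L ∧ Ψ = Φ ++ L.flatten) ∧
      (none ∈ concatLoop body Ws Φ → ∃ W ∈ Ws, none ∈ body W) := by
  induction Ws generalizing Φ with
  | nil =>
    refine ⟨by simp [concatLoop], ?_, by simp [concatLoop]⟩
    intro Ψ hΨ
    refine ⟨[], List.Forall₂.nil, ?_⟩
    simpa [concatLoop] using hΨ
  | cons W Ws ih =>
    have ih := ih (fun W hW => hne W (List.mem_cons_of_mem _ hW))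
      (fun W hW => hP W (List.mem_cons_of_mem _ hW))
    rw [concatLoop]
    refine ⟨?_, ?_, ?_⟩
    · obtain ⟨o, ho⟩ := hne W (by simp)
      cases o with
      | none => exact ⟨none, Finset.mem_biUnion.2 ⟨none, ho, by simp⟩⟩
      | some Φ' =>
        obtain ⟨r, hr⟩ := (ih (Φ ++ Φ')).1
        exact ⟨r, Finset.mem_biUnion.2 ⟨some Φ', ho, hr⟩⟩
    · intro Ψ hΨ
      obtain ⟨o, ho, hΨ⟩ := Finset.mem_biUnion.1 hΨ
      cases o with
      | none => simp at hΨ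
      | some Φ' =>
        obtain ⟨L, hL, rfl⟩ := (ih (Φ ++ Φ')).2.1 Ψ hΨ
        exact ⟨Φ' :: L, List.Forall₂.cons (hP W (by simp) Φ' ho) hL, by simp⟩
    · intro h
      obtain ⟨o, ho, h⟩ := Finset.mem_biUnion.1 h
      cases o with
      | none => exact ⟨W, by simp, ho⟩
      | some Φ' =>
        obtain ⟨W', hW', h'⟩ := (ih (Φ ++ Φ')).2.2 h
        exact ⟨W', List.mem_cons_of_mem _ hW', h'⟩

/-- Concatenating weak linear orders of the classes of a weak linear order refines it. -/
theorem isWeakOrder_flatten {P : Finset V → List (Finset V) → Prop}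
    (hP : ∀ W Φ, P W Φ → IsWeakOrder Φ W) {Ws : List (Finset V)} {L : List (List (Finset V))}
    (hL : List.Forall₂ P Ws L) {U : Finset V} (hWs : IsWeakOrder Ws U) :
    IsWeakOrder L.flatten U ∧ (∀ x y, WeakLT Ws x y → WeakLT L.flatten x y) ∧
      ∀ W ∈ Ws, ∃ Φ, P W Φ ∧ ∀ x ∈ W, ∀ y ∈ W, (WeakLT L.flatten x y ↔ WeakLT Φ x y) := by
  induction hL generalizing U with
  | nil => simpa using hWs
  | @cons W Φ Ws L hWΦ hL ih =>
    obtain ⟨hne, hWU, hd, hg, hWs'⟩ := hWs.of_cons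
    obtain ⟨h1, h2, h3⟩ := ih hWs'
    have hΦ := hP W Φ hWΦ
    rw [List.flatten_cons]
    refine ⟨?_, ?_, ?_⟩
    · have := isWeakOrder_append hΦ h1 Finset.disjoint_sdiff
      rwa [Finset.union_sdiff_of_subset hWU] at this
    · intro x y hxy
      rw [weakLT_append, hΦ.2.2, h1.2.2, ← hg]
      rcases weakLT_cons.1 hxy with h | h
      exacts [Or.inr (Or.inl h), Or.inr (Or.inr (h2 x y h))]
    · intro W' hW'
      rcases List.mem_cons.1 hW' with rfl | hW'
      · refine ⟨Φ, hWΦ, fun x hx y hy => ?_⟩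
        rw [weakLT_append, h1.2.2]
        have : ¬ WeakLT L.flatten x y := fun h => by
          have := h.mem_left
          simp [h1.2.2, hx] at this
        simp [this, hy]
      · obtain ⟨Φ', hΦ', hiff⟩ := h3 W' hW'
        refine ⟨Φ', hΦ', fun x hx y hy => ?_⟩
        have hx' : x ∈ ground Ws := mem_ground.2 ⟨W', hW', hx⟩
        have hxn : x ∉ W := fun h => Finset.disjoint_left.1 hd h hx'
        rw [weakLT_append, hΦ.2.2, hiff x hx y hy]
        have : ¬ WeakLT Φ x y := fun h => hxn (hΦ.2.2 ▸ h.mem_left)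
        simp [this, hxn]

end ConcatLemmas

/-! ### Robinson rankings and the recursion. -/

section RobinsonLemmas

variable {V R : Type*} [DecidableEq V] [LinearOrder R] [Zero R]

theorem supportGraph_adj {A : Matrix V V R} (hA : A.IsSymm) {x y : V} :
    (supportGraph A).Adj x y ↔ x ≠ y ∧ A x y ≠ 0 := by
  rw [supportGraph, SimpleGraph.fromRel_adj, hA.apply x y, or_self]

theorem min_nonzeroValues_le {A : Matrix V V R} {W : Finset V} {x y : V} (hx : x ∈ W) (hy : y ∈ W)
    (h : A x y ≠ 0) : (nonzeroValues A W).min ≤ (A x y : WithTop R) := by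
  apply Finset.min_le
  simp only [nonzeroValues, Finset.mem_filter, Finset.mem_image, Finset.mem_product]
  exact ⟨⟨(x, y), ⟨hx, hy⟩, rfl⟩, h⟩

theorem lower_isSymm {A : Matrix V V R} (hA : A.IsSymm) (W : Finset V) : (lower A W).IsSymm := by
  refine Matrix.IsSymm.ext fun x y => ?_
  simp only [lower, hA.apply x y, and_left_comm]

theorem lower_nonneg {A : Matrix V V R} (hA : ∀ x y, 0 ≤ A x y) (W : Finset V) (x y : V) :
    0 ≤ lower A W x y := by
  unfold lower
  split_ifs
  exacts [hA x y, le_rfl]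

theorem lower_le {A : Matrix V V R} (hA : ∀ x y, 0 ≤ A x y) (W : Finset V) (x y : V) :
    lower A W x y ≤ A x y := by
  unfold lower
  split_ifs
  exacts [le_rfl, hA x y]

/-- On the block `W`, lowering sends the smallest nonzero value to zero and fixes the others, which
is a monotone map of nonnegative values. -/
theorem lower_mono {A : Matrix V V R} (hA : ∀ x y, 0 ≤ A x y) {W : Finset V} {a b c d : V}
    (ha : a ∈ W) (hb : b ∈ W) (hc : c ∈ W) (hd : d ∈ W) (h : A a b ≤ A c d) :
    lower A W a b ≤ lower A W c d := by
  by_cases hcd : (A c d : WithTop R) = (nonzeroValues A W).min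
  · have h0 : lower A W a b = 0 := by
      by_cases h0 : A a b = 0
      · simp [lower, h0]
      · have hab := min_nonzeroValues_le ha hb h0
        rw [← hcd] at hab
        have he : (A a b : WithTop R) = (nonzeroValues A W).min := by
          rw [← hcd, le_antisymm h (WithTop.coe_le_coe.1 hab)]
        simp [lower, he]
    rw [h0]
    exact lower_nonneg hA W c d
  · have : lower A W c d = A c d := if_pos ⟨hc, hd, hcd⟩
    rw [this]
    exact (lower_le hA W a b).trans h

/-- Lowering identifies only zero with the smallest nonzero value, so it reflects inequalities once
`h0` excludes a zero on the right under a nonzero entry. -/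
theorem le_of_lower_le {A : Matrix V V R} (hA : ∀ x y, 0 ≤ A x y) {W : Finset V} {a b c d : V}
    (ha : a ∈ W) (hb : b ∈ W) (hc : c ∈ W) (hd : d ∈ W) (h : lower A W a b ≤ lower A W c d)
    (h0 : A a b ≠ 0 → A c d ≠ 0) : A a b ≤ A c d := by
  by_cases hab0 : A a b = 0
  · rw [hab0]; exact hA c d
  by_cases hab : (A a b : WithTop R) = (nonzeroValues A W).min
  · have := min_nonzeroValues_le hc hd (h0 hab0)
    rw [← hab] at this
    exact WithTop.coe_le_coe.1 this
  · have he : lower A W a b = A a b := if_pos ⟨ha, hb, hab⟩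
    rw [← he]
    exact h.trans (lower_le hA W c d)

/-- The ranking `p` of `U` is a Robinson ordering of `A[U]`, up to the diagonal entries, that is
compatible with `ψ`. -/
structure IsRobinsonRank (A : Matrix V V R) (U : Finset V) (ψ : List (Finset V)) (p : V → ℤ) :
    Prop where
  inj : Set.InjOn p U
  compat : ∀ x y, WeakLT ψ x y → p x < p y
  le : ∀ x ∈ U, ∀ y ∈ U, ∀ z ∈ U, p x < p y → p y < p z → A x z ≤ A x y ∧ A x z ≤ A y z

/-- Every linear order compatible with the weak linear order `Φ` of `U` is a Robinson ordering of
`A[U]`, up to the diagonal entries. -/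
def IsRobinsonOrder (A : Matrix V V R) (U : Finset V) (Φ : List (Finset V)) : Prop :=
  ∀ x ∈ U, ∀ y ∈ U, ∀ z ∈ U, x ≠ y → y ≠ z → x ≠ z → ¬ WeakLT Φ y x → ¬ WeakLT Φ z y →
    A x z ≤ A x y ∧ A x z ≤ A y z

/-- `Φ` is a correct output of Robinson on `A[U]` and `ψ`. -/
structure IsRobinsonOutput (A : Matrix V V R) (U : Finset V) (ψ Φ : List (Finset V)) : Prop where
  weak : IsWeakOrder Φ U
  refines : ∀ x y, WeakLT ψ x y → WeakLT Φ x y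
  robinson : IsRobinsonOrder A U Φ

/-- All the outcomes in `S` are correct for Robinson on `A[U]` and `ψ`. -/
structure CorrectOutcomes (A : Matrix V V R) (U : Finset V) (ψ : List (Finset V))
    (S : Finset (Option (List (Finset V)))) : Prop where
  nonempty : S.Nonempty
  sound : ∀ Φ, some Φ ∈ S → IsRobinsonOutput A U ψ Φ
  complete : none ∈ S → ∀ p, ¬ IsRobinsonRank A U ψ p

theorem IsRobinsonRank.umbrella {A : Matrix V V R} (hA : A.IsSymm) (h0 : ∀ x y, 0 ≤ A x y)
    {U : Finset V} {ψ : List (Finset V)} {p : V → ℤ} (h : IsRobinsonRank A U ψ p) :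
    Umbrella (supportGraph A) U p := by
  intro x hx y hy z hz hxy hyz hxz
  rcases hxy.eq_or_lt with he | hxy
  · obtain rfl := h.inj hx hy he
    exact ⟨ClosedAdj.refl _ _, hxz⟩
  rcases hyz.eq_or_lt with he | hyz
  · obtain rfl := h.inj hy hz he
    exact ⟨hxz, ClosedAdj.refl _ _⟩
  have hne : x ≠ z := fun he => (hxy.trans hyz).ne (congrArg p he)
  have hpos : 0 < A x z :=
    (h0 x z).lt_of_ne ((supportGraph_adj hA).1 (hxz.adj hne)).2.symm
  obtain ⟨h1, h2⟩ := h.le x hx y hy z hz hxy hyz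
  exact ⟨Or.inr ((supportGraph_adj hA).2 ⟨fun he => hxy.ne (congrArg p he), (hpos.trans_le h1).ne'⟩),
    Or.inr ((supportGraph_adj hA).2 ⟨fun he => hyz.ne (congrArg p he), (hpos.trans_le h2).ne'⟩)⟩

theorem IsRobinsonRank.restrict {A : Matrix V V R} {U W : Finset V} {ψ : List (Finset V)}
    {p : V → ℤ} (h : IsRobinsonRank A U ψ p) (hW : W ⊆ U) :
    IsRobinsonRank A W (restrict ψ W) p where
  inj := h.inj.mono (by simpa using hW)
  compat x y hxy := h.compat x y (weakLT_restrict.1 hxy).1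
  le x hx y hy z hz := h.le x (hW hx) y (hW hy) z (hW hz)

theorem IsRobinsonRank.lower {A : Matrix V V R} (h0 : ∀ x y, 0 ≤ A x y) {W : Finset V}
    {ψ Φ : List (Finset V)} {p : V → ℤ} (h : IsRobinsonRank A W ψ p)
    (hΦ : ∀ x y, WeakLT Φ x y → p x < p y) : IsRobinsonRank (lower A W) W Φ p where
  inj := h.inj
  compat := hΦ
  le x hx y hy z hz hxy hyz :=
    (h.le x hx y hy z hz hxy hyz).imp (lower_mono h0 hx hz hx hy) (lower_mono h0 hx hz hy hz)

theorem IsRobinsonRank.neg {A : Matrix V V R} (hA : A.IsSymm) {W : Finset V}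
    {ψ Φ : List (Finset V)} {p : V → ℤ} (h : IsRobinsonRank A W ψ p)
    (hΦ : ∀ x y, WeakLT Φ x y → p y < p x) : IsRobinsonRank A W Φ (fun x => -p x) where
  inj x hx y hy hxy := h.inj hx hy (neg_injective hxy)
  compat x y hxy := neg_lt_neg (hΦ x y hxy)
  le x hx y hy z hz hxy hyz := by
    have := h.le z hz y hy x hx (neg_lt_neg_iff.1 hyz) (neg_lt_neg_iff.1 hxy)
    rw [hA.apply x z, hA.apply y z, hA.apply x y] at this
    exact this.symm

/-- A Robinson ordering of a component agrees with the straight enumeration that is found, or with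
its reverse. -/
theorem IsRobinsonRank.straightEnumeration {A : Matrix V V R} (hA : A.IsSymm)
    (h0 : ∀ x y, 0 ≤ A x y) {U : Finset V} {c : List V}
    (hc : IsSearchedComponent (supportGraph A) U c) {ψ : List (Finset V)} {p : V → ℤ}
    (h : IsRobinsonRank A c.toFinset ψ p) :
    ∃ φ, straightEnumeration (supportGraph A) c = some φ ∧
      ((∀ x y, WeakLT φ x y → p x < p y) ∨ ∀ x y, WeakLT φ x y → p y < p x) := by
  -- The enumeration is compared with `f` rather than `p`: blocks of different rank in `f` are
  -- ordered the same way by `p`.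
  obtain ⟨f, hf, -, hfp⟩ := (h.umbrella hA h0).exists_blockRank
  obtain ⟨φ, hφ, hs⟩ := straightEnumeration_of_blockRank hc.nodup hc.conn hc.lex hf
  obtain ⟨hw, hb⟩ := straightEnumeration_some hc.nodup hφ
  have hne : ∀ x y, WeakLT φ x y → f x ≠ f y := by
    intro x y hxy he
    obtain ⟨hx, hy, hlt⟩ := hw.weakLT_iff.1 hxy
    have := hb.2 x hx y hy (hf.1.twins_of_eq hx hy he)
    simp at this
    omega
  have hasymm : ∀ x y, WeakLT φ x y → ¬ WeakLT φ y x := by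
    intro x y h1 h2
    exact (hw.weakLT_iff.1 h1).2.2.not_gt (hw.weakLT_iff.1 h2).2.2
  refine ⟨φ, hφ, hs.imp (fun hs x y hxy => ?_) fun hs x y hxy => ?_⟩
  · obtain ⟨hx, hy, -⟩ := hw.weakLT_iff.1 hxy
    refine hfp x hx y hy ((hne x y hxy).lt_of_le (not_lt.1 fun hlt => ?_))
    exact hasymm x y hxy (hs y (by simpa using hy) x (by simpa using hx) hlt)
  · obtain ⟨hx, hy, -⟩ := hw.weakLT_iff.1 hxy
    refine hfp y hy x hx ((hne x y hxy).symm.lt_of_le (not_lt.1 fun hlt => ?_))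
    exact hasymm x y hxy (hs x (by simpa using hx) y (by simpa using hy) hlt)

/-- If two weak linear orders are compatible, and remain so when one is reversed, then one of them
is trivial. -/
theorem IsWeakOrder.trivial_or_trivial {ψ φ : List (Finset V)} {W : Finset V}
    (hψ : IsWeakOrder ψ W) (hφ : IsWeakOrder φ W) (h : ∀ x y, WeakLT ψ x y → ¬ WeakLT φ x y)
    (h' : ∀ x y, WeakLT ψ x y → ¬ WeakLT φ y x) :
    (∀ x y, ¬ WeakLT ψ x y) ∨ ∀ x y, ¬ WeakLT φ x y := by
  by_contra! hcon
  obtain ⟨⟨a, b, hab⟩, u, v, huv⟩ := hcon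
  obtain ⟨ha, hb, hab⟩ := hψ.weakLT_iff.1 hab
  obtain ⟨hu, hv, huv⟩ := hφ.weakLT_iff.1 huv
  have key : ∀ x ∈ W, ∀ y ∈ W, classIdx ψ x ≠ classIdx ψ y → classIdx φ x = classIdx φ y := by
    have key' : ∀ x ∈ W, ∀ y ∈ W, classIdx ψ x < classIdx ψ y → classIdx φ x = classIdx φ y := by
      intro x hx y hy hlt
      have hxy := hψ.weakLT_iff.2 ⟨hx, hy, hlt⟩
      have h1 := h x y hxy
      have h2 := h' x y hxy
      rw [hφ.weakLT_iff] at h1 h2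
      have h1 : ¬ classIdx φ x < classIdx φ y := fun hl => h1 ⟨hx, hy, hl⟩
      have h2 : ¬ classIdx φ y < classIdx φ x := fun hl => h2 ⟨hy, hx, hl⟩
      omega
    intro x hx y hy hne
    rcases lt_or_gt_of_ne hne with hlt | hlt
    exacts [key' x hx y hy hlt, (key' y hy x hx hlt).symm]
  -- By `key`, `u` and `v` share a class of `ψ`. One of `a`, `b` lies outside it, and hence in the
  -- `φ`-classes of both `u` and `v`, which are different.
  have h1 := key u hu v hv
  have h2 := key a ha u hu
  have h3 := key a ha v hv
  have h4 := key b hb u hu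
  have h5 := key b hb v hv
  omega

/-- What Robinson does with a component. -/
theorem correctOutcomes_component [Fintype V] {A : Matrix V V R} (hA : A.IsSymm)
    (h0 : ∀ x y, 0 ≤ A x y) {U : Finset V} {c : List V}
    (hc : IsSearchedComponent (supportGraph A) U c) {ψ : List (Finset V)} (hψ : IsWeakOrder ψ U)
    (hrec : ¬ IsDiagOn (lower A c.toFinset) c.toFinset → ∀ Φ, IsWeakOrder Φ c.toFinset →
      CorrectOutcomes (lower A c.toFinset) c.toFinset Φ
        (robinson (lower A c.toFinset) c.toFinset Φ)) :
    CorrectOutcomes A c.toFinset (restrict ψ c.toFinset)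
      (match straightEnumeration (supportGraph A) c with
        | none => {none}
        | some φ =>
          let Φ₁ := refineOrder (restrict ψ c.toFinset) φ
          let Φ₂ := if Φ₁ = [] then refineOrder (restrict ψ c.toFinset) φ.reverse else Φ₁
          if Φ₂ = [] then {none}
          else if IsDiagOn (lower A c.toFinset) c.toFinset then {some Φ₂}
          else robinson (lower A c.toFinset) c.toFinset Φ₂) := by
  set W := c.toFinset with hW
  have hψW := hψ.restrict hc.subset
  set ψW := restrict ψ W
  cases hse : straightEnumeration (supportGraph A) c with
  | none =>
    refine ⟨by simp, by simp, fun _ p hp => ?_⟩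
    obtain ⟨φ, hφ, -⟩ := hp.straightEnumeration hA h0 hc
    rw [hse] at hφ
    exact Option.some_ne_none _ hφ.symm
  | some φ =>
    obtain ⟨hw, hb⟩ := straightEnumeration_some hc.nodup hse
    have horient : ∀ p, IsRobinsonRank A W ψW p →
        (∀ x y, WeakLT φ x y → p x < p y) ∨ ∀ x y, WeakLT φ x y → p y < p x := by
      intro p hp
      obtain ⟨φ', hφ', h⟩ := hp.straightEnumeration hA h0 hc
      rw [hse] at hφ'
      obtain rfl := Option.some_injective _ hφ'
      exact h
    dsimp only
    by_cases hΦ : (if refineOrder ψW φ = [] then refineOrder ψW φ.reverse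
        else refineOrder ψW φ) = []
    · rw [if_pos hΦ]
      refine ⟨by simp, by simp, fun _ p hp => ?_⟩
      have h1 : refineOrder ψW φ = [] := by
        by_contra hne
        rw [if_neg hne] at hΦ
        exact hne hΦ
      rw [if_pos h1] at hΦ
      rcases horient p hp with ho | ho
      · refine refineOrder_ne_nil hψW hw hc.nonempty ?_ h1
        rintro ⟨x, y, hxy, hyx⟩
        exact (hp.compat x y hxy).not_gt (ho y x hyx)
      · refine refineOrder_ne_nil hψW hw.reverse hc.nonempty ?_ hΦ
        rintro ⟨x, y, hxy, hyx⟩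
        exact (hp.compat x y hxy).not_gt (ho x y (weakLT_reverse.1 hyx))
    · rw [if_neg hΦ]
      -- the orientation of the straight enumeration that is used
      obtain ⟨φ', hφ'w, hφ'o, hφ'u, hne, he⟩ : ∃ φ', IsWeakOrder φ' W ∧
          (∀ p, IsRobinsonRank A W ψW p →
            (∀ x y, WeakLT φ' x y → p x < p y) ∨ ∀ x y, WeakLT φ' x y → p y < p x) ∧
          (∀ x ∈ W, ∀ y ∈ W, ∀ z ∈ W, ¬ WeakLT φ' y x → ¬ WeakLT φ' z y →
            ClosedAdj (supportGraph A) x z →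
            ClosedAdj (supportGraph A) x y ∧ ClosedAdj (supportGraph A) y z) ∧
          refineOrder ψW φ' ≠ [] ∧ (if refineOrder ψW φ = [] then refineOrder ψW φ.reverse
            else refineOrder ψW φ) = refineOrder ψW φ' := by
        have hu : ∀ x ∈ W, ∀ y ∈ W, ∀ z ∈ W, ¬ WeakLT φ y x → ¬ WeakLT φ z y →
            ClosedAdj (supportGraph A) x z →
            ClosedAdj (supportGraph A) x y ∧ ClosedAdj (supportGraph A) y z := by
          intro x hx y hy z hz hyx hzy hxz
          rw [hw.weakLT_iff] at hyx hzy
          refine hb.1 x hx y hy z hz ?_ ?_ hxz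
          · exact Int.ofNat_le.2 (not_lt.1 fun h => hyx ⟨hy, hx, h⟩)
          · exact Int.ofNat_le.2 (not_lt.1 fun h => hzy ⟨hz, hy, h⟩)
        by_cases h1 : refineOrder ψW φ = []
        · rw [if_pos h1] at hΦ ⊢
          refine ⟨φ.reverse, hw.reverse, fun p hp => ?_, ?_, hΦ, rfl⟩
          · simp only [weakLT_reverse]
            exact (horient p hp).symm.imp (fun h x y => h y x) (fun h x y => h y x)
          · intro x hx y hy z hz hyx hzy hxz
            rw [weakLT_reverse] at hyx hzy
            obtain ⟨h1, h2⟩ := hu z hz y hy x hx hzy hyx hxz.symm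
            exact ⟨h2.symm, h1.symm⟩
        · rw [if_neg h1]
          exact ⟨φ, hw, horient, hu, h1, rfl⟩
      rw [he]
      obtain ⟨hΦw, hΦlt⟩ := refineOrder_spec hψW hφ'w hne
      set Φ₂ := refineOrder ψW φ'
      have hasymm : ∀ x y, WeakLT Φ₂ x y → ¬ WeakLT Φ₂ y x := fun x y h1 h2 =>
        (hΦw.weakLT_iff.1 h1).2.2.not_gt (hΦw.weakLT_iff.1 h2).2.2
      -- Since `Φ` refines the enumeration `φ'`, the umbrella property makes `A x y` and `A y z`
      -- nonzero whenever `A x z` is; this is what `le_of_lower_le` needs.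
      have hlift : ∀ Φ, IsRobinsonOutput (lower A W) W Φ₂ Φ → IsRobinsonOutput A W ψW Φ := by
        intro Φ h
        refine ⟨h.weak, fun x y hxy => h.refines x y ((hΦlt x y).2 (Or.inl hxy)), ?_⟩
        intro x hx y hy z hz hxy hyz hxz hnyx hnzy
        have hadj : A x z ≠ 0 → A x y ≠ 0 ∧ A y z ≠ 0 := by
          intro hne
          obtain ⟨h1, h2⟩ := hφ'u x hx y hy z hz
            (fun h' => hnyx (h.refines y x ((hΦlt y x).2 (Or.inr h'))))
            (fun h' => hnzy (h.refines z y ((hΦlt z y).2 (Or.inr h'))))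
            (Or.inr ((supportGraph_adj hA).2 ⟨hxz, hne⟩))
          exact ⟨((supportGraph_adj hA).1 (h1.adj hxy)).2, ((supportGraph_adj hA).1 (h2.adj hyz)).2⟩
        obtain ⟨h1, h2⟩ := h.robinson x hx y hy z hz hxy hyz hxz hnyx hnzy
        exact ⟨le_of_lower_le h0 hx hz hx hy h1 fun hne => (hadj hne).1,
          le_of_lower_le h0 hx hz hy hz h2 fun hne => (hadj hne).2⟩
      split_ifs with hdiag
      · refine ⟨by simp, ?_, by simp⟩
        intro Φ hΦ'
        simp only [Finset.mem_singleton, Option.some.injEq] at hΦ'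
        subst hΦ'
        refine hlift _ ⟨hΦw, fun _ _ h => h, ?_⟩
        intro x hx y hy z hz _ _ hxz _ _
        rw [hdiag x hx z hz hxz]
        exact ⟨lower_nonneg h0 W x y, lower_nonneg h0 W y z⟩
      · have hr := hrec hdiag Φ₂ hΦw
        refine ⟨hr.nonempty, fun Φ hΦ' => hlift Φ (hr.sound Φ hΦ'), fun hnone p hp => ?_⟩
        rcases hφ'o p hp with ho | ho
        · refine hr.complete hnone p (hp.lower h0 fun x y hxy => ?_)
          rcases (hΦlt x y).1 hxy with h | h
          exacts [hp.compat x y h, ho x y h]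
        -- The ranking follows the other orientation. So `ψW` is compatible with the reverse of `φ'`
        -- because of `p`, and with `φ'` because both are refined by `Φ₂`. If `ψW` is trivial the
        -- ranking is reversed; if `φ'` is trivial its orientation does not matter.
        · rcases hψW.trivial_or_trivial hφ'w
            (fun x y h1 h2 => (hp.compat x y h1).not_gt (ho x y h2))
            (fun x y h1 h2 => hasymm x y ((hΦlt x y).2 (Or.inl h1)) ((hΦlt y x).2 (Or.inr h2)))
            with ht | ht
          · refine hr.complete hnone _ ((hp.neg hA (Φ := Φ₂) fun x y hxy => ?_).lower h0
              fun x y hxy => ?_)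
            · exact ho x y (((hΦlt x y).1 hxy).resolve_left (ht x y))
            · exact neg_lt_neg (ho x y (((hΦlt x y).1 hxy).resolve_left (ht x y)))
          · refine hr.complete hnone p (hp.lower h0 fun x y hxy => ?_)
            exact hp.compat x y (((hΦlt x y).1 hxy).resolve_right (ht x y))

/-- A triple with both ends in one component lies entirely in it, since the components are
consecutive; if the ends lie in different components, their entry is zero. -/
theorem ComponentsSpec.isRobinsonOutput {A : Matrix V V R} (hA : A.IsSymm)
    (h0 : ∀ x y, 0 ≤ A x y) {U : Finset V} {ψ : List (Finset V)} (hψ : IsWeakOrder ψ U)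
    {cs : List (List V)}
    (hcs : ComponentsSpec (supportGraph A) U ψ cs) {L : List (List (Finset V))}
    (hL : List.Forall₂ (fun W Φ => IsRobinsonOutput A W (restrict ψ W) Φ)
      (cs.map List.toFinset) L) : IsRobinsonOutput A U ψ L.flatten := by
  obtain ⟨h1, h2, h3⟩ := isWeakOrder_flatten (fun W Φ h => h.weak) hL hcs.weak
  set Ws := cs.map List.toFinset
  have hsame : ∀ x ∈ U, ∃ W ∈ Ws, ∀ y ∈ U, y ∈ W ↔ classIdx Ws y = classIdx Ws x := by
    intro x hx
    have hi : classIdx Ws x < Ws.length := classIdx_lt_iff.2 (hcs.weak.2.2 ▸ hx)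
    exact ⟨Ws[classIdx Ws x], List.getElem_mem hi, fun y hy => hcs.weak.mem_getElem_iff hy hi⟩
  refine ⟨h1, ?_, ?_⟩
  · intro x y hxy
    obtain ⟨hx, hy, -⟩ := hψ.weakLT_iff.1 hxy
    rcases lt_trichotomy (classIdx Ws x) (classIdx Ws y) with hlt | heq | hgt
    · exact h2 x y (hcs.weak.weakLT_iff.2 ⟨hx, hy, hlt⟩)
    · obtain ⟨W, hW, hmem⟩ := hsame x hx
      obtain ⟨Φ, hΦ, hiff⟩ := h3 W hW
      have hxW := (hmem x hx).2 rfl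
      have hyW := (hmem y hy).2 heq.symm
      exact (hiff x hxW y hyW).2 (hΦ.refines x y (weakLT_restrict.2 ⟨hxy, hxW, hyW⟩))
    · exact absurd hxy (hcs.sep y x (hcs.weak.weakLT_iff.2 ⟨hy, hx, hgt⟩)).2
  · intro x hx y hy z hz hxy hyz hxz hnyx hnzy
    have hle1 : classIdx Ws x ≤ classIdx Ws y := not_lt.1 fun hlt =>
      hnyx (h2 y x (hcs.weak.weakLT_iff.2 ⟨hy, hx, hlt⟩))
    have hle2 : classIdx Ws y ≤ classIdx Ws z := not_lt.1 fun hlt =>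
      hnzy (h2 z y (hcs.weak.weakLT_iff.2 ⟨hz, hy, hlt⟩))
    rcases (hle1.trans hle2).eq_or_lt with heq | hlt
    · obtain ⟨W, hW, hmem⟩ := hsame x hx
      obtain ⟨Φ, hΦ, hiff⟩ := h3 W hW
      have hxW := (hmem x hx).2 rfl
      have hyW := (hmem y hy).2 (by omega)
      have hzW := (hmem z hz).2 (by omega)
      exact hΦ.robinson x hxW y hyW z hzW hxy hyz hxz (by rwa [← hiff y hyW x hxW])
        (by rwa [← hiff z hzW y hyW])
    · have hna := (hcs.sep x z (hcs.weak.weakLT_iff.2 ⟨hx, hz, hlt⟩)).1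
      have hzero : A x z = 0 := by
        by_contra hne
        exact hna ((supportGraph_adj hA).2 ⟨hxz, hne⟩)
      rw [hzero]
      exact ⟨h0 x y, h0 y z⟩

/-- A recursive call has fewer distinct nonzero values. For completeness, a Robinson ranking of the
whole restricts to every component, so one failing component excludes them all. -/
theorem robinson_correct [Fintype V] {A : Matrix V V R} (hA : A.IsSymm) (h0 : ∀ x y, 0 ≤ A x y)
    {U : Finset V} {ψ : List (Finset V)} (hψ : IsWeakOrder ψ U) :
    CorrectOutcomes A U ψ (robinson A U ψ) := by
  induction hk : (nonzeroValues A Finset.univ).card using Nat.strong_induction_on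
    generalizing A U ψ with
  | _ k ih =>
  subst hk
  obtain ⟨hne, hsome, hnone⟩ := coLexBFS_spec (G := supportGraph A) hψ
  have hcomp : ∀ cs, ComponentsSpec (supportGraph A) U ψ cs → ∀ c ∈ cs,
      CorrectOutcomes A c.toFinset (restrict ψ c.toFinset)
        (match straightEnumeration (supportGraph A)
            (cs.flatten.filter (fun v => v ∈ c.toFinset)) with
        | none => {none}
        | some φ =>
          let Φ₁ := refineOrder (restrict ψ c.toFinset) φ
          let Φ₂ := if Φ₁ = [] then refineOrder (restrict ψ c.toFinset) φ.reverse else Φ₁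
          if Φ₂ = [] then {none}
          else if IsDiagOn (lower A c.toFinset) c.toFinset then {some Φ₂}
          else robinson (lower A c.toFinset) c.toFinset Φ₂) := by
    intro cs hcs c hc
    rw [filter_flatten_eq hcs.weak.2.1 hc]
    exact correctOutcomes_component hA h0 (hcs.comp c hc) hψ fun hd Φ hΦ =>
      ih _ (card_nonzeroValues_lower_lt A _ hd) (lower_isSymm hA _) (lower_nonneg h0 _) hΦ rfl
  have hbranch : ∀ o ∈ coLexBFS (supportGraph A) U ψ, ∀ S, S = (match o with
      | none => {none}
      | some (comps, σ) =>
        concatLoop (fun W =>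
          match straightEnumeration (supportGraph A) (σ.filter (fun v => v ∈ W)) with
          | none => {none}
          | some φ =>
            let Φ₁ := refineOrder (restrict ψ W) φ
            let Φ₂ := if Φ₁ = [] then refineOrder (restrict ψ W) φ.reverse else Φ₁
            if Φ₂ = [] then {none}
            else if IsDiagOn (lower A W) W then {some Φ₂}
            else robinson (lower A W) W Φ₂) comps []) → CorrectOutcomes A U ψ S := by
    rintro o ho _ rfl
    match o, ho with
    | none, ho =>
      exact ⟨by simp, by simp, fun _ p hp => hnone ho p (hp.umbrella hA h0) hp.compat⟩
    | some (comps, σ), ho =>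
      obtain ⟨cs, hcs, rfl, rfl⟩ := hsome comps σ ho
      dsimp only
      obtain ⟨h1, h2, h3⟩ := concatLoop_spec (Ws := cs.map List.toFinset)
        (P := fun W Φ => IsRobinsonOutput A W (restrict ψ W) Φ)
        (body := fun W =>
          match straightEnumeration (supportGraph A) (cs.flatten.filter (fun v => v ∈ W)) with
          | none => {none}
          | some φ =>
            let Φ₁ := refineOrder (restrict ψ W) φ
            let Φ₂ := if Φ₁ = [] then refineOrder (restrict ψ W) φ.reverse else Φ₁
            if Φ₂ = [] then {none}
            else if IsDiagOn (lower A W) W then {some Φ₂}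
            else robinson (lower A W) W Φ₂)
        (fun W hW => by
          obtain ⟨c, hc, rfl⟩ := List.mem_map.1 hW
          exact (hcomp cs hcs c hc).nonempty)
        (fun W hW => by
          obtain ⟨c, hc, rfl⟩ := List.mem_map.1 hW
          exact (hcomp cs hcs c hc).sound) []
      refine ⟨h1, ?_, ?_⟩
      · intro Φ hΦ
        obtain ⟨L, hL, rfl⟩ := h2 Φ hΦ
        exact hcs.isRobinsonOutput hA h0 hψ hL
      · intro hn p hp
        obtain ⟨W, hW, hnW⟩ := h3 hn
        obtain ⟨c, hc, rfl⟩ := List.mem_map.1 hW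
        exact (hcomp cs hcs c hc).complete hnW p (hp.restrict (hcs.comp c hc).subset)
  rw [robinson]
  refine ⟨?_, ?_, ?_⟩
  · obtain ⟨o, ho⟩ := hne
    obtain ⟨r, hr⟩ := (hbranch o ho _ rfl).nonempty
    exact ⟨r, Finset.mem_biUnion.2 ⟨o, ho, hr⟩⟩
  · intro Φ hΦ
    obtain ⟨o, ho, hr⟩ := Finset.mem_biUnion.1 hΦ
    exact (hbranch o ho _ rfl).sound Φ hr
  · intro hn
    obtain ⟨o, ho, hr⟩ := Finset.mem_biUnion.1 hn
    exact (hbranch o ho _ rfl).complete hr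

end RobinsonLemmas

/-! ### Straight enumerations as umbrella orders. -/

section StraightEnumerations

variable {V : Type*} [DecidableEq V] [Fintype V] {G : SimpleGraph V}

theorem mem_closedNbhd {x y : V} : y ∈ closedNbhd G x ↔ ClosedAdj G x y := by
  simp [closedNbhd, ClosedAdj, eq_comm]

theorem closedNbhd_eq_iff_twins {x y : V} :
    closedNbhd G x = closedNbhd G y ↔ Twins G Finset.univ x y := by
  simp [Set.ext_iff, mem_closedNbhd, Twins]

/-- The blocks in the order of a block rank form a straight enumeration. -/
theorem BlockRank.isStraightEnumeration {f : V → ℤ} (hf : BlockRank G Finset.univ f)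
    {φ : List (Finset V)} (hφ : IsWeakOrder φ Finset.univ)
    (hlt : ∀ x y, WeakLT φ x y ↔ f x < f y) : IsStraightEnumeration G φ := by
  have hiff : ∀ x y, classIdx φ x < classIdx φ y ↔ f x < f y := fun x y => by
    rw [← hlt, hφ.weakLT_iff]; simp
  have hle : ∀ x y, classIdx φ x ≤ classIdx φ y ↔ f x ≤ f y := fun x y => by
    rw [← not_lt, hiff, not_lt]
  have heq : ∀ x y, classIdx φ x = classIdx φ y ↔ Twins G Finset.univ x y := by
    intro x y
    rw [le_antisymm_iff, hle, hle, ← le_antisymm_iff]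
    exact ⟨hf.1.twins_of_eq (by simp) (by simp), hf.2 x (by simp) y (by simp)⟩
  have hmem : ∀ (x : V) (i : Fin φ.length), x ∈ φ.get i ↔ classIdx φ x = i := fun x i =>
    hφ.mem_getElem_iff (Finset.mem_univ x) i.2
  refine ⟨hφ, ?_, ?_⟩
  · intro B hB x hx y
    obtain ⟨i, rfl⟩ := List.get_of_mem hB
    rw [hmem] at hx ⊢
    rw [closedNbhd_eq_iff_twins, ← heq, hx, eq_comm]
  · intro i
    obtain ⟨x, hx⟩ := hφ.1 _ (List.get_mem φ i)
    have hx' := (hmem x i).1 hx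
    -- Blocks consist of twins, so adjacency of two blocks can be tested on any representatives.
    have hadj : ∀ j : Fin φ.length, (j = i ∨ SetsAdj G (φ.get i) (φ.get j)) ↔
        ∀ y ∈ φ.get j, ClosedAdj G x y := by
      intro j
      constructor
      · rintro (rfl | ⟨u, hu, v, hv, huv⟩) y hy
        · have : classIdx φ x = classIdx φ y := hx'.trans ((hmem y j).1 hy).symm
          exact ((heq x y).1 this y (by simp)).2 (ClosedAdj.refl G y)
        · refine Twins.closedAdj_congr (U := Finset.univ) (by simp) (by simp)
            ((heq u x).1 ?_) ((heq v y).1 ?_) (Or.inr huv)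
          · rw [(hmem u i).1 hu, hx']
          · rw [(hmem v j).1 hv, (hmem y j).1 hy]
      · intro h
        obtain ⟨y, hy⟩ := hφ.1 _ (List.get_mem φ j)
        rcases h y hy with rfl | h
        · left
          exact Fin.ext (((hmem x j).1 hy).symm.trans hx')
        · exact Or.inr ⟨x, hx, y, hy, h⟩
    refine ⟨fun j hj k hk l hl => (hadj l).2 fun y hy => ?_⟩
    obtain ⟨u, hu⟩ := hφ.1 _ (List.get_mem φ j)
    obtain ⟨v, hv⟩ := hφ.1 _ (List.get_mem φ k)
    have hxu := (hadj j).1 hj u hu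
    have hxv := (hadj k).1 hk v hv
    have huy : f u ≤ f y := by
      rw [← hle, (hmem u j).1 hu, (hmem y l).1 hy]
      exact hl.1
    have hyv : f y ≤ f v := by
      rw [← hle, (hmem v k).1 hv, (hmem y l).1 hy]
      exact hl.2
    rcases le_total (f y) (f x) with h | h
    · exact (hf.1 u (by simp) y (by simp) x (by simp) huy h hxu.symm).2.symm
    · exact (hf.1 x (by simp) y (by simp) v (by simp) h hyv hxv).1

/-- An edge `xz` puts both blocks in the closed neighbourhood of each; consecutiveness around `x`
gives the edge `xy`, and around `z` the edge `yz`. -/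
theorem IsStraightEnumeration.umbrella {φ : List (Finset V)} (h : IsStraightEnumeration G φ) :
    Umbrella G Finset.univ (fun x => (classIdx φ x : ℤ)) := by
  obtain ⟨hφ, hblock, hconn⟩ := h
  have hlt : ∀ x : V, classIdx φ x < φ.length := fun x =>
    classIdx_lt_iff.2 (hφ.2.2 ▸ Finset.mem_univ x)
  have hmem : ∀ (x : V) (i : Fin φ.length), x ∈ φ.get i ↔ classIdx φ x = i := fun x i =>
    hφ.mem_getElem_iff (Finset.mem_univ x) i.2
  have htwins : ∀ x y, classIdx φ x = classIdx φ y → Twins G Finset.univ x y := by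
    intro x y he
    rw [← closedNbhd_eq_iff_twins]
    exact (hblock (φ.get ⟨_, hlt x⟩) (List.get_mem _ _) x ((hmem _ _).2 rfl) y).1
      ((hmem _ _).2 he.symm)
  have hadj : ∀ x y, (⟨_, hlt y⟩ : Fin φ.length) ∈ {j : Fin φ.length | j = ⟨_, hlt x⟩ ∨
      SetsAdj G (φ.get ⟨_, hlt x⟩) (φ.get j)} ↔ ClosedAdj G x y := by
    intro x y
    constructor
    · rintro (he | ⟨u, hu, v, hv, huv⟩)
      · have he := htwins x y (congrArg Fin.val he).symm
        exact (he y (by simp)).2 (ClosedAdj.refl G y)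
      · exact Twins.closedAdj_congr (U := Finset.univ) (by simp) (by simp)
          (htwins u x ((hmem _ _).1 hu)) (htwins v y ((hmem _ _).1 hv)) (Or.inr huv)
    · rintro (rfl | h)
      · exact Or.inl rfl
      · exact Or.inr ⟨x, (hmem _ _).2 rfl, y, (hmem _ _).2 rfl, h⟩
  intro x _ y _ z _ hxy hyz hxz
  simp only [Nat.cast_le] at hxy hyz
  constructor
  · exact (hadj x y).1 ((hconn _).out ((hadj x x).2 (ClosedAdj.refl G x)) ((hadj x z).2 hxz)
      ⟨hxy, hyz⟩)
  · exact ((hadj z y).1 ((hconn _).out ((hadj z x).2 hxz.symm) ((hadj z z).2 (ClosedAdj.refl G z))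
      ⟨hxy, hyz⟩)).symm

/-- Every linear order that spans cliques by edges is compatible with a straight enumeration. -/
theorem Umbrella.exists_isStraightEnumeration {p : V → ℤ} (hp : Umbrella G Finset.univ p)
    (h0 : ∀ x, 0 ≤ p x) :
    ∃ φ, IsStraightEnumeration G φ ∧ ∀ x y, WeakLT φ x y → p x < p y := by
  obtain ⟨f, hf, hfr, hfp⟩ := hp.exists_blockRank
  have hf0 : ∀ x, 0 ≤ f x := fun x => by
    obtain ⟨x', -, he⟩ := hfr x (by simp)
    exact he ▸ h0 x'
  have hlt : ∀ x y, WeakLT (ofRank (fun x => (f x).toNat) Finset.univ) x y ↔ f x < f y := by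
    intro x y
    rw [weakLT_ofRank]
    have := hf0 x
    have := hf0 y
    simp
    omega
  exact ⟨_, hf.isStraightEnumeration (isWeakOrder_ofRank _ _) hlt,
    fun x y hxy => hfp x (by simp) y (by simp) ((hlt x y).1 hxy)⟩

end StraightEnumerations

/-! ### From level graphs to Robinson rankings and permutations. -/

section RankLemmas

variable {n : ℕ}

/-- The sum of the positions of the classes is a rank for the common refinement of compatible weak
linear orders. -/
theorem sum_classIdx_lt {ι : Type*} {V : Type*} [DecidableEq V] [Fintype V] {s : Finset ι}
    {χ : ι → List (Finset V)}
    (hχ : ∀ i ∈ s, IsWeakOrder (χ i) Finset.univ) (hc : ∀ i ∈ s, ∀ j ∈ s, Compatible (χ i) (χ j))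
    {i : ι} (hi : i ∈ s) {x y : V} (h : classIdx (χ i) x < classIdx (χ i) y) :
    ∑ j ∈ s, classIdx (χ j) x < ∑ j ∈ s, classIdx (χ j) y := by
  refine Finset.sum_lt_sum (fun j hj => not_lt.1 fun hlt => ?_) ⟨i, hi, h⟩
  exact hc i hi j hj ⟨x, y, (hχ i hi).weakLT_iff.2 ⟨by simp, by simp, h⟩,
    (hχ j hj).weakLT_iff.2 ⟨by simp, by simp, hlt⟩⟩

/-- The linear order that sorts by `S` and breaks ties by the natural order. -/
def tieBreak (S : Fin n → ℕ) (x : Fin n) : ℤ := (S x * n + x : ℕ)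

theorem tieBreak_lt {S : Fin n → ℕ} {x y : Fin n} (h : S x < S y) :
    tieBreak S x < tieBreak S y := by
  have h1 := Nat.mul_le_mul_right n (Nat.succ_le_of_lt h)
  rw [Nat.succ_mul] at h1
  have := x.2
  simp only [tieBreak, Nat.cast_lt]
  omega

theorem le_of_tieBreak_lt {S : Fin n → ℕ} {x y : Fin n} (h : tieBreak S x < tieBreak S y) :
    S x ≤ S y := not_lt.1 fun hlt => h.not_gt (tieBreak_lt hlt)

theorem tieBreak_injective (S : Fin n → ℕ) : Function.Injective (tieBreak S) := by
  intro x y h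
  rcases lt_trichotomy (S x) (S y) with hlt | heq | hgt
  · exact absurd h (tieBreak_lt hlt).ne
  · simp only [tieBreak, Nat.cast_inj, heq] at h
    exact Fin.ext (by omega)
  · exact absurd h (tieBreak_lt hgt).ne'

theorem levelGraph_adj {A : Matrix (Fin n) (Fin n) ℝ} (hA : A.IsSymm) {α : ℝ} {x y : Fin n} :
    (levelGraph A α).Adj x y ↔ x ≠ y ∧ α ≤ A x y := by
  rw [levelGraph, SimpleGraph.fromRel_adj, hA.apply x y, or_self]

theorem mem_nonzeroValues_univ {A : Matrix (Fin n) (Fin n) ℝ} {α : ℝ} :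
    α ∈ nonzeroValues A Finset.univ ↔ (∃ x y, A x y = α) ∧ α ≠ 0 := by
  simp [nonzeroValues]

theorem IsRobinsonRank.umbrella_levelGraph {A : Matrix (Fin n) (Fin n) ℝ} (hA : A.IsSymm)
    {ψ : List (Finset (Fin n))} {p : Fin n → ℤ} (h : IsRobinsonRank A Finset.univ ψ p) (α : ℝ) :
    Umbrella (levelGraph A α) Finset.univ p := by
  intro x hx y hy z hz hxy hyz hxz
  rcases hxy.eq_or_lt with he | hxy
  · obtain rfl := h.inj (by simp) (by simp) he
    exact ⟨ClosedAdj.refl _ _, hxz⟩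
  rcases hyz.eq_or_lt with he | hyz
  · obtain rfl := h.inj (by simp) (by simp) he
    exact ⟨hxz, ClosedAdj.refl _ _⟩
  have hα := ((levelGraph_adj hA).1 (hxz.adj fun he => (hxy.trans hyz).ne (congrArg p he))).2
  obtain ⟨h1, h2⟩ := h.le x hx y hy z hz hxy hyz
  exact ⟨Or.inr ((levelGraph_adj hA).2 ⟨fun he => hxy.ne (congrArg p he), hα.trans h1⟩),
    Or.inr ((levelGraph_adj hA).2 ⟨fun he => hyz.ne (congrArg p he), hα.trans h2⟩)⟩

/-- A correct output of Robinson is compatible with straight enumerations of the level graphs. -/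
theorem IsRobinsonOutput.exists_isStraightEnumeration {A : Matrix (Fin n) (Fin n) ℝ}
    (hA : A.IsSymm) {ψ Φ : List (Finset (Fin n))} (h : IsRobinsonOutput A Finset.univ ψ Φ) (α : ℝ) :
    ∃ φ, IsStraightEnumeration (levelGraph A α) φ ∧ Compatible Φ φ := by
  have hlt : ∀ x y, WeakLT Φ x y → tieBreak (classIdx Φ) x < tieBreak (classIdx Φ) y :=
    fun x y hxy => tieBreak_lt (h.weak.weakLT_iff.1 hxy).2.2
  -- One fixed linear extension of `Φ` serves all levels: every enumeration obtained from it is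
  -- compatible with `Φ`.
  have hp : IsRobinsonRank A Finset.univ Φ (tieBreak (classIdx Φ)) := by
    refine ⟨(tieBreak_injective _).injOn, hlt, fun x hx y hy z hz hxy hyz => ?_⟩
    exact h.robinson x hx y hy z hz (fun he => hxy.ne (congrArg _ he))
      (fun he => hyz.ne (congrArg _ he)) (fun he => (hxy.trans hyz).ne (congrArg _ he))
      (fun h' => hxy.not_gt (hlt y x h')) (fun h' => hyz.not_gt (hlt z y h'))
  obtain ⟨φ, hφ, hφlt⟩ := (hp.umbrella_levelGraph hA α).exists_isStraightEnumeration
    fun x => by simp [tieBreak]; positivity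
  refine ⟨φ, hφ, ?_⟩
  rintro ⟨x, y, hxy, hyx⟩
  exact (hlt x y hxy).not_gt (hφlt y x hyx)

/-- Compatible straight enumerations of the level graphs yield a Robinson ordering. -/
theorem exists_isRobinsonRank {A : Matrix (Fin n) (Fin n) ℝ} (hA : A.IsSymm)
    (h0 : ∀ i j, 0 ≤ A i j) {ψ : List (Finset (Fin n))} (hψ : IsWeakOrder ψ Finset.univ)
    {φ : ℝ → List (Finset (Fin n))}
    (hφ : ∀ α ∈ nonzeroValues A Finset.univ,
      IsStraightEnumeration (levelGraph A α) (φ α) ∧ Compatible (φ α) ψ)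
    (hc : ∀ α ∈ nonzeroValues A Finset.univ, ∀ β ∈ nonzeroValues A Finset.univ,
      Compatible (φ α) (φ β)) : ∃ p, IsRobinsonRank A Finset.univ ψ p := by
  -- The order `ψ` joins the family of enumerations under the index `none`, so that the sum of
  -- positions extends it as well.
  set s : Finset (Option ℝ) := Finset.insertNone (nonzeroValues A Finset.univ) with hs
  set χ : Option ℝ → List (Finset (Fin n)) := fun o => o.elim ψ φ with hχ
  have hw : ∀ i ∈ s, IsWeakOrder (χ i) Finset.univ := by
    intro i hi
    cases i with
    | none => exact hψ
    | some α => exact (hφ α (Finset.some_mem_insertNone.1 hi)).1.1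
  have hsymm : ∀ {ψ₁ ψ₂ : List (Finset (Fin n))}, Compatible ψ₁ ψ₂ → Compatible ψ₂ ψ₁ :=
    fun h ⟨x, y, h1, h2⟩ => h ⟨y, x, h2, h1⟩
  have hcomp : ∀ i ∈ s, ∀ j ∈ s, Compatible (χ i) (χ j) := by
    intro i hi j hj
    cases i with
    | none =>
      cases j with
      | none =>
        rintro ⟨x, y, h1, h2⟩
        exact (hψ.weakLT_iff.1 h1).2.2.not_gt (hψ.weakLT_iff.1 h2).2.2
      | some β => exact hsymm (hφ β (Finset.some_mem_insertNone.1 hj)).2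
    | some α =>
      cases j with
      | none => exact (hφ α (Finset.some_mem_insertNone.1 hi)).2
      | some β => exact hc α (Finset.some_mem_insertNone.1 hi) β (Finset.some_mem_insertNone.1 hj)
  set S : Fin n → ℕ := fun x => ∑ i ∈ s, classIdx (χ i) x
  have hS : ∀ i ∈ s, ∀ x y, classIdx (χ i) x < classIdx (χ i) y → S x < S y :=
    fun i hi x y h => sum_classIdx_lt hw hcomp hi h
  refine ⟨tieBreak S, (tieBreak_injective S).injOn, fun x y hxy => ?_, ?_⟩
  · exact tieBreak_lt (hS none (by simp [hs]) x y (hψ.weakLT_iff.1 hxy).2.2)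
  · intro x _ y _ z _ hxy hyz
    by_cases hz : A x z = 0
    · rw [hz]
      exact ⟨h0 x y, h0 y z⟩
    -- The level to look at is `A x z` itself: there `xz` is an edge, and edges `xy`, `yz` are the
    -- two inequalities.
    have hα : A x z ∈ nonzeroValues A Finset.univ := mem_nonzeroValues_univ.2 ⟨⟨x, z, rfl⟩, hz⟩
    have hle : ∀ u v, tieBreak S u < tieBreak S v →
        classIdx (φ (A x z)) u ≤ classIdx (φ (A x z)) v := fun u v h => not_lt.1 fun hlt =>
      (le_of_tieBreak_lt h).not_gt (hS (some (A x z)) (Finset.some_mem_insertNone.2 hα) v u hlt)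
    have hne1 : x ≠ y := fun he => hxy.ne (congrArg _ he)
    have hne2 : y ≠ z := fun he => hyz.ne (congrArg _ he)
    have hne3 : x ≠ z := fun he => (hxy.trans hyz).ne (congrArg _ he)
    obtain ⟨h1, h2⟩ := (hφ _ hα).1.umbrella x (by simp) y (by simp) z (by simp)
      (Int.ofNat_le.2 (hle x y hxy)) (Int.ofNat_le.2 (hle y z hyz))
      (Or.inr ((levelGraph_adj hA).2 ⟨hne3, le_rfl⟩))
    exact ⟨((levelGraph_adj hA).1 (h1.adj hne1)).2, ((levelGraph_adj hA).1 (h2.adj hne2)).2⟩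

theorem weakLT_permOrder {π : Equiv.Perm (Fin n)} {x y : Fin n} :
    WeakLT (permOrder π) x y ↔ ∃ i j, i < j ∧ x = π i ∧ y = π j := by
  simp only [weakLT_iff_getElem, permOrder, List.getElem_map, List.getElem_finRange,
    Finset.mem_singleton, List.length_map, List.length_finRange]
  constructor
  · rintro ⟨i, j, hi, hj, hij, hx, hy⟩
    exact ⟨⟨i, hi⟩, ⟨j, hj⟩, hij, hx, hy⟩
  · rintro ⟨i, j, hij, hx, hy⟩
    exact ⟨i, j, i.2, j.2, hij, hx, hy⟩

theorem exists_compatible_permOrder {Φ : List (Finset (Fin n))} (hΦ : IsWeakOrder Φ Finset.univ) :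
    ∃ π : Equiv.Perm (Fin n), Compatible (permOrder π) Φ := by
  refine ⟨Tuple.sort (classIdx Φ), ?_⟩
  rintro ⟨x, y, hxy, hyx⟩
  obtain ⟨i, j, hij, rfl, rfl⟩ := weakLT_permOrder.1 hxy
  exact (hΦ.weakLT_iff.1 hyx).2.2.not_ge (Tuple.monotone_sort (classIdx Φ) hij.le)

theorem IsRobinsonOutput.isRobinson {A : Matrix (Fin n) (Fin n) ℝ} (hA : A.IsSymm)
    (hdiag : ∀ i j, A i j ≤ A i i) {ψ Φ : List (Finset (Fin n))}
    (h : IsRobinsonOutput A Finset.univ ψ Φ) {π : Equiv.Perm (Fin n)}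
    (hπ : Compatible (permOrder π) Φ) : IsRobinson (A.submatrix π π) := by
  intro i j k hij hjk
  simp only [Matrix.submatrix_apply]
  -- Coinciding indices bring in diagonal entries; only here is their dominance needed.
  rcases hij.eq_or_lt with rfl | hij
  · exact le_min (hdiag _ _) le_rfl
  rcases hjk.eq_or_lt with rfl | hjk
  · exact le_min le_rfl (hA.apply (π j) (π i) ▸ hdiag _ _)
  have hn : ∀ i j, i < j → ¬ WeakLT Φ (π j) (π i) := fun i j hij hlt =>
    hπ ⟨π i, π j, weakLT_permOrder.2 ⟨i, j, hij, rfl, rfl⟩, hlt⟩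
  obtain ⟨h1, h2⟩ := h.robinson (π i) (by simp) (π j) (by simp) (π k) (by simp)
    (fun he => hij.ne (π.injective he)) (fun he => hjk.ne (π.injective he))
    (fun he => (hij.trans hjk).ne (π.injective he)) (hn i j hij) (hn j k hjk)
  exact le_min h1 h2

theorem IsRobinsonian.exists_isRobinsonRank {A : Matrix (Fin n) (Fin n) ℝ} (h : IsRobinsonian A) :
    ∃ p, IsRobinsonRank A Finset.univ (oneClass Finset.univ) p := by
  obtain ⟨π, hπ⟩ := h
  refine ⟨fun x => ((π.symm x : ℕ) : ℤ), ?_, fun x y hxy => absurd hxy not_weakLT_oneClass, ?_⟩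
  · intro x _ y _ hxy
    exact π.symm.injective (Fin.ext (Int.ofNat_inj.1 hxy))
  · intro x _ y _ z _ hxy hyz
    have := hπ (π.symm x) (π.symm y) (π.symm z) (Fin.le_def.2 (Int.ofNat_lt.1 hxy).le)
      (Fin.le_def.2 (Int.ofNat_lt.1 hyz).le)
    simpa using this

end RankLemmas

/-! ### The main theorem. -/

theorem mainTheorem3 (n : ℕ) (A : Matrix (Fin n) (Fin n) ℝ) (hsymm : A.IsSymm)
    (hnonneg : ∀ i j, 0 ≤ A i j) :
    (∀ ψ : List (Finset (Fin n)), IsWeakOrder ψ Finset.univ →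
      (robinson A Finset.univ ψ).Nonempty ∧
      (∀ Φ : List (Finset (Fin n)), some Φ ∈ robinson A Finset.univ ψ →
        IsWeakOrder Φ Finset.univ ∧ Compatible Φ ψ ∧
        ∃ φ : ℝ → List (Finset (Fin n)), ∀ α ∈ nonzeroValues A Finset.univ,
          IsStraightEnumeration (levelGraph A α) (φ α) ∧ Compatible Φ (φ α)) ∧
      (none ∈ robinson A Finset.univ ψ →
        ¬ ∃ φ : ℝ → List (Finset (Fin n)),
          (∀ α ∈ nonzeroValues A Finset.univ,
            IsStraightEnumeration (levelGraph A α) (φ α) ∧ Compatible (φ α) ψ) ∧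
          (∀ α ∈ nonzeroValues A Finset.univ, ∀ β ∈ nonzeroValues A Finset.univ,
            Compatible (φ α) (φ β)))) ∧
    ((∀ i j, A i j ≤ A i i) →
      (robinsonian A).Nonempty ∧
      (∀ π : Equiv.Perm (Fin n), some π ∈ robinsonian A → IsRobinson (A.submatrix π π)) ∧
      (none ∈ robinsonian A → ¬ IsRobinsonian A)) := by
  constructor
  · intro ψ hψ
    have h := robinson_correct hsymm hnonneg hψ
    refine ⟨h.nonempty, fun Φ hΦ => ?_, ?_⟩
    · have hout := h.sound Φ hΦ
      choose φ hφ using fun α => hout.exists_isStraightEnumeration hsymm α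
      refine ⟨hout.weak, ?_, φ, fun α _ => hφ α⟩
      rintro ⟨x, y, hxy, hyx⟩
      exact (hout.weak.weakLT_iff.1 hxy).2.2.not_gt
        (hout.weak.weakLT_iff.1 (hout.refines y x hyx)).2.2
    · rintro hnone ⟨φ, hφ, hc⟩
      obtain ⟨p, hp⟩ := exists_isRobinsonRank hsymm hnonneg hψ hφ hc
      exact h.complete hnone p hp
  · intro hdiag
    have h := robinson_correct hsymm hnonneg (isWeakOrder_oneClass (Finset.univ : Finset (Fin n)))
    refine ⟨?_, ?_, ?_⟩
    · obtain ⟨r, hr⟩ := h.nonempty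
      cases r with
      | none => exact ⟨none, none, hr, trivial⟩
      | some Φ =>
        obtain ⟨π, hπ⟩ := exists_compatible_permOrder (h.sound Φ hr).weak
        exact ⟨some π, some Φ, hr, hπ⟩
    · rintro π ⟨r, hr, hπ⟩
      cases r with
      | none => exact hπ.elim
      | some Φ => exact (h.sound Φ hr).isRobinson hsymm hdiag hπ
    · rintro ⟨r, hr, hπ⟩ hA
      cases r with
      | none =>
        obtain ⟨p, hp⟩ := hA.exists_isRobinsonRank
        exact h.complete hr p hp
      | some Φ => exact hπ.elim
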